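/- \textbf{Problem.} For a shape that is either the closed axis-parallel unit square or the closed unit disk, an instance $(k,V,T)$ of Steiner Tree consists of an integer $k\ge 0$ and two disjoint finite sets $V$ (non-terminals) and $T\neq\emptyset$ (terminals) of translates of the shape in the plane, given by the rational coordinates of their lower left corners (squares) or centers (disks). The question is whether there is a set $S\subseteq V$ with $|S|\le k$ such that the intersection graph of $S\cup T$ is connected. Let $t=|T|$ and let $n$ be the size of the instance, that is, the number of bits of its encoding (so $n\ge |V|+|T|$). \textbf{Hypothesis.} The Exponential Time Hypothesis (ETH) says that there is $\delta>0$ such that 3-SAT with $N$ variables (and pairwise distinct clauses) cannot be solved by a deterministic algorithm in time $O(2^{\delta N})$. Running times are numbers of steps on a random access machine with addition and subtraction as its arithmetic operations, which is polynomially equivalent to Turing machines. \textbf{Theorem.} Assume ETH. Then the following holds for Steiner Tree on intersection graphs of unit squares, and likewise for unit disks. \begin{enumerate} \item There is no algorithm that solves every instance $(k,V,T)$ in time $2^{o(k+t)}\cdot n^{O(1)}$. \item More precisely, for every $b>0$ there is $\varepsilon>0$ such that for every $C>0$ there is no algorithm that solves every instance $(k,V,T)$ in time $C\cdot 2^{\varepsilon(k+t)}\cdot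 n^{b}$. \end{enumerate} -/

import Mathlib

namespace GeomSteiner

/-! ## Machine model

A random access machine with finitely many integer registers and memory arrays, controlled by a
structured program. The elementary instructions are constants, addition, truncated subtraction,
indirect reading and indirect writing; each of them, and each test of a branch or a loop, is one
step. There is no multiplication and no shift, so that `t` steps lengthen the binary expansions of
the numbers by at most `t` bits, and the model is polynomially equivalent to Turing machines. -/

/-- Programs. Registers and arrays are named by natural numbers; a program mentions only finitely
many of them. -/
inductive Program : Type
  /-- `x := n` -/
  | const (x n : ℕ) : Program
  /-- `x := y + z` -/
  | add (x y z : ℕ) : Program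
  /-- `x := y - z`, truncated at `0` -/
  | sub (x y z : ℕ) : Program
  /-- `x := a[y]` -/
  | load (x a y : ℕ) : Program
  /-- `a[x] := y` -/
  | store (a x y : ℕ) : Program
  /-- first `p`, then `q` -/
  | seq (p q : Program) : Program
  /-- if register `x` is nonzero then `p`, else `q` -/
  | ite (x : ℕ) (p q : Program) : Program
  /-- while register `x` is nonzero do `p` -/
  | loop (x : ℕ) (p : Program) : Program

/-- A memory state: the contents of the registers and of the arrays. -/
structure State : Type where
  reg : ℕ → ℕ
  arr : ℕ → ℕ → ℕ

/-- Assign `v` to register `x`. -/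
def State.setReg (s : State) (x v : ℕ) : State :=
  { s with reg := Function.update s.reg x v }

/-- Assign `v` to cell `i` of array `a`. -/
def State.setArr (s : State) (a i v : ℕ) : State :=
  { s with arr := Function.update s.arr a (Function.update (s.arr a) i v) }

/-- `Exec p s t s'`: program `p`, started in state `s`, halts after exactly `t` steps in
state `s'`. -/
inductive Exec : Program → State → ℕ → State → Prop
  | const (s : State) (x n : ℕ) : Exec (.const x n) s 1 (s.setReg x n)
  | add (s : State) (x y z : ℕ) : Exec (.add x y z) s 1 (s.setReg x (s.reg y + s.reg z))
  | sub (s : State) (x y z : ℕ) : Exec (.sub x y z) s 1 (s.setReg x (s.reg y - s.reg z))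
  | load (s : State) (x a y : ℕ) : Exec (.load x a y) s 1 (s.setReg x (s.arr a (s.reg y)))
  | store (s : State) (a x y : ℕ) : Exec (.store a x y) s 1 (s.setArr a (s.reg x) (s.reg y))
  | seq {p q : Program} {s s' s'' : State} {t t' : ℕ} :
      Exec p s t s' → Exec q s' t' s'' → Exec (.seq p q) s (t + t') s''
  | ite_true {p q : Program} {s s' : State} {x t : ℕ} :
      s.reg x ≠ 0 → Exec p s t s' → Exec (.ite x p q) s (t + 1) s'
  | ite_false {p q : Program} {s s' : State} {x t : ℕ} :
      s.reg x = 0 → Exec q s t s' → Exec (.ite x p q) s (t + 1) s'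
  | loop_done {p : Program} {s : State} {x : ℕ} :
      s.reg x = 0 → Exec (.loop x p) s 1 s
  | loop_step {p : Program} {s s' s'' : State} {x t t' : ℕ} :
      s.reg x ≠ 0 → Exec p s t s' → Exec (.loop x p) s' t' s'' →
      Exec (.loop x p) s (t + t' + 1) s''

/-- The initial state on the input `w`: array `0` holds `w`, register `0` holds its length, and
everything else is `0`. -/
def initState (w : List ℕ) : State where
  reg := fun x => if x = 0 then w.length else 0
  arr := fun a i => if a = 0 then w.getD i 0 else 0

/-- The size of an input: its total number of binary digits, plus one separator per number. -/
def bitSize (w : List ℕ) : ℕ := (w.map fun a => a.size + 1).sum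

/-- There is an algorithm that decides, for every instance `I` of a problem, whether `yes I` holds,
in at most `bound I` steps on the input `enc I`. The answer is "yes" if register `0` is nonzero
at the end. -/
def SolvableInTime {Inst : Type} (enc : Inst → List ℕ) (yes : Inst → Prop) (bound : Inst → ℝ) :
    Prop :=
  ∃ p : Program, ∀ I : Inst, ∃ (t : ℕ) (s : State),
    Exec p (initState (enc I)) t s ∧ (t : ℝ) ≤ bound I ∧ (s.reg 0 ≠ 0 ↔ yes I)

/-! ## 3-SAT and the Exponential Time Hypothesis -/

/-- A literal over `n` variables: a variable and its sign (`true` for the positive literal). -/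
abbrev Lit (n : ℕ) : Type := Fin n × Bool

/-- An instance of 3-SAT: a number of variables and a list of pairwise distinct clauses. A clause
is a disjunction of three, not necessarily distinct, literals. -/
structure CNF3 : Type where
  numVars : ℕ
  clauses : List (Lit numVars × Lit numVars × Lit numVars)
  nodup : clauses.Nodup

/-- The formula has a satisfying assignment. -/
def CNF3.Satisfiable (φ : CNF3) : Prop :=
  ∃ α : Fin φ.numVars → Bool, ∀ c ∈ φ.clauses,
    α c.1.1 = c.1.2 ∨ α c.2.1.1 = c.2.1.2 ∨ α c.2.2.1 = c.2.2.2

/-- A literal as input: the index of the variable, and the sign. -/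
def encodeLit {n : ℕ} (l : Lit n) : List ℕ := [(l.1 : ℕ), if l.2 then 1 else 0]

/-- A formula as input: the number of variables, the number of clauses, and the clauses. -/
def CNF3.encode (φ : CNF3) : List ℕ :=
  φ.numVars :: φ.clauses.length ::
    φ.clauses.flatMap fun c => encodeLit c.1 ++ encodeLit c.2.1 ++ encodeLit c.2.2

/-- The Exponential Time Hypothesis: for some `δ > 0`, 3-SAT with `n` variables cannot be solved in
time `O(2 ^ (δ n))`. -/
def ETH : Prop :=
  ∃ δ : ℝ, 0 < δ ∧ ¬ ∃ C : ℝ, 0 < C ∧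
    SolvableInTime CNF3.encode CNF3.Satisfiable fun φ => C * (2 : ℝ) ^ (δ * (φ.numVars : ℝ))

/-! ## Steiner Tree on intersection graphs of unit squares and unit disks -/

/-- The Euclidean plane. -/
abbrev Plane : Type := EuclideanSpace ℝ (Fin 2)

/-- The closed axis-parallel square of side length `1` with lower left corner `p`. -/
def unitSquare (p : ℚ × ℚ) : Set Plane :=
  {z | z 0 ∈ Set.Icc (p.1 : ℝ) (p.1 + 1) ∧ z 1 ∈ Set.Icc (p.2 : ℝ) (p.2 + 1)}

/-- The closed disk of radius `1` with center `p`. -/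
def unitDisk (p : ℚ × ℚ) : Set Plane :=
  Metric.closedBall !₂[(p.1 : ℝ), (p.2 : ℝ)] 1

/-- The intersection graph of a family of objects: two of them are adjacent if they meet. -/
def intersectionGraph {α : Type} (obj : α → Set Plane) : SimpleGraph α where
  Adj a b := a ≠ b ∧ (obj a ∩ obj b).Nonempty
  symm := ⟨fun _ _ h => ⟨h.1.symm, by rw [Set.inter_comm]; exact h.2⟩⟩
  loopless := ⟨fun _ h => h.1 rfl⟩

/-- An instance `(k, V, T)` of Steiner Tree for translates of a fixed shape: the budget `k`, the
positions of the non-terminal objects and the positions of the terminal objects. -/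
structure SteinerInstance : Type where
  k : ℕ
  V : List (ℚ × ℚ)
  T : List (ℚ × ℚ)
  nodup : (V ++ T).Nodup
  terminals_ne_nil : T ≠ []

/-- The number of terminals. -/
def SteinerInstance.t (I : SteinerInstance) : ℕ := I.T.length

/-- At most `k` non-terminal objects can be chosen such that the intersection graph of these and of
all terminal objects is connected. -/
def SteinerInstance.HasSolution (obj : ℚ × ℚ → Set Plane) (I : SteinerInstance) : Prop :=
  ∃ S : Finset (ℚ × ℚ), (∀ p ∈ S, p ∈ I.V) ∧ S.card ≤ I.k ∧
    ((intersectionGraph obj).induce {p | p ∈ S ∨ p ∈ I.T}).Connected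

/-- A rational number as input: its sign, and its numerator and denominator in lowest terms. -/
def encodeRat (q : ℚ) : List ℕ := [if q < 0 then 1 else 0, q.num.natAbs, q.den]

/-- An instance as input: `k`, the numbers of non-terminals and of terminals, the positions. -/
def SteinerInstance.encode (I : SteinerInstance) : List ℕ :=
  I.k :: I.V.length :: I.T.length ::
    (I.V ++ I.T).flatMap fun p => encodeRat p.1 ++ encodeRat p.2

/-- The size of an instance, in bits. It is at least the number of objects. -/
def SteinerInstance.size (I : SteinerInstance) : ℕ := bitSize I.encode

/-- Steiner Tree for the shape `obj` has an algorithm with running time at most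
`C * 2 ^ f (k + t) * n ^ b`, where `n` is the size of the instance. -/
def SteinerSolvable (obj : ℚ × ℚ → Set Plane) (f : ℕ → ℝ) (C b : ℝ) : Prop :=
  SolvableInTime SteinerInstance.encode (SteinerInstance.HasSolution obj)
    fun I => C * (2 : ℝ) ^ f (I.k + I.t) * (I.size : ℝ) ^ b

/-- There is no algorithm for the shape `obj` with running time `2 ^ o(k + t) * n ^ O(1)`. -/
def NoSubexponentialAlgorithm (obj : ℚ × ℚ → Set Plane) : Prop :=
  ¬ ∃ (f : ℕ → ℝ) (C b : ℝ), f =o[Filter.atTop] (fun m : ℕ => (m : ℝ)) ∧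
    SteinerSolvable obj f C b

/-- For every `b > 0` there is `ε > 0` such that for no `C > 0` there is an algorithm for the shape
`obj` with running time `C * 2 ^ (ε * (k + t)) * n ^ b`. -/
def UniformExponentialLowerBound (obj : ℚ × ℚ → Set Plane) : Prop :=
  ∀ b : ℝ, 0 < b → ∃ ε : ℝ, 0 < ε ∧ ∀ C : ℝ, 0 < C →
    ¬ SteinerSolvable obj (fun m => ε * (m : ℝ)) C b

end GeomSteiner

/-! Fix an integer `r`. The variables of a formula with `N` variables are split into `r` residue
classes, and each of `r ^ 3` rows takes the union of at most three classes. Every clause then lies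
inside some row (`exists_row`), while a row has only `2 ^ O(N / r)` partial assignments
(`lanes_rowSet_length_le`). Every partial assignment that violates no clause inside its row becomes
an explicit non-terminal. So the instance has `2 ^ O(N / r)` objects, but its budget and its number
of terminals are linear in `N` for fixed `r` (`parameter_le`). If `r` is large compared to `(1 + b)
/ δ`, then writing the instance and the factor `n ^ b` are both affordable, and an algorithm with a
small enough `ε` decides 3-SAT in time `O(2 ^ (δ N))`. Clauses only filter candidates and do not
enter the parameter, so the bound `8 N ^ 3` on their number suffices and no sparsification is
needed.

Rows must agree on their common variables although the objects live in the plane. Each row owns two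
neighbouring tracks, and along a track the chosen labels can only decrease. The even track stores a
number whose digits are the assignment, the odd track its complement, so the number falls on one
track and rises on the other. A checkpoint between neighbouring tracks enforces an implication
between one bit of each. Pass 0 compares the two numbers of a row digit by digit in one direction,
pass 3 in the other; with monotonicity this makes both numbers equal and constant in between. Passes
1 and 2 carry every bit across all tracks, upward and downward; a row without the current variable
has a free bit that relays it. This is `satisfiable_of_feasible`; `feasible_of_satisfiable` is the
converse.

Geometrically, a label is a horizontal offset on a coarse grid: objects in consecutive columns of a
track meet if and only if the offset does not grow. A private terminal forces a candidate in every
slot, and a pair of terminals forces a connector at every checkpoint. The budget is exactly the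
number of these demands, so nothing else can be bought, and cuts read off monotonicity and
checkpoints (`Linked.feasible`). All intended contacts are nearly horizontal or nearly vertical, so
that they occur even for disks, and even squares have no further contacts; one layout thus serves
both shapes (`ShapeGrid`).

The running time is certified by an explicit program (`Program.reduction`,
`Program.reduction_spec`). Quantities that depend only on `r` are hard-coded, products are repeated
additions or doublings, and all step bounds are powers of one number `Y` of order `2 ^ (3 N / r)` up
to a constant. The given solver is run afterwards in untouched memory. -/

namespace GeomSteiner

/-! ## A track selection problem -/

/-- Tracks `0, …, P - 1` with positions `1, …, L`. At every position of a track one of finitely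
many candidates is to be chosen, each of which has a label below `A` and may or may not touch its
checkpoint. -/
structure TrackSystem where
  P : ℕ
  L : ℕ
  A : ℕ
  cand : ℕ → ℕ → List (ℕ × Bool)
  label_lt : ∀ τ s c, c ∈ cand τ s → c.1 < A
  label_nodup : ∀ τ s, ((cand τ s).map Prod.fst).Nodup
  P_pos : 0 < P
  A_pos : 0 < A

namespace TrackSystem

/-- Between the tracks `τ` and `τ + 1` there is a checkpoint at position `s`. -/
def Check (Θ : TrackSystem) (τ s : ℕ) : Prop := τ + 1 < Θ.P ∧ (τ + s) % 2 = 0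

instance (Θ : TrackSystem) (τ s : ℕ) : Decidable (Θ.Check τ s) := by
  unfold Check; infer_instance

/-- There is a choice with nonincreasing labels on every track, such that every checkpoint is
touched from below or from above. -/
def Feasible (Θ : TrackSystem) : Prop :=
  ∃ σ : ℕ → ℕ → ℕ × Bool,
    (∀ τ s, τ < Θ.P → 1 ≤ s → s ≤ Θ.L → σ τ s ∈ Θ.cand τ s) ∧
    (∀ τ s, τ < Θ.P → 1 ≤ s → s + 1 ≤ Θ.L → (σ τ (s + 1)).1 ≤ (σ τ s).1) ∧
    (∀ τ s, 1 ≤ s → s ≤ Θ.L → Θ.Check τ s → (σ τ s).2 = true ∨ (σ (τ + 1) s).2 = true)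

end TrackSystem

/-! ## Objects and their positions -/

/-- The objects of the construction: candidates, their private terminals, connectors, the lower and
the upper terminal of a checkpoint, and the terminals of the trunk. -/
inductive Ob : Type
  | slot (τ s : ℕ) (c : ℕ × Bool) : Ob
  | priv (τ s : ℕ) : Ob
  | conn (τ s : ℕ) : Ob
  | lower (τ s : ℕ) : Ob
  | upper (τ s : ℕ) : Ob
  | trunk (j : ℕ) : Ob
  deriving DecidableEq

namespace Ob

/-- The column of an object. -/
def col : Ob → ℕ
  | slot _ s _ => s
  | priv _ s => s
  | conn _ s => s
  | lower _ s => s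
  | upper _ s => s
  | trunk _ => 0

/-- The level of an object. -/
def lev : Ob → ℕ
  | slot τ _ _ => 5 * τ + 5
  | priv τ s => if (τ + s) % 2 = 0 then 5 * τ + 4 else 5 * τ + 6
  | conn τ s => if (τ + s) % 2 = 0 then 5 * τ + 6 else 5 * τ + 4
  | lower τ _ => 5 * τ + 7
  | upper τ _ => 5 * τ + 8
  | trunk j => j

/-- The horizontal offset of an object within its column. -/
def offX (Θ : TrackSystem) : Ob → ℕ
  | slot _ _ c => 2 * Θ.L + 2 + 2 * c.1
  | priv τ s => if (τ + s) % 2 = 0 then 2 * s + (2 * Θ.L + 2 + 2 * Θ.A) else 2 * s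
  | conn τ s => if (τ + s) % 2 = 0 then 2 * s else 2 * s + (2 * Θ.L + 2 + 2 * Θ.A)
  | lower _ s => 2 * s
  | upper _ s => 2 * s + (2 * Θ.L + 2 + 2 * Θ.A)
  | trunk j => if j % 5 = 0 then 2 * Θ.L + 2 * Θ.A else 0

/-- The vertical offset of an object within its level. -/
def offY : Ob → ℕ
  | slot τ s c => 6 * s + (if c.2 then (if (τ + s) % 2 = 0 then 4 else 0) else 2)
  | priv τ s => if (τ + s) % 2 = 0 then 6 * s + 4 else 6 * s
  | conn τ s => if (τ + s) % 2 = 0 then 6 * s + 4 else 6 * s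
  | lower _ s => 6 * s + 2
  | upper _ s => 6 * s + 2
  | trunk _ => 2

/-- The lattice point of an object on a grid of mesh `G`. -/
def pos (Θ : TrackSystem) (G : ℕ) (o : Ob) : ℕ × ℕ :=
  (o.col * G + o.offX Θ, o.lev * G + o.offY)

/-- The non-terminal objects of the construction. -/
def IsV (Θ : TrackSystem) : Ob → Prop
  | slot τ s c => τ < Θ.P ∧ 1 ≤ s ∧ s ≤ Θ.L ∧ c ∈ Θ.cand τ s
  | conn τ s => τ < Θ.P ∧ 1 ≤ s ∧ s ≤ Θ.L ∧ ((τ + s) % 2 = 0 → τ + 1 < Θ.P) ∧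
      ((τ + s) % 2 ≠ 0 → 0 < τ)
  | _ => False

/-- The terminals of the construction. -/
def IsT (Θ : TrackSystem) : Ob → Prop
  | priv τ s => τ < Θ.P ∧ 1 ≤ s ∧ s ≤ Θ.L
  | lower τ s => 1 ≤ s ∧ s ≤ Θ.L ∧ Θ.Check τ s
  | upper τ s => 1 ≤ s ∧ s ≤ Θ.L ∧ Θ.Check τ s
  | trunk j => 5 ≤ j ∧ j < 5 * Θ.P + 5
  | _ => False

/-- The objects of the construction. -/
def IsObj (Θ : TrackSystem) (o : Ob) : Prop := o.IsV Θ ∨ o.IsT Θ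

end Ob

/-- A mesh that is large compared to all offsets. -/
def LargeMesh (Θ : TrackSystem) (G : ℕ) : Prop := (2 * Θ.L + 2 + 2 * Θ.A + 100) ^ 2 ≤ G

/-- Two lattice points differ by at most `W` in both coordinates. -/
def SquareNear (W : ℕ) (p q : ℕ × ℕ) : Prop :=
  (p.1 ≤ q.1 + W ∧ q.1 ≤ p.1 + W) ∧ (p.2 ≤ q.2 + W ∧ q.2 ≤ p.2 + W)

/-- Two lattice points have Euclidean distance at most `W`. -/
def DiskNear (W : ℕ) (p q : ℕ × ℕ) : Prop :=
  ((p.1 : ℤ) - q.1) ^ 2 + ((p.2 : ℤ) - q.2) ^ 2 ≤ (W : ℤ) ^ 2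

theorem SquareNear.symm {W : ℕ} {p q : ℕ × ℕ} (h : SquareNear W p q) : SquareNear W q p :=
  ⟨⟨h.1.2, h.1.1⟩, ⟨h.2.2, h.2.1⟩⟩

/-- What nearness of two coordinates says about their grid lines and offsets. -/
def Close (c r c' r' : ℕ) : Prop := c' = c ∨ (c' = c + 1 ∧ r' ≤ r + 1) ∨ (c = c' + 1 ∧ r ≤ r' + 1)

/-- The reach `G + 1` exceeds the mesh by one, so passing to the next grid line leaves room for the
offset to grow by at most one. All offsets of the layout are even, hence there the condition says
that the offset does not grow. The extra unit is what disks need for deviations perpendicular to the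
grid direction. -/
theorem close_of_near {G c r c' r' : ℕ} (hr : r + 1 < G) (hr' : r' + 1 < G)
    (h : c * G + r ≤ c' * G + r' + (G + 1)) (h' : c' * G + r' ≤ c * G + r + (G + 1)) :
    Close c r c' r' := by
  have h1 : c < c' + 2 := by
    by_contra hc
    have := Nat.mul_le_mul_right G (not_lt.mp hc)
    rw [Nat.add_mul] at this; omega
  have h2 : c' < c + 2 := by
    by_contra hc
    have := Nat.mul_le_mul_right G (not_lt.mp hc)
    rw [Nat.add_mul] at this; omega
  have h3 : c' = c ∨ c' = c + 1 ∨ c = c' + 1 := by omega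
  rcases h3 with h3 | h3 | h3
  · exact Or.inl h3
  · subst h3; rw [Nat.add_mul] at h h'; exact Or.inr (Or.inl ⟨rfl, by omega⟩)
  · subst h3; rw [Nat.add_mul] at h h'; exact Or.inr (Or.inr ⟨rfl, by omega⟩)

namespace Ob

variable {Θ : TrackSystem} {G : ℕ}

theorem _root_.GeomSteiner.LargeMesh.le (hG : LargeMesh Θ G) :
    100 * (2 * Θ.L + 2 + 2 * Θ.A + 100) ≤ G := by
  unfold LargeMesh at hG; nlinarith

theorem offX_lt (hG : LargeMesh Θ G) {o : Ob} (ho : o.IsObj Θ) : o.offX Θ + 1 < G := by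
  have := hG.le
  cases o <;> simp only [IsObj, IsV, IsT, offX, false_or, or_false] at ho ⊢
  · have := Θ.label_lt _ _ _ ho.2.2.2; omega
  all_goals first | omega | (split_ifs <;> omega)

theorem offY_lt (hG : LargeMesh Θ G) {o : Ob} (ho : o.IsObj Θ) : o.offY + 1 < G := by
  have := hG.le
  cases o <;> simp only [IsObj, IsV, IsT, offY, false_or, or_false] at ho ⊢ <;>
    first | omega | (split_ifs <;> omega)

theorem close_of_squareNear (hG : LargeMesh Θ G) {o o' : Ob} (ho : o.IsObj Θ) (ho' : o'.IsObj Θ)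
    (h : SquareNear (G + 1) (o.pos Θ G) (o'.pos Θ G)) :
    Close o.col (o.offX Θ) o'.col (o'.offX Θ) ∧ Close o.lev o.offY o'.lev o'.offY :=
  ⟨close_of_near (offX_lt hG ho) (offX_lt hG ho') h.1.1 h.1.2,
    close_of_near (offY_lt hG ho) (offY_lt hG ho') h.2.1 h.2.2⟩

/-- The possible adjacencies of objects, for one order of their kinds. -/
def Rel : Ob → Ob → Prop
  | slot τ s c, slot τ' s' c' => τ = τ' ∧
      (s = s' ∨ (s' = s + 1 ∧ c'.1 ≤ c.1) ∨ (s = s' + 1 ∧ c.1 ≤ c'.1))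
  | slot τ s _, priv τ' s' => τ = τ' ∧ s = s'
  | slot τ s c, conn τ' s' => τ = τ' ∧ s = s' ∧ c.2 = true
  | slot _ s _, trunk _ => s = 1
  | priv τ s, priv τ' s' => τ = τ' ∧ s = s'
  | conn τ s, conn τ' s' => τ = τ' ∧ s = s'
  | conn τ s, lower τ' s' => τ = τ' ∧ s = s'
  | conn τ s, upper τ' s' => τ = τ' + 1 ∧ s = s'
  | lower τ s, lower τ' s' => τ = τ' ∧ s = s'
  | lower τ s, upper τ' s' => τ = τ' ∧ s = s'
  | upper τ s, upper τ' s' => τ = τ' ∧ s = s'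
  | trunk _, trunk _ => True
  | _, _ => False

/-- A rank of the kinds of objects. -/
def kind : Ob → ℕ
  | slot _ _ _ => 0
  | priv _ _ => 1
  | conn _ _ => 2
  | lower _ _ => 3
  | upper _ _ => 4
  | trunk _ => 5

/-- The offsets are designed for this case check. Labels sit in the horizontal offset of slots,
which gives the label inequality for consecutive columns. Objects attached above a track have the
small horizontal offset `2 * s`, those below a large one; this separates them from the slots of one
neighbouring column, and the vertical shift `6 * s` separates them from those of the other. A
touching slot is shifted by 2 towards its connector, which decides that contact but not the one with
the private terminal on the opposite side. -/
theorem rel_of_squareNear_of_kind_le (hG : LargeMesh Θ G) {o o' : Ob} (ho : o.IsObj Θ)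
    (ho' : o'.IsObj Θ) (hk : o.kind ≤ o'.kind)
    (h : SquareNear (G + 1) (o.pos Θ G) (o'.pos Θ G)) : Rel o o' := by
  obtain ⟨hx, hy⟩ := close_of_squareNear hG ho ho' h
  have hA := Θ.A_pos
  clear h hG
  cases o with
  | slot τ s c =>
    simp only [IsObj, IsV, IsT, or_false] at ho
    have hc := Θ.label_lt _ _ _ ho.2.2.2
    cases o' with
    | slot τ' s' c' =>
      simp only [IsObj, IsV, IsT, or_false] at ho'
      have hc' := Θ.label_lt _ _ _ ho'.2.2.2
      simp only [Close, col, lev, offX, offY, Rel] at *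
      omega
    | conn τ' s' =>
      rcases c with ⟨a, b⟩
      cases b <;> simp only [Close, col, lev, offX, offY, Rel, IsObj, IsV, IsT, or_false, if_true,
        Bool.false_eq_true, if_false, and_true, and_false] at * <;> split_ifs at * <;> omega
    | trunk j =>
      simp only [Close, col, lev, offX, offY, Rel, IsObj, IsV, IsT, false_or] at *
      omega
    | _ =>
      simp only [Close, col, lev, offX, offY, Rel, IsObj, IsV, IsT, false_or] at *
      split_ifs at * <;> omega
  | _ =>
    cases o' <;> first
      | (simp only [kind] at hk; omega)
      | (simp only [Close, col, lev, offX, offY, Rel, IsObj, IsV, IsT, TrackSystem.Check,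
          or_false, false_or] at *
         all_goals first
          | omega
          | ((try split_ifs at hx) <;> (try split_ifs at hy) <;> first
             | omega
             | (simp only [false_and, false_or] at hx; omega)))

theorem rel_of_squareNear (hG : LargeMesh Θ G) {o o' : Ob} (ho : o.IsObj Θ)
    (ho' : o'.IsObj Θ) (h : SquareNear (G + 1) (o.pos Θ G) (o'.pos Θ G)) :
    Rel o o' ∨ Rel o' o := by
  rcases le_total o.kind o'.kind with hk | hk
  · exact Or.inl (rel_of_squareNear_of_kind_le hG ho ho' hk h)
  · exact Or.inr (rel_of_squareNear_of_kind_le hG ho' ho hk h.symm)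

end Ob
end GeomSteiner

/-! ### Injectivity of the layout, and its intended contacts for disks -/

namespace GeomSteiner
namespace Ob

variable {Θ : TrackSystem} {G : ℕ}

/-- Offsets are below the mesh, so division by `G` recovers column, level and both offsets. Within
one slot the label alone determines the candidate, by `label_nodup`. -/
theorem pos_injOn (hG : LargeMesh Θ G) {o o' : Ob} (ho : o.IsObj Θ) (ho' : o'.IsObj Θ)
    (h : o.pos Θ G = o'.pos Θ G) : o = o' := by
  have key : ∀ {a b r r' : ℕ}, r + 1 < G → r' + 1 < G → a * G + r = b * G + r' →
      a = b ∧ r = r' := by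
    intro a b r r' hr hr' hh
    have hG0 : 0 < G := by omega
    have h1 : (a * G + r) / G = a := by
      rw [mul_comm, Nat.mul_add_div hG0, Nat.div_eq_of_lt (by omega)]; rfl
    have h2 : (b * G + r') / G = b := by
      rw [mul_comm, Nat.mul_add_div hG0, Nat.div_eq_of_lt (by omega)]; rfl
    have h3 : a = b := by rw [← h1, ← h2, hh]
    subst h3; exact ⟨rfl, by omega⟩
  obtain ⟨hc, hx⟩ := key (offX_lt hG ho) (offX_lt hG ho') (congrArg Prod.fst h)
  obtain ⟨hl, hy⟩ := key (offY_lt hG ho) (offY_lt hG ho') (congrArg Prod.snd h)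
  clear h hG key
  cases o with
  | slot τ s c =>
    cases o' with
    | slot τ' s' c' =>
      simp only [col, lev, offX, IsObj, IsV, IsT, or_false] at hc hl hx ho ho'
      have hs : s = s' := hc
      have ht : τ = τ' := by omega
      subst hs; subst ht
      have := List.inj_on_of_nodup_map (Θ.label_nodup τ s) ho.2.2.2 ho'.2.2.2 (by omega)
      rw [this]
    | _ =>
      simp only [col, lev, offX, offY, IsObj, IsV, IsT, or_false, false_or] at hc hl hx hy ho ho'
      first | omega | (split_ifs at hl <;> omega)
  | _ =>
    cases o' <;>
      (simp only [col, lev, offX, offY, IsObj, IsV, IsT, or_false, false_or, TrackSystem.Check,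
        priv.injEq, conn.injEq, lower.injEq, upper.injEq, trunk.injEq, reduceCtorEq]
        at hc hl hx hy ho ho' ⊢
       first | omega | (split_ifs at hl <;> omega))

end Ob

theorem diskNear_of_abs_le {G : ℕ} {p q : ℕ × ℕ} (a b : ℤ) (hx : |(p.1 : ℤ) - q.1| ≤ a)
    (hy : |(p.2 : ℤ) - q.2| ≤ b) (h : a ^ 2 + b ^ 2 ≤ ((G : ℤ) + 1) ^ 2) :
    DiskNear (G + 1) p q := by
  unfold DiskNear
  have h1 := sq_le_sq' (neg_le_of_abs_le hx) (le_of_abs_le hx)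
  have h2 := sq_le_sq' (neg_le_of_abs_le hy) (le_of_abs_le hy)
  push_cast; linarith

theorem DiskNear.symm {W : ℕ} {p q : ℕ × ℕ} (h : DiskNear W p q) : DiskNear W q p := by
  unfold DiskNear at *; linarith [h, sq_nonneg ((p.1 : ℤ) - q.1), sub_sq_comm (p.1 : ℤ) q.1,
    sub_sq_comm (p.2 : ℤ) q.2]

namespace Ob

variable {Θ : TrackSystem} {G : ℕ}

/-- A sideways deviation `d` is harmless as long as `d ^ 2 ≤ 2 * G + 1`, since `G ^ 2 + d ^ 2 ≤ (G +
1) ^ 2`. This is why `LargeMesh` asks for the square of the largest offset. -/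
theorem diskNear_vertical (hG : LargeMesh Θ G) {p q : ℕ × ℕ}
    (hx : |(p.1 : ℤ) - q.1| ≤ 2 * Θ.L + 2 + 2 * Θ.A) (hy : |(p.2 : ℤ) - q.2| ≤ G) :
    DiskNear (G + 1) p q := by
  refine diskNear_of_abs_le _ _ hx hy ?_
  have h : ((2 * Θ.L + 2 + 2 * Θ.A + 100 : ℕ) : ℤ) ^ 2 ≤ G := by exact_mod_cast hG
  push_cast at h; nlinarith

theorem diskNear_horizontal (hG : LargeMesh Θ G) {p q : ℕ × ℕ}
    (hx : |(p.1 : ℤ) - q.1| ≤ G) (hy : |(p.2 : ℤ) - q.2| ≤ 10) : DiskNear (G + 1) p q := by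
  refine diskNear_of_abs_le _ _ hx hy ?_
  have h : ((100 * (2 * Θ.L + 2 + 2 * Θ.A + 100) : ℕ) : ℤ) ≤ G := by exact_mod_cast hG.le
  push_cast at h; nlinarith

theorem diskNear_slot_slot (hG : LargeMesh Θ G) {τ s : ℕ} {c c' : ℕ × Bool} (hc : c.1 < Θ.A)
    (h : c'.1 ≤ c.1) : DiskNear (G + 1) ((slot τ s c).pos Θ G) ((slot τ (s + 1) c').pos Θ G) := by
  have hG' : ((100 * (2 * Θ.L + 2 + 2 * Θ.A + 100) : ℕ) : ℤ) ≤ G := by exact_mod_cast hG.le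
  zify at hc h; push_cast at hG'
  refine diskNear_horizontal hG ?_ ?_
  · simp only [pos, col, offX, abs_le]; push_cast; constructor <;> nlinarith
  · simp only [pos, lev, offY, abs_le]; split_ifs <;> push_cast <;> constructor <;> linarith

/-- On the levels of tracks the trunk has offset `2 * L + 2 * A`, the largest one that a slot can
have, so it reaches every candidate of column 1 whatever its label. -/
theorem diskNear_trunk_slot (hG : LargeMesh Θ G) {τ : ℕ} {c : ℕ × Bool} (hc : c.1 < Θ.A) :
    DiskNear (G + 1) ((trunk (5 * τ + 5)).pos Θ G) ((slot τ 1 c).pos Θ G) := by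
  have hG' : ((100 * (2 * Θ.L + 2 + 2 * Θ.A + 100) : ℕ) : ℤ) ≤ G := by exact_mod_cast hG.le
  zify at hc; push_cast at hG'
  have h5 : (5 * τ + 5) % 5 = 0 := by omega
  refine diskNear_horizontal hG ?_ ?_
  · simp only [pos, col, offX, abs_le, h5, if_true]; push_cast; constructor <;> linarith
  · simp only [pos, lev, offY, abs_le]; split_ifs <;> push_cast <;> constructor <;> linarith

theorem diskNear_slot_priv (hG : LargeMesh Θ G) {τ s : ℕ} {c : ℕ × Bool} (hc : c.1 < Θ.A)
    (hs : s ≤ Θ.L) : DiskNear (G + 1) ((slot τ s c).pos Θ G) ((priv τ s).pos Θ G) := by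
  have hG' : ((100 * (2 * Θ.L + 2 + 2 * Θ.A + 100) : ℕ) : ℤ) ≤ G := by exact_mod_cast hG.le
  zify at hc hs; push_cast at hG'
  refine diskNear_vertical hG ?_ ?_
  · simp only [pos, col, offX, abs_le]; split_ifs <;> push_cast <;> constructor <;> linarith
  · simp only [pos, lev, offY, abs_le]; split_ifs <;> push_cast <;> constructor <;> linarith

theorem diskNear_slot_conn (hG : LargeMesh Θ G) {τ s : ℕ} {c : ℕ × Bool} (hc : c.1 < Θ.A)
    (hs : s ≤ Θ.L) (h2 : c.2 = true) :
    DiskNear (G + 1) ((slot τ s c).pos Θ G) ((conn τ s).pos Θ G) := by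
  have hG' : ((100 * (2 * Θ.L + 2 + 2 * Θ.A + 100) : ℕ) : ℤ) ≤ G := by exact_mod_cast hG.le
  zify at hc hs; push_cast at hG'
  refine diskNear_vertical hG ?_ ?_
  · simp only [pos, col, offX, abs_le]; split_ifs <;> push_cast <;> constructor <;> linarith
  · simp only [pos, lev, offY, abs_le, h2, if_true]
    split_ifs <;> push_cast <;> constructor <;> linarith

theorem diskNear_conn_lower (hG : LargeMesh Θ G) {τ s : ℕ} (h : (τ + s) % 2 = 0) :
    DiskNear (G + 1) ((conn τ s).pos Θ G) ((lower τ s).pos Θ G) := by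
  have hG' : ((100 * (2 * Θ.L + 2 + 2 * Θ.A + 100) : ℕ) : ℤ) ≤ G := by exact_mod_cast hG.le
  push_cast at hG'
  refine diskNear_vertical hG ?_ ?_
  · simp only [pos, col, offX, abs_le, h, if_true]; push_cast; constructor <;> linarith
  · simp only [pos, lev, offY, abs_le, h, if_true]; push_cast; constructor <;> linarith

theorem diskNear_lower_upper (hG : LargeMesh Θ G) {τ s : ℕ} :
    DiskNear (G + 1) ((lower τ s).pos Θ G) ((upper τ s).pos Θ G) := by
  refine diskNear_vertical hG ?_ ?_
  · simp only [pos, col, offX, abs_le]; push_cast; constructor <;> linarith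
  · simp only [pos, lev, offY, abs_le]; push_cast; constructor <;> linarith

theorem diskNear_upper_conn (hG : LargeMesh Θ G) {τ s : ℕ} (h : (τ + s) % 2 = 0) :
    DiskNear (G + 1) ((upper τ s).pos Θ G) ((conn (τ + 1) s).pos Θ G) := by
  have hG' : ((100 * (2 * Θ.L + 2 + 2 * Θ.A + 100) : ℕ) : ℤ) ≤ G := by exact_mod_cast hG.le
  push_cast at hG'
  have h' : ¬(τ + 1 + s) % 2 = 0 := by omega
  refine diskNear_vertical hG ?_ ?_
  · simp only [pos, col, offX, abs_le, h', if_false]; push_cast; constructor <;> linarith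
  · simp only [pos, lev, offY, abs_le, h', if_false]; push_cast; constructor <;> linarith

theorem diskNear_trunk_trunk (hG : LargeMesh Θ G) {j : ℕ} :
    DiskNear (G + 1) ((trunk j).pos Θ G) ((trunk (j + 1)).pos Θ G) := by
  refine diskNear_vertical hG ?_ ?_
  · simp only [pos, col, offX, abs_le]; split_ifs <;> push_cast <;> constructor <;> linarith
  · simp only [pos, lev, offY, abs_le]; push_cast; constructor <;> linarith

end Ob

/-! ## The instance -/

/-- The rational point of a lattice point, for the denominator `D`. Numerators are odd, so that
they are coprime to powers of two. -/
def ratPoint (D : ℕ) (p : ℕ × ℕ) : ℚ × ℚ :=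
  (((2 * p.1 + 1 : ℕ) : ℚ) / D, ((2 * p.2 + 1 : ℕ) : ℚ) / D)

theorem ratPoint_injective {D : ℕ} (hD : 0 < D) : Function.Injective (ratPoint D) := by
  rintro ⟨a, b⟩ ⟨a', b'⟩ h
  have hD' : (D : ℚ) ≠ 0 := by positivity
  simp only [ratPoint, Prod.mk.injEq, div_left_inj' hD'] at h
  have h1 : 2 * a + 1 = 2 * a' + 1 := by exact_mod_cast h.1
  have h2 : 2 * b + 1 = 2 * b' + 1 := by exact_mod_cast h.2
  rw [Prod.mk.injEq]; omega

/-- On lattice points for the denominator `D`, the intersection pattern of the objects lies between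
the disk graph and the square graph of radius `W`. -/
structure ShapeGrid (obj : ℚ × ℚ → Set Plane) (W D : ℕ) : Prop where
  meet : ∀ p q, DiskNear W p q → (obj (ratPoint D p) ∩ obj (ratPoint D q)).Nonempty
  near : ∀ p q, (obj (ratPoint D p) ∩ obj (ratPoint D q)).Nonempty → SquareNear W p q

namespace TrackSystem

variable (Θ : TrackSystem)

/-- All pairs of a track and a position. -/
def pairs : List (ℕ × ℕ) :=
  (List.range Θ.P).flatMap fun τ => (List.range Θ.L).map fun i => (τ, i + 1)

/-- The connector of track `τ` at position `s` exists. -/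
def HasConn (τ s : ℕ) : Prop := ((τ + s) % 2 = 0 → τ + 1 < Θ.P) ∧ ((τ + s) % 2 ≠ 0 → 0 < τ)

instance (τ s : ℕ) : Decidable (Θ.HasConn τ s) := by unfold HasConn; infer_instance

/-- The non-terminals. -/
def objV : List Ob := Θ.pairs.flatMap fun p =>
  (Θ.cand p.1 p.2).map (Ob.slot p.1 p.2) ++
    if Θ.HasConn p.1 p.2 then [Ob.conn p.1 p.2] else []

/-- The terminals. -/
def objT : List Ob := (Θ.pairs.flatMap fun p =>
  Ob.priv p.1 p.2 ::
    if Θ.Check p.1 p.2 then [Ob.lower p.1 p.2, Ob.upper p.1 p.2] else []) ++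
  (List.range (5 * Θ.P)).map fun j => Ob.trunk (j + 5)

/-- The budget. -/
def budget : ℕ := Θ.pairs.length + (Θ.pairs.filter fun p => Θ.Check p.1 p.2).length

variable {Θ}

theorem mem_pairs {p : ℕ × ℕ} : p ∈ Θ.pairs ↔ p.1 < Θ.P ∧ 1 ≤ p.2 ∧ p.2 ≤ Θ.L := by
  rcases p with ⟨τ, s⟩
  simp only [pairs, List.mem_flatMap, List.mem_range, List.mem_map, Prod.mk.injEq]
  constructor
  · rintro ⟨a, ha, i, hi, rfl, rfl⟩; omega
  · rintro ⟨h1, h2, h3⟩; exact ⟨τ, h1, s - 1, by omega, rfl, by omega⟩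

theorem pairs_nodup : Θ.pairs.Nodup := by
  refine List.nodup_flatMap.2 ⟨fun τ _ => ?_, ?_⟩
  · exact List.nodup_range.map fun i j h => by simpa using h
  · refine List.nodup_range.imp fun {a b} hab => ?_
    simp only [Function.onFun, List.disjoint_left, List.mem_map]
    rintro x ⟨i, _, rfl⟩ ⟨j, _, h⟩
    exact hab (congrArg Prod.fst h).symm

theorem mem_objV {o : Ob} : o ∈ Θ.objV ↔ o.IsV Θ := by
  simp only [objV, List.mem_flatMap, List.mem_append, List.mem_map, mem_pairs, Prod.exists]
  constructor
  · rintro ⟨τ, s, ⟨h1, h2, h3⟩, ⟨c, b, hc, rfl⟩ | h⟩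
    · exact ⟨h1, h2, h3, hc⟩
    · split_ifs at h with hh
      · rw [List.mem_singleton] at h; subst h; exact ⟨h1, h2, h3, hh⟩
      · simp at h
  · cases o with
    | slot τ s c =>
      rintro ⟨h1, h2, h3, h4⟩; exact ⟨τ, s, ⟨h1, h2, h3⟩, Or.inl ⟨c.1, c.2, h4, rfl⟩⟩
    | conn τ s =>
      rintro ⟨h1, h2, h3, h4⟩
      exact ⟨τ, s, ⟨h1, h2, h3⟩, Or.inr (by rw [if_pos (show Θ.HasConn τ s from h4)]; exact List.mem_singleton.2 rfl)⟩
    | _ => exact False.elim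

theorem mem_objT {o : Ob} : o ∈ Θ.objT ↔ o.IsT Θ := by
  simp only [objT, List.mem_append, List.mem_flatMap, List.mem_map, mem_pairs, Prod.exists,
    List.mem_cons, List.mem_range]
  constructor
  · rintro (⟨τ, s, ⟨h1, h2, h3⟩, rfl | h⟩ | ⟨j, hj, rfl⟩)
    · exact ⟨h1, h2, h3⟩
    · split_ifs at h with hh
      · simp only [List.mem_cons, List.not_mem_nil, or_false] at h
        rcases h with rfl | rfl <;> exact ⟨h2, h3, hh⟩
      · simp at h
    · exact ⟨by omega, by omega⟩
  · cases o with
    | priv τ s => rintro ⟨h1, h2, h3⟩; exact Or.inl ⟨τ, s, ⟨h1, h2, h3⟩, Or.inl rfl⟩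
    | lower τ s =>
      rintro ⟨h2, h3, h⟩
      exact Or.inl ⟨τ, s, ⟨by have := h.1; omega, h2, h3⟩, Or.inr (by rw [if_pos h]; simp)⟩
    | upper τ s =>
      rintro ⟨h2, h3, h⟩
      exact Or.inl ⟨τ, s, ⟨by have := h.1; omega, h2, h3⟩, Or.inr (by rw [if_pos h]; simp)⟩
    | trunk j =>
      rintro ⟨h1, h2⟩; exact Or.inr ⟨j - 5, by omega, by congr 1; omega⟩
    | _ => exact False.elim

/-- The pair of a track and a position that an object belongs to. -/
def _root_.GeomSteiner.Ob.pair : Ob → ℕ × ℕ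
  | .slot τ s _ => (τ, s)
  | .priv τ s => (τ, s)
  | .conn τ s => (τ, s)
  | .lower τ s => (τ, s)
  | .upper τ s => (τ, s)
  | .trunk _ => (0, 0)

theorem nodup_flatMap_pairs {f : ℕ × ℕ → List Ob} (h1 : ∀ p, (f p).Nodup)
    (h2 : ∀ p, ∀ o ∈ f p, o.pair = p) : (Θ.pairs.flatMap f).Nodup := by
  refine List.nodup_flatMap.2 ⟨fun p _ => h1 p, pairs_nodup.imp fun {a b} hab => ?_⟩
  simp only [Function.onFun, List.disjoint_left]
  intro o ha hb
  exact hab ((h2 _ _ ha).symm.trans (h2 _ _ hb))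

theorem objV_nodup : Θ.objV.Nodup := by
  refine nodup_flatMap_pairs (fun p => ?_) fun p o ho => ?_
  · have h : ((Θ.cand p.1 p.2).map (Ob.slot p.1 p.2)).Nodup :=
      (List.Nodup.of_map _ (Θ.label_nodup p.1 p.2)).map fun a b h => by simpa using h
    split_ifs
    · refine List.Nodup.append h (List.nodup_singleton _) ?_
      simp
    · simpa using h
  · rw [List.mem_append] at ho
    rcases ho with ho | ho
    · obtain ⟨c, _, rfl⟩ := List.mem_map.1 ho; rfl
    · split_ifs at ho
      · rw [List.mem_singleton] at ho; subst ho; rfl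
      · simp at ho

theorem objT_nodup : Θ.objT.Nodup := by
  refine List.Nodup.append ?_ ?_ ?_
  · refine nodup_flatMap_pairs (fun p => ?_) fun p o ho => ?_
    · split_ifs <;> simp
    · split_ifs at ho <;> simp at ho
      · rcases ho with rfl | rfl | rfl <;> rfl
      · subst ho; rfl
  · exact List.nodup_range.map fun a b h => by simpa using h
  · simp only [List.disjoint_left, List.mem_flatMap, List.mem_map]
    rintro o ⟨p, _, ho⟩ ⟨j, _, rfl⟩
    split_ifs at ho <;> simp at ho

theorem nodup_map_pos {G : ℕ} (hG : LargeMesh Θ G) :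
    ((Θ.objV ++ Θ.objT).map (Ob.pos Θ G)).Nodup := by
  refine List.Nodup.map_on (fun o ho o' ho' h => Ob.pos_injOn hG ?_ ?_ h) ?_
  · rw [List.mem_append, mem_objV, mem_objT] at ho; exact ho
  · rw [List.mem_append, mem_objV, mem_objT] at ho'; exact ho'
  · refine List.Nodup.append objV_nodup objT_nodup ?_
    rw [List.disjoint_left]
    intro o h1 h2
    rw [mem_objV] at h1; rw [mem_objT] at h2
    cases o <;> simp only [Ob.IsV, Ob.IsT] at h1 h2

variable (Θ) in
/-- The Steiner Tree instance of a track system. -/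
def toSteiner (G D : ℕ) (hG : LargeMesh Θ G) (hD : 0 < D) : SteinerInstance where
  k := Θ.budget
  V := (Θ.objV.map (Ob.pos Θ G)).map (ratPoint D)
  T := (Θ.objT.map (Ob.pos Θ G)).map (ratPoint D)
  nodup := by
    rw [← List.map_append, ← List.map_append]
    exact (nodup_map_pos hG).map (ratPoint_injective hD)
  terminals_ne_nil := by
    have := Θ.P_pos
    simp [objT]; omega

end TrackSystem
-- Cut arguments: from a Steiner tree to a feasible choice
theorem _root_.SimpleGraph.Connected.exists_adj_boundary {V : Type*} {H : SimpleGraph V}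
    (hH : H.Connected) (U : Set V) {a b : V} (ha : a ∈ U) (hb : b ∉ U) :
    ∃ x ∈ U, ∃ y ∉ U, H.Adj x y := by
  obtain ⟨w⟩ := hH.preconnected a b
  obtain ⟨d, -, h1, h2⟩ := w.exists_boundary_dart U ha hb
  exact ⟨d.fst, h1, d.snd, h2, d.adj⟩

namespace TrackSystem

variable {Θ : TrackSystem} {G : ℕ}

/-- A set `S` of selected non-terminal objects which, with all terminals, cannot be separated
without cutting an adjacency. -/
structure Linked (Θ : TrackSystem) (S : Finset Ob) : Prop where
  isV : ∀ o ∈ S, o.IsV Θ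
  card_le : S.card ≤ Θ.budget
  cut : ∀ U : Ob → Prop, (∃ o, U o ∧ (o ∈ S ∨ o.IsT Θ)) → (∃ o, ¬ U o ∧ (o ∈ S ∨ o.IsT Θ)) →
    ∃ o o', U o ∧ ¬ U o' ∧ (o ∈ S ∨ o.IsT Θ) ∧ (o' ∈ S ∨ o'.IsT Θ) ∧ (Ob.Rel o o' ∨ Ob.Rel o' o)

theorem isT_trunk : (Ob.trunk 5).IsT Θ := ⟨le_rfl, by have := Θ.P_pos; omega⟩

/-- Cut off the private terminal alone: its only possible neighbours are the candidates of its own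
slot. -/
theorem Linked.exists_slot {S : Finset Ob} (h : Linked Θ S) {τ s : ℕ} (hτ : τ < Θ.P)
    (h1 : 1 ≤ s) (hs : s ≤ Θ.L) : ∃ c, Ob.slot τ s c ∈ S := by
  obtain ⟨o, o', ho, ho', hS, hS', hr⟩ := h.cut (fun o => o = .priv τ s)
    ⟨_, rfl, Or.inr ⟨hτ, h1, hs⟩⟩ ⟨.trunk 5, by simp, Or.inr isT_trunk⟩
  subst ho
  cases o' with
  | slot τ' s' c =>
    rcases hr with hr | hr
    · exact hr.elim
    · obtain ⟨rfl, rfl⟩ := hr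
      rcases hS' with hS' | hS'
      · exact ⟨c, hS'⟩
      · exact hS'.elim
  | priv τ' s' =>
    rcases hr with ⟨rfl, rfl⟩ | ⟨rfl, rfl⟩ <;> exact absurd rfl ho'
  | _ => rcases hr with hr | hr <;> exact hr.elim

/-- Cut off the two terminals of the checkpoint: apart from each other, they can only meet the
connector of the track below or of the track above. -/
theorem Linked.exists_conn {S : Finset Ob} (h : Linked Θ S) {τ s : ℕ}
    (h1 : 1 ≤ s) (hs : s ≤ Θ.L) (hc : Θ.Check τ s) : ∃ τ', (τ' = τ ∨ τ' = τ + 1) ∧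
      Ob.conn τ' s ∈ S := by
  obtain ⟨o, o', ho, ho', hS, hS', hr⟩ := h.cut (fun o => o = .lower τ s ∨ o = .upper τ s)
    ⟨_, Or.inl rfl, Or.inr ⟨h1, hs, hc⟩⟩ ⟨.trunk 5, by simp, Or.inr isT_trunk⟩
  cases o' with
  | conn τ' s' =>
    have hS'' : Ob.conn τ' s' ∈ S := hS'.resolve_right id
    rcases ho with rfl | rfl
    · rcases hr with hr | hr
      · exact hr.elim
      · obtain ⟨rfl, rfl⟩ := hr; exact ⟨_, Or.inl rfl, hS''⟩
    · rcases hr with hr | hr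
      · exact hr.elim
      · obtain ⟨rfl, rfl⟩ := hr; exact ⟨_, Or.inr rfl, hS''⟩
  | lower τ' s' =>
    rcases ho with rfl | rfl <;> rcases hr with hr | hr <;>
      first | exact hr.elim | (obtain ⟨rfl, rfl⟩ := hr; exact absurd (Or.inl rfl) ho')
  | upper τ' s' =>
    rcases ho with rfl | rfl <;> rcases hr with hr | hr <;>
      first | exact hr.elim | (obtain ⟨rfl, rfl⟩ := hr; exact absurd (Or.inr rfl) ho')
  | _ =>
    rcases ho with rfl | rfl <;> rcases hr with hr | hr <;> exact hr.elim

/-- The index set of the objects that every solution must contain. -/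
def indices (Θ : TrackSystem) : Finset ((ℕ × ℕ) ⊕ (ℕ × ℕ)) :=
  Θ.pairs.toFinset.disjSum (Θ.pairs.filter fun p => Θ.Check p.1 p.2).toFinset

theorem card_indices : Θ.indices.card = Θ.budget := by
  rw [indices, Finset.card_disjSum, List.toFinset_card_of_nodup pairs_nodup,
    List.toFinset_card_of_nodup (pairs_nodup.filter _), budget]

/-- The demands of slots and checkpoints are met by pairwise distinct members of `S`, and the budget
equals the number of demands. Hence `S` is exactly the image of the demands: one candidate per slot
and one connector per checkpoint. -/
theorem Linked.exists_choice {S : Finset Ob} (h : Linked Θ S) :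
    ∃ (σ : ℕ → ℕ → ℕ × Bool) (e : ℕ → ℕ → ℕ),
      (∀ τ s, τ < Θ.P → 1 ≤ s → s ≤ Θ.L → ∀ c, Ob.slot τ s c ∈ S ↔ c = σ τ s) ∧
      (∀ τ s, 1 ≤ s → s ≤ Θ.L → Θ.Check τ s → (e τ s = τ ∨ e τ s = τ + 1) ∧
        ∀ τ', τ' = τ ∨ τ' = τ + 1 → (Ob.conn τ' s ∈ S ↔ τ' = e τ s)) := by
  have hσ : ∀ τ s, ∃ c, τ < Θ.P → 1 ≤ s → s ≤ Θ.L → Ob.slot τ s c ∈ S := fun τ s => by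
    by_cases hh : τ < Θ.P ∧ 1 ≤ s ∧ s ≤ Θ.L
    · obtain ⟨c, hc⟩ := h.exists_slot hh.1 hh.2.1 hh.2.2; exact ⟨c, fun _ _ _ => hc⟩
    · exact ⟨(0, true), fun h1 h2 h3 => absurd ⟨h1, h2, h3⟩ hh⟩
  have he : ∀ τ s, ∃ τ', (τ' = τ ∨ τ' = τ + 1) ∧
      (1 ≤ s → s ≤ Θ.L → Θ.Check τ s → Ob.conn τ' s ∈ S) := fun τ s => by
    by_cases hh : 1 ≤ s ∧ s ≤ Θ.L ∧ Θ.Check τ s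
    · obtain ⟨c, hc, hc'⟩ := h.exists_conn hh.1 hh.2.1 hh.2.2; exact ⟨c, hc, fun _ _ _ => hc'⟩
    · exact ⟨τ, Or.inl rfl, fun h1 h2 h3 => absurd ⟨h1, h2, h3⟩ hh⟩
  choose σ hσ using hσ
  choose e he' he using he
  let F : (ℕ × ℕ) ⊕ (ℕ × ℕ) → Ob :=
    Sum.elim (fun p => .slot p.1 p.2 (σ p.1 p.2)) (fun p => .conn (e p.1 p.2) p.2)
  have hmem : ∀ i, i ∈ Θ.indices ↔ Sum.elim (fun p => p.1 < Θ.P ∧ 1 ≤ p.2 ∧ p.2 ≤ Θ.L)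
      (fun p => 1 ≤ p.2 ∧ p.2 ≤ Θ.L ∧ Θ.Check p.1 p.2) i := by
    rintro (⟨a, b⟩ | ⟨a, b⟩)
    · simp [indices, mem_pairs]
    · simp only [indices, Finset.inr_mem_disjSum, List.mem_toFinset, List.mem_filter, mem_pairs,
        decide_eq_true_eq, Sum.elim_inr]
      constructor
      · rintro ⟨⟨_, h2, h3⟩, h4⟩; exact ⟨h2, h3, h4⟩
      · rintro ⟨h2, h3, h4⟩; exact ⟨⟨by have := h4.1; omega, h2, h3⟩, h4⟩
  have hF : ∀ i ∈ Θ.indices, F i ∈ S := by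
    rintro (⟨a, b⟩ | ⟨a, b⟩) hi <;> rw [hmem] at hi
    · exact hσ _ _ hi.1 hi.2.1 hi.2.2
    · exact he _ _ hi.1 hi.2.1 hi.2.2
  -- Checkpoints at the same position lie above tracks of equal parity, so no connector can serve
  -- two of them.
  have hconn : ∀ a b a' b', Θ.Check a b → Θ.Check a' b' → b = b' →
      (e a b = a' ∨ e a b = a' + 1) → a = a' := by
    rintro a b a' b' ⟨_, h1⟩ ⟨_, h2⟩ rfl h3
    have := he' a b; omega
  have hinj : Set.InjOn F Θ.indices := by
    rintro (⟨a, b⟩ | ⟨a, b⟩) hi (⟨a', b'⟩ | ⟨a', b'⟩) hi' hh <;>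
      rw [Finset.mem_coe, hmem] at hi hi' <;>
      simp only [F, Sum.elim_inl, Sum.elim_inr, Ob.slot.injEq, Ob.conn.injEq, reduceCtorEq] at hh
    · obtain ⟨rfl, rfl, -⟩ := hh; rfl
    · obtain ⟨h1, rfl⟩ := hh
      have := hconn a b a' b hi.2.2 hi'.2.2 rfl (by rw [h1]; exact he' a' b)
      rw [this]
  have himg : Θ.indices.image F = S := by
    refine Finset.eq_of_subset_of_card_le (Finset.image_subset_iff.2 hF) ?_
    rw [Finset.card_image_of_injOn hinj, card_indices]; exact h.card_le
  refine ⟨σ, e, fun τ s h1 h2 h3 c => ⟨fun hc => ?_, fun hc => hc ▸ hσ τ s h1 h2 h3⟩,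
    fun τ s h1 h2 h3 => ⟨he' τ s, fun τ' hτ' => ⟨fun hc => ?_, fun hc => hc ▸ he τ s h1 h2 h3⟩⟩⟩
  · rw [← himg, Finset.mem_image] at hc
    obtain ⟨⟨a, b⟩ | ⟨a, b⟩, hi, hh⟩ := hc <;>
      simp only [F, Sum.elim_inl, Sum.elim_inr, Ob.slot.injEq, reduceCtorEq] at hh
    obtain ⟨rfl, rfl, rfl⟩ := hh; rfl
  · rw [← himg, Finset.mem_image] at hc
    obtain ⟨⟨a, b⟩ | ⟨a, b⟩, hi, hh⟩ := hc <;>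
      simp only [F, Sum.elim_inl, Sum.elim_inr, Ob.conn.injEq, reduceCtorEq] at hh
    rw [hmem] at hi
    obtain ⟨rfl, rfl⟩ := hh
    rw [hconn a b τ b hi.2.2 h3 rfl hτ']

/-- Each checkpoint has a single connector, so it hangs on one of its two tracks and offers no
shortcut between them. A track therefore reaches the trunk only through its own slots, which makes
every consecutive pair of slots touch. -/
theorem Linked.feasible {S : Finset Ob} (h : Linked Θ S) : Θ.Feasible := by
  obtain ⟨σ, e, hσ, he⟩ := h.exists_choice
  refine ⟨σ, fun τ s h1 h2 h3 => ?_, fun τ s h1 h2 h3 => ?_, fun τ s h1 h2 h3 => ?_⟩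
  · exact (h.isV _ ((hσ τ s h1 h2 h3 _).2 rfl)).2.2.2
  -- The cut consists of the part of track `τ` to the right of `s`, with all checkpoints there whose
  -- connector belongs to `τ`. Only the contact between the slots `s + 1` and `s` can cross it.
  · obtain ⟨o, o', ho, ho', hS, hS', hr⟩ := h.cut (fun o => match o with
        | .slot τ' s' _ => τ' = τ ∧ s < s'
        | .priv τ' s' => τ' = τ ∧ s < s'
        | .conn τ' s' => τ' = τ ∧ s < s'
        | .lower τ' s' => e τ' s' = τ ∧ s < s'
        | .upper τ' s' => e τ' s' = τ ∧ s < s'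
        | .trunk _ => False)
      ⟨.slot τ (s + 1) (σ τ (s + 1)), ⟨rfl, by omega⟩,
        Or.inl ((hσ _ _ h1 (by omega) h3 _).2 rfl)⟩
      ⟨.trunk 5, by simp, Or.inr isT_trunk⟩
    cases o with
    | slot τ' s' c =>
      obtain ⟨rfl, hs'⟩ := ho
      have hc : Ob.slot τ' s' c ∈ S := hS.resolve_right id
      have hcV := h.isV _ hc
      cases o' with
      | slot τ'' s'' c' =>
        have hc' : Ob.slot τ'' s'' c' ∈ S := hS'.resolve_right id
        have hcV' := h.isV _ hc'
        simp only [Ob.Rel, Ob.IsV] at hr ho' hcV hcV'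
        have e1 : τ'' = τ' := by omega
        have e2 : s'' = s := by omega
        have e3 : s' = s + 1 := by omega
        subst e1 e2 e3
        rw [(hσ _ _ h1 (by omega) h3 _).1 hc, (hσ _ _ h1 h2 (by omega) _).1 hc'] at hr
        omega
      | priv τ'' s'' => simp only [Ob.Rel, or_false] at hr ho'; omega
      | conn τ'' s'' => simp only [Ob.Rel, or_false] at hr ho'; omega
      | trunk j => simp only [Ob.Rel, or_false] at hr; omega
      | _ => rcases hr with hr | hr <;> exact hr.elim
    | priv τ' s' =>
      obtain ⟨rfl, hs'⟩ := ho
      cases o' with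
      | slot τ'' s'' c => simp only [Ob.Rel, false_or] at hr ho'; omega
      | priv τ'' s'' => simp only [Ob.Rel] at hr ho'; omega
      | _ => rcases hr with hr | hr <;> exact hr.elim
    | conn τ' s' =>
      obtain ⟨rfl, hs'⟩ := ho
      have hc : Ob.conn τ' s' ∈ S := hS.resolve_right id
      cases o' with
      | slot τ'' s'' c => simp only [Ob.Rel, false_or] at hr ho'; omega
      | conn τ'' s'' => simp only [Ob.Rel] at hr ho'; omega
      | lower τ'' s'' =>
        simp only [Ob.Rel, or_false] at hr
        obtain ⟨rfl, rfl⟩ := hr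
        obtain ⟨g1, g2, g3⟩ : 1 ≤ s' ∧ s' ≤ Θ.L ∧ Θ.Check τ' s' :=
          hS'.resolve_left fun hh => h.isV _ hh
        exact absurd ⟨(((he _ _ g1 g2 g3).2 _ (Or.inl rfl)).1 hc).symm, hs'⟩ ho'
      | upper τ'' s'' =>
        simp only [Ob.Rel, or_false] at hr
        obtain ⟨rfl, rfl⟩ := hr
        obtain ⟨g1, g2, g3⟩ : 1 ≤ s' ∧ s' ≤ Θ.L ∧ Θ.Check τ'' s' :=
          hS'.resolve_left fun hh => h.isV _ hh
        exact absurd ⟨(((he _ _ g1 g2 g3).2 _ (Or.inr rfl)).1 hc).symm, hs'⟩ ho'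
      | _ => rcases hr with hr | hr <;> exact hr.elim
    | lower τ' s' =>
      obtain ⟨g1, g2, g3⟩ : 1 ≤ s' ∧ s' ≤ Θ.L ∧ Θ.Check τ' s' :=
        hS.resolve_left fun hh => h.isV _ hh
      cases o' with
      | conn τ'' s'' =>
        have hc : Ob.conn τ'' s'' ∈ S := hS'.resolve_right id
        simp only [Ob.Rel, false_or] at hr
        obtain ⟨rfl, rfl⟩ := hr
        have := ((he _ _ g1 g2 g3).2 _ (Or.inl rfl)).1 hc
        simp only at ho ho'; omega
      | lower τ'' s'' =>
        rcases hr with ⟨rfl, rfl⟩ | ⟨rfl, rfl⟩ <;> exact absurd ho ho'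
      | upper τ'' s'' =>
        rcases hr with ⟨rfl, rfl⟩ | hr
        · exact absurd ho ho'
        · exact hr.elim
      | _ => rcases hr with hr | hr <;> exact hr.elim
    | upper τ' s' =>
      obtain ⟨g1, g2, g3⟩ : 1 ≤ s' ∧ s' ≤ Θ.L ∧ Θ.Check τ' s' :=
        hS.resolve_left fun hh => h.isV _ hh
      cases o' with
      | conn τ'' s'' =>
        have hc : Ob.conn τ'' s'' ∈ S := hS'.resolve_right id
        simp only [Ob.Rel, false_or] at hr
        obtain ⟨rfl, rfl⟩ := hr
        have := ((he _ _ g1 g2 g3).2 _ (Or.inr rfl)).1 hc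
        simp only at ho ho'; omega
      | upper τ'' s'' =>
        rcases hr with ⟨rfl, rfl⟩ | ⟨rfl, rfl⟩ <;> exact absurd ho ho'
      | lower τ'' s'' =>
        rcases hr with hr | ⟨rfl, rfl⟩
        · exact hr.elim
        · exact absurd ho ho'
      | _ => rcases hr with hr | hr <;> exact hr.elim
    | trunk j => exact ho.elim
  · obtain ⟨he1, he2⟩ := he τ s h1 h2 h3
    have hlt : e τ s < Θ.P := by have := h3.1; omega
    suffices hh : (σ (e τ s) s).2 = true by
      rcases he1 with h' | h' <;> rw [h'] at hh
      · exact Or.inl hh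
      · exact Or.inr hh
    -- A checkpoint together with its only connector can leave this set only through the slot of the
    -- connector, and that contact requires the touch flag.
    obtain ⟨o, o', ho, ho', hS, hS', hr⟩ := h.cut
      (fun o => o = .lower τ s ∨ o = .upper τ s ∨ o = .conn (e τ s) s)
      ⟨_, Or.inl rfl, Or.inr ⟨h1, h2, h3⟩⟩ ⟨.trunk 5, by simp, Or.inr isT_trunk⟩
    cases o' with
    | slot τ' s' c =>
      have hc : Ob.slot τ' s' c ∈ S := hS'.resolve_right id
      rcases ho with rfl | rfl | rfl
      · rcases hr with hr | hr <;> exact hr.elim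
      · rcases hr with hr | hr <;> exact hr.elim
      · rcases hr with hr | ⟨rfl, rfl, hr⟩
        · exact hr.elim
        · rw [← (hσ _ _ hlt h1 h2 _).1 hc]; exact hr
    | conn τ' s' =>
      exfalso
      have hc : Ob.conn τ' s' ∈ S := hS'.resolve_right id
      have key : ¬ ((τ' = τ ∨ τ' = τ + 1) ∧ s' = s) := by
        rintro ⟨ht, rfl⟩
        exact ho' (Or.inr (Or.inr (by rw [(he2 _ ht).1 hc])))
      rcases ho with rfl | rfl | rfl <;> simp only [Ob.Rel, false_or] at hr <;> omega
    | lower τ' s' =>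
      exfalso
      rcases ho with rfl | rfl | rfl <;> simp only [Ob.Rel, false_or, or_false] at hr
      · rcases hr with ⟨rfl, rfl⟩ | ⟨rfl, rfl⟩ <;> exact ho' (Or.inl rfl)
      · obtain ⟨rfl, rfl⟩ := hr; exact ho' (Or.inl rfl)
      · obtain ⟨g1, g2, g3⟩ : 1 ≤ s' ∧ s' ≤ Θ.L ∧ Θ.Check τ' s' :=
          hS'.resolve_left fun hh => h.isV _ hh
        have e1 : τ' = τ := by have := h3.2; have := g3.2; omega
        obtain ⟨-, rfl⟩ := hr
        subst e1; exact ho' (Or.inl rfl)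
    | upper τ' s' =>
      exfalso
      rcases ho with rfl | rfl | rfl <;> simp only [Ob.Rel, or_false] at hr
      · obtain ⟨rfl, rfl⟩ := hr; exact ho' (Or.inr (Or.inl rfl))
      · rcases hr with ⟨rfl, rfl⟩ | ⟨rfl, rfl⟩ <;> exact ho' (Or.inr (Or.inl rfl))
      · obtain ⟨g1, g2, g3⟩ : 1 ≤ s' ∧ s' ≤ Θ.L ∧ Θ.Check τ' s' :=
          hS'.resolve_left fun hh => h.isV _ hh
        have e1 : τ' = τ := by have := h3.2; have := g3.2; omega
        obtain ⟨-, rfl⟩ := hr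
        subst e1; exact ho' (Or.inr (Or.inl rfl))
    | _ =>
      exfalso
      rcases ho with rfl | rfl | rfl <;> rcases hr with hr | hr <;> exact hr.elim

end TrackSystem
end GeomSteiner

/-! ### Equivalence of the Steiner Tree instance and the track system -/

namespace GeomSteiner
namespace TrackSystem

variable {Θ : TrackSystem} {G D : ℕ} {obj : ℚ × ℚ → Set Plane}

theorem mem_toSteiner_V (hG : LargeMesh Θ G) (hD : 0 < D) {p : ℚ × ℚ} :
    p ∈ (Θ.toSteiner G D hG hD).V ↔ ∃ o : Ob, o.IsV Θ ∧ ratPoint D (o.pos Θ G) = p := by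
  simp [toSteiner, mem_objV]

theorem mem_toSteiner_T (hG : LargeMesh Θ G) (hD : 0 < D) {p : ℚ × ℚ} :
    p ∈ (Θ.toSteiner G D hG hD).T ↔ ∃ o : Ob, o.IsT Θ ∧ ratPoint D (o.pos Θ G) = p := by
  simp [toSteiner, mem_objT]

/-- The selected points are pulled back to objects along the injective layout, and a cut of objects
becomes a cut of the connected graph. Of `ShapeGrid` only the upper bound by the square graph is
needed. -/
theorem feasible_of_hasSolution (hG : LargeMesh Θ G) (hD : 0 < D) (hS : ShapeGrid obj (G + 1) D)
    (h : (Θ.toSteiner G D hG hD).HasSolution obj) : Θ.Feasible := by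
  classical
  obtain ⟨S₀, hV, hcard, hconn⟩ := h
  let q : Ob → ℚ × ℚ := fun o => ratPoint D (o.pos Θ G)
  let S : Finset Ob := Θ.objV.toFinset.filter fun o => q o ∈ S₀
  have hmem : ∀ o, o ∈ S ↔ o.IsV Θ ∧ q o ∈ S₀ := fun o => by
    simp [S, mem_objV]
  have hobj : ∀ {o}, o ∈ S ∨ o.IsT Θ → o.IsObj Θ := by
    rintro o (ho | ho)
    · exact Or.inl ((hmem o).1 ho).1
    · exact Or.inr ho
  have hset : ∀ {o}, o ∈ S ∨ o.IsT Θ → q o ∈ S₀ ∨ q o ∈ (Θ.toSteiner G D hG hD).T := by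
    rintro o (ho | ho)
    · exact Or.inl ((hmem o).1 ho).2
    · exact Or.inr ((mem_toSteiner_T hG hD).2 ⟨o, ho, rfl⟩)
  have hset' : ∀ x, x ∈ S₀ ∨ x ∈ (Θ.toSteiner G D hG hD).T →
      ∃ o, (o ∈ S ∨ o.IsT Θ) ∧ q o = x := by
    rintro x (hx | hx)
    · obtain ⟨o, ho, rfl⟩ := (mem_toSteiner_V hG hD).1 (hV x hx)
      exact ⟨o, Or.inl ((hmem o).2 ⟨ho, hx⟩), rfl⟩
    · obtain ⟨o, ho, rfl⟩ := (mem_toSteiner_T hG hD).1 hx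
      exact ⟨o, Or.inr ho, rfl⟩
  have hinj : ∀ {o o'}, (o ∈ S ∨ o.IsT Θ) → (o' ∈ S ∨ o'.IsT Θ) → q o = q o' → o = o' :=
    fun ho ho' hq => Ob.pos_injOn hG (hobj ho) (hobj ho') (ratPoint_injective hD hq)
  refine Linked.feasible (S := S) ⟨fun o ho => ((hmem o).1 ho).1, ?_, ?_⟩
  · refine le_trans ?_ hcard
    refine Finset.card_le_card_of_injOn q (fun o ho => ((hmem o).1 ho).2) ?_
    exact fun o ho o' ho' hq => hinj (Or.inl ho) (Or.inl ho') hq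
  · rintro U ⟨a, ha, haS⟩ ⟨b, hb, hbS⟩
    obtain ⟨⟨x, hx⟩, ⟨o, hoU, hoS, hox⟩, ⟨y, hy⟩, hyU, hxy⟩ :=
      hconn.exists_adj_boundary {z | ∃ o, U o ∧ (o ∈ S ∨ o.IsT Θ) ∧ q o = z.1}
        (a := ⟨q a, hset haS⟩) (b := ⟨q b, hset hbS⟩) ⟨a, ha, haS, rfl⟩
        (by rintro ⟨o, hoU, hoS, hq⟩; exact hb (hinj hoS hbS hq ▸ hoU))
    obtain ⟨o', hoS', rfl⟩ := hset' y hy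
    have hox : q o = x := hox
    subst hox
    refine ⟨o, o', hoU, fun hU => hyU ⟨o', hU, hoS', rfl⟩, hoS, hoS', ?_⟩
    exact Ob.rel_of_squareNear hG (hobj hoS) (hobj hoS') (hS.near _ _ hxy.2)

/-- Everything is reachable from the lowest trunk terminal: up the trunk, along each track, and from
slots to private terminals, connectors and checkpoints. Of `ShapeGrid` only the lower bound by the
disk graph is needed. -/
theorem hasSolution_of_feasible (hG : LargeMesh Θ G) (hD : 0 < D) (hS : ShapeGrid obj (G + 1) D)
    (h : Θ.Feasible) : (Θ.toSteiner G D hG hD).HasSolution obj := by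
  classical
  obtain ⟨σ, hσ, hσ', hσc⟩ := h
  let q : Ob → ℚ × ℚ := fun o => ratPoint D (o.pos Θ G)
  let slotOb : ℕ × ℕ → Ob := fun p => .slot p.1 p.2 (σ p.1 p.2)
  -- The connector is bought on the lower track if that one touches, and otherwise on the upper
  -- track, which then touches by feasibility.
  let connOb : ℕ × ℕ → Ob := fun p => .conn (if (σ p.1 p.2).2 then p.1 else p.1 + 1) p.2
  let S : Finset Ob := Θ.indices.image (Sum.elim slotOb connOb)
  have hmem : ∀ o, o ∈ S ↔ (∃ τ s, τ < Θ.P ∧ 1 ≤ s ∧ s ≤ Θ.L ∧ o = .slot τ s (σ τ s)) ∨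
      (∃ τ s, 1 ≤ s ∧ s ≤ Θ.L ∧ Θ.Check τ s ∧
        o = .conn (if (σ τ s).2 then τ else τ + 1) s) := by
    intro o
    simp only [S, indices, Finset.mem_image, Finset.mem_disjSum, List.mem_toFinset, mem_pairs,
      List.mem_filter, decide_eq_true_eq]
    constructor
    · rintro ⟨_, ⟨⟨τ, s⟩, ⟨h1, h2, h3⟩, rfl⟩ | ⟨⟨τ, s⟩, ⟨⟨h1, h2, h3⟩, h4⟩, rfl⟩, rfl⟩
      · exact Or.inl ⟨τ, s, h1, h2, h3, rfl⟩
      · exact Or.inr ⟨τ, s, h2, h3, h4, rfl⟩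
    · rintro (⟨τ, s, h1, h2, h3, rfl⟩ | ⟨τ, s, h2, h3, h4, rfl⟩)
      · exact ⟨_, Or.inl ⟨(τ, s), ⟨h1, h2, h3⟩, rfl⟩, rfl⟩
      · exact ⟨_, Or.inr ⟨(τ, s), ⟨⟨by have := h4.1; omega, h2, h3⟩, h4⟩, rfl⟩, rfl⟩
  have hSV : ∀ o ∈ S, o.IsV Θ := by
    intro o ho
    rcases (hmem o).1 ho with ⟨τ, s, h1, h2, h3, rfl⟩ | ⟨τ, s, h2, h3, h4, rfl⟩
    · exact ⟨h1, h2, h3, hσ τ s h1 h2 h3⟩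
    · obtain ⟨h5, h6⟩ := h4
      split_ifs
      · exact ⟨by omega, h2, h3, fun _ => by omega, fun _ => by omega⟩
      · exact ⟨by omega, h2, h3, fun _ => by omega, fun _ => by omega⟩
  have hlt : ∀ τ s, τ < Θ.P → 1 ≤ s → s ≤ Θ.L → (σ τ s).1 < Θ.A :=
    fun τ s h1 h2 h3 => Θ.label_lt _ _ _ (hσ τ s h1 h2 h3)
  refine ⟨S.image q, ?_, ?_, ?_⟩
  · intro p hp
    obtain ⟨o, ho, rfl⟩ := Finset.mem_image.1 hp
    exact (mem_toSteiner_V hG hD).2 ⟨o, hSV o ho, rfl⟩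
  · exact Finset.card_image_le.trans (Finset.card_image_le.trans card_indices.le)
  · set X : Set (ℚ × ℚ) := {p | p ∈ S.image q ∨ p ∈ (Θ.toSteiner G D hG hD).T} with hX
    have hsel : ∀ {o}, (o ∈ S ∨ o.IsT Θ) → q o ∈ X := by
      rintro o (ho | ho)
      · exact Or.inl (Finset.mem_image_of_mem q ho)
      · exact Or.inr ((mem_toSteiner_T hG hD).2 ⟨o, ho, rfl⟩)
    let root : X := ⟨q (.trunk 5), hsel (Or.inr isT_trunk)⟩
    let R : Ob → Prop := fun o => ∃ hx : q o ∈ X,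
      ((intersectionGraph obj).induce X).Reachable root ⟨q o, hx⟩
    have step : ∀ {o o'}, R o → (o' ∈ S ∨ o'.IsT Θ) →
        DiskNear (G + 1) (o.pos Θ G) (o'.pos Θ G) → R o' := by
      rintro o o' ⟨hx, hr⟩ ho' hn
      refine ⟨hsel ho', ?_⟩
      by_cases hq : q o = q o'
      · have : (⟨q o, hx⟩ : X) = ⟨q o', hsel ho'⟩ := Subtype.ext hq
        rw [← this]; exact hr
      · refine hr.trans (SimpleGraph.Adj.reachable ?_)
        exact ⟨hq, hS.meet _ _ hn⟩
    have htrunk : ∀ j, j < 5 * Θ.P → R (.trunk (j + 5)) := by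
      intro j
      induction j with
      | zero => exact fun _ => ⟨hsel (Or.inr isT_trunk), SimpleGraph.Reachable.refl _⟩
      | succ j ih =>
        intro hj
        refine step (ih (by omega)) (Or.inr ⟨by omega, by omega⟩) ?_
        rw [add_right_comm j 1 5]; exact Ob.diskNear_trunk_trunk hG
    have hslot : ∀ τ s, τ < Θ.P → s + 1 ≤ Θ.L → R (.slot τ (s + 1) (σ τ (s + 1))) := by
      intro τ s hτ
      induction s with
      | zero =>
        intro hs
        refine step (htrunk (5 * τ) (by omega))
          (Or.inl ((hmem _).2 (Or.inl ⟨τ, 1, hτ, le_rfl, hs, rfl⟩))) ?_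
        exact Ob.diskNear_trunk_slot hG (hlt _ _ hτ le_rfl hs)
      | succ s ih =>
        intro hs
        refine step (ih (by omega))
          (Or.inl ((hmem _).2 (Or.inl ⟨τ, s + 1 + 1, hτ, by omega, hs, rfl⟩))) ?_
        exact Ob.diskNear_slot_slot hG (hlt _ _ hτ (by omega) (by omega))
          (hσ' _ _ hτ (by omega) hs)
    have hslot' : ∀ τ s, τ < Θ.P → 1 ≤ s → s ≤ Θ.L → R (.slot τ s (σ τ s)) := by
      intro τ s hτ h1 hs
      obtain ⟨s, rfl⟩ := Nat.exists_eq_succ_of_ne_zero (Nat.one_le_iff_ne_zero.1 h1)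
      exact hslot τ s hτ hs
    have hconn : ∀ τ s, 1 ≤ s → s ≤ Θ.L → Θ.Check τ s →
        R (.conn (if (σ τ s).2 then τ else τ + 1) s) := by
      intro τ s h1 h2 h3
      have hτ : τ + 1 < Θ.P := h3.1
      have hin := Or.inl (b := (Ob.conn (if (σ τ s).2 then τ else τ + 1) s).IsT Θ)
        ((hmem _).2 (Or.inr ⟨τ, s, h1, h2, h3, rfl⟩))
      split_ifs at hin ⊢ with hh
      · exact step (hslot' τ s (by omega) h1 h2) hin
          (Ob.diskNear_slot_conn hG (hlt _ _ (by omega) h1 h2) h2 hh)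
      · have hh' := (hσc τ s h1 h2 h3).resolve_left hh
        exact step (hslot' (τ + 1) s hτ h1 h2) hin
          (Ob.diskNear_slot_conn hG (hlt _ _ hτ h1 h2) h2 hh')
    have hcheck : ∀ τ s, 1 ≤ s → s ≤ Θ.L → Θ.Check τ s → R (.lower τ s) ∧ R (.upper τ s) := by
      intro τ s h1 h2 h3
      have hc := hconn τ s h1 h2 h3
      have hl : (Ob.lower τ s).IsT Θ := ⟨h1, h2, h3⟩
      have hu : (Ob.upper τ s).IsT Θ := ⟨h1, h2, h3⟩
      split_ifs at hc
      · have := step hc (Or.inr hl) (Ob.diskNear_conn_lower hG h3.2)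
        exact ⟨this, step this (Or.inr hu) (Ob.diskNear_lower_upper hG)⟩
      · have := step hc (Or.inr hu) (Ob.diskNear_upper_conn hG h3.2).symm
        exact ⟨step this (Or.inr hl) (Ob.diskNear_lower_upper hG).symm, this⟩
    have hall : ∀ o, (o ∈ S ∨ o.IsT Θ) → R o := by
      rintro o (ho | ho)
      · rcases (hmem o).1 ho with ⟨τ, s, h1, h2, h3, rfl⟩ | ⟨τ, s, h2, h3, h4, rfl⟩
        · exact hslot' τ s h1 h2 h3
        · exact hconn τ s h2 h3 h4
      · cases o with
        | priv τ s =>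
          obtain ⟨h1, h2, h3⟩ := ho
          exact step (hslot' τ s h1 h2 h3) (Or.inr ⟨h1, h2, h3⟩)
            (Ob.diskNear_slot_priv hG (hlt _ _ h1 h2 h3) h3)
        | lower τ s => exact (hcheck τ s ho.1 ho.2.1 ho.2.2).1
        | upper τ s => exact (hcheck τ s ho.1 ho.2.1 ho.2.2).2
        | trunk j =>
          obtain ⟨h1, h2⟩ := ho
          have := htrunk (j - 5) (by omega)
          rwa [Nat.sub_add_cancel h1] at this
        | _ => exact ho.elim
    rw [SimpleGraph.connected_iff_exists_forall_reachable]
    refine ⟨root, ?_⟩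
    rintro ⟨x, hx⟩
    have : ∃ o, (o ∈ S ∨ o.IsT Θ) ∧ q o = x := by
      rcases hx with hx | hx
      · obtain ⟨o, ho, rfl⟩ := Finset.mem_image.1 hx; exact ⟨o, Or.inl ho, rfl⟩
      · obtain ⟨o, ho, rfl⟩ := (mem_toSteiner_T hG hD).1 hx; exact ⟨o, Or.inr ho, rfl⟩
    obtain ⟨o, ho, rfl⟩ := this
    exact (hall o ho).2

theorem hasSolution_iff_feasible (hG : LargeMesh Θ G) (hD : 0 < D)
    (hS : ShapeGrid obj (G + 1) D) :
    (Θ.toSteiner G D hG hD).HasSolution obj ↔ Θ.Feasible :=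
  ⟨feasible_of_hasSolution hG hD hS, hasSolution_of_feasible hG hD hS⟩

end TrackSystem

/-! ## Unit squares and unit disks -/

theorem abs_ratPoint_sub (D a b : ℕ) :
    (((((2 * a + 1 : ℕ) : ℚ) / D : ℚ) : ℝ) - ((((2 * b + 1 : ℕ) : ℚ) / D : ℚ) : ℝ)) =
      2 * ((a : ℝ) - b) / D := by
  push_cast; ring

/-- Unit intervals meet if and only if their left ends differ by at most 1. Numerators change in
steps of 2, so the denominator `2 * W` turns this into a lattice difference of at most `W`. -/
theorem shapeGrid_unitSquare {W : ℕ} (hW : 0 < W) : ShapeGrid unitSquare W (2 * W) := by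
  have hW' : (0 : ℝ) < W := by exact_mod_cast hW
  have key : ∀ a b : ℕ, (2 * ((a : ℝ) - b) / ((2 * W : ℕ) : ℝ) ≤ 1 ↔ a ≤ b + W) := by
    intro a b
    rw [div_le_one (by positivity)]; push_cast
    constructor
    · intro h; have : (a : ℝ) ≤ b + W := by linarith
      exact_mod_cast this
    · intro h; have : (a : ℝ) ≤ b + W := by exact_mod_cast h
      linarith
  have hiff : ∀ a b : ℕ, (∃ z : ℝ, z ∈ Set.Icc ((((2 * a + 1 : ℕ) : ℚ) / (2 * W : ℕ) : ℚ) : ℝ)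
      (((((2 * a + 1 : ℕ) : ℚ) / (2 * W : ℕ) : ℚ) : ℝ) + 1) ∧
      z ∈ Set.Icc ((((2 * b + 1 : ℕ) : ℚ) / (2 * W : ℕ) : ℚ) : ℝ)
      (((((2 * b + 1 : ℕ) : ℚ) / (2 * W : ℕ) : ℚ) : ℝ) + 1)) ↔ (a ≤ b + W ∧ b ≤ a + W) := by
    intro a b
    rw [← key a b, ← key b a, ← abs_ratPoint_sub, ← abs_ratPoint_sub]
    generalize ((((2 * a + 1 : ℕ) : ℚ) / (2 * W : ℕ) : ℚ) : ℝ) = x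
    generalize ((((2 * b + 1 : ℕ) : ℚ) / (2 * W : ℕ) : ℚ) : ℝ) = y
    simp only [Set.mem_Icc]
    constructor
    · rintro ⟨z, h1, h2⟩; constructor <;> linarith
    · rintro ⟨h1, h2⟩
      exact ⟨max x y, ⟨le_max_left _ _, max_le (by linarith) (by linarith)⟩, le_max_right _ _,
        max_le (by linarith) (by linarith)⟩
  have hmeet : ∀ p q : ℕ × ℕ, (unitSquare (ratPoint (2 * W) p) ∩
      unitSquare (ratPoint (2 * W) q)).Nonempty ↔ SquareNear W p q := by
    intro p q
    unfold SquareNear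
    rw [← hiff, ← hiff]
    constructor
    · rintro ⟨z, h1, h2⟩
      exact ⟨⟨z 0, h1.1, h2.1⟩, ⟨z 1, h1.2, h2.2⟩⟩
    · rintro ⟨⟨a, h1, h2⟩, ⟨b, h3, h4⟩⟩
      exact ⟨!₂[a, b], ⟨h1, h3⟩, ⟨h2, h4⟩⟩
  refine ⟨fun p q h => (hmeet p q).2 ?_, fun p q => (hmeet p q).1⟩
  unfold DiskNear at h
  have h1 := abs_le_of_sq_le_sq' (a := (p.1 : ℤ) - q.1) (b := W)
    (by nlinarith [sq_nonneg ((p.2 : ℤ) - q.2)]) (by positivity)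
  have h2 := abs_le_of_sq_le_sq' (a := (p.2 : ℤ) - q.2) (b := W)
    (by nlinarith [sq_nonneg ((p.1 : ℤ) - q.1)]) (by positivity)
  refine ⟨⟨?_, ?_⟩, ?_, ?_⟩ <;> omega

/-- Unit disks meet if and only if their centers have distance at most 2, the midpoint being a
witness. The denominator `W` turns this into a lattice distance of at most `W`. -/
theorem shapeGrid_unitDisk {W : ℕ} (hW : 0 < W) : ShapeGrid unitDisk W W := by
  have hW' : (0 : ℝ) < W := by exact_mod_cast hW
  have hmeet : ∀ p q : ℕ × ℕ, (unitDisk (ratPoint W p) ∩ unitDisk (ratPoint W q)).Nonempty ↔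
      DiskNear W p q := by
    intro p q
    have h1 : (unitDisk (ratPoint W p) ∩ unitDisk (ratPoint W q)).Nonempty ↔
        dist (!₂[((ratPoint W p).1 : ℝ), ((ratPoint W p).2 : ℝ)] : Plane)
          !₂[((ratPoint W q).1 : ℝ), ((ratPoint W q).2 : ℝ)] ≤ 2 := by
      unfold unitDisk
      constructor
      · rintro ⟨z, h1, h2⟩
        rw [Metric.mem_closedBall] at h1 h2
        have := dist_triangle_right (!₂[((ratPoint W p).1 : ℝ), ((ratPoint W p).2 : ℝ)] : Plane)
          !₂[((ratPoint W q).1 : ℝ), ((ratPoint W q).2 : ℝ)] z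
        rw [dist_comm _ z, dist_comm _ z] at this
        linarith
      · intro h
        refine ⟨midpoint ℝ !₂[((ratPoint W p).1 : ℝ), ((ratPoint W p).2 : ℝ)]
          !₂[((ratPoint W q).1 : ℝ), ((ratPoint W q).2 : ℝ)], ?_, ?_⟩
        · rw [Metric.mem_closedBall, dist_midpoint_left]; norm_num; linarith
        · rw [Metric.mem_closedBall, dist_midpoint_right]; norm_num; linarith
    rw [h1, EuclideanSpace.dist_eq, Real.sqrt_le_left (by norm_num)]
    simp only [Fin.sum_univ_two, Real.dist_eq, sq_abs]
    have h2 : ((ratPoint W p).1 : ℝ) - ((ratPoint W q).1 : ℝ) = 2 * ((p.1 : ℝ) - q.1) / W :=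
      abs_ratPoint_sub W p.1 q.1
    have h3 : ((ratPoint W p).2 : ℝ) - ((ratPoint W q).2 : ℝ) = 2 * ((p.2 : ℝ) - q.2) / W :=
      abs_ratPoint_sub W p.2 q.2
    simp only [Matrix.cons_val_zero, Matrix.cons_val_one]
    rw [h2, h3, div_pow, div_pow, ← add_div, div_le_iff₀ (by positivity)]
    unfold DiskNear
    rw [← Int.cast_le (R := ℝ)]; push_cast
    constructor <;> intro h <;> nlinarith
  refine ⟨fun p q => (hmeet p q).2, fun p q h => ?_⟩
  have h := (hmeet p q).1 h
  unfold DiskNear at h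
  have h1 := abs_le_of_sq_le_sq' (a := (p.1 : ℤ) - q.1) (b := W)
    (by nlinarith [sq_nonneg ((p.2 : ℤ) - q.2)]) (by positivity)
  have h2 := abs_le_of_sq_le_sq' (a := (p.2 : ℤ) - q.2) (b := W)
    (by nlinarith [sq_nonneg ((p.1 : ℤ) - q.1)]) (by positivity)
  refine ⟨⟨?_, ?_⟩, ?_, ?_⟩ <;> omega

/-! ## Lanes: numbers whose binary digits are supported on a set -/

/-- The numbers below `2 ^ n` whose binary digits are supported on `S`. -/
def lanes (S : ℕ → Bool) : ℕ → List ℕ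
  | 0 => [0]
  | n + 1 => if S n then lanes S n ++ (lanes S n).map (· + 2 ^ n) else lanes S n

theorem lanes_lt {S : ℕ → Bool} {n a : ℕ} (h : a ∈ lanes S n) : a < 2 ^ n := by
  induction n generalizing a with
  | zero => simp [lanes] at h; simp [h]
  | succ n ih =>
    rw [pow_succ]
    simp only [lanes] at h
    split_ifs at h
    · rw [List.mem_append, List.mem_map] at h
      rcases h with h | ⟨b, hb, rfl⟩
      · have := ih h; omega
      · have := ih hb; omega
    · have := ih h; omega

theorem lanes_testBit {S : ℕ → Bool} {n a : ℕ} (h : a ∈ lanes S n) (x : ℕ)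
    (hx : a.testBit x = true) : S x = true := by
  induction n generalizing a with
  | zero => simp [lanes] at h; simp [h] at hx
  | succ n ih =>
    simp only [lanes] at h
    split_ifs at h with hS
    · rw [List.mem_append, List.mem_map] at h
      rcases h with h | ⟨b, hb, rfl⟩
      · exact ih h hx
      · rcases lt_trichotomy x n with hn | rfl | hn
        · rw [add_comm, Nat.testBit_two_pow_add_gt hn] at hx; exact ih hb hx
        · exact hS
        · have h1 := lanes_lt hb
          have h2 : 2 ^ (n + 1) ≤ 2 ^ x := Nat.pow_le_pow_right (by norm_num) hn
          rw [pow_succ] at h2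
          rw [Nat.testBit_lt_two_pow (by omega)] at hx; cases hx
    · exact ih h hx

theorem lanes_nodup (S : ℕ → Bool) (n : ℕ) : (lanes S n).Nodup := by
  induction n with
  | zero => simp [lanes]
  | succ n ih =>
    simp only [lanes]
    split_ifs
    · refine ih.append (ih.map fun a b h => by simpa using h) ?_
      rw [List.disjoint_left]
      intro a ha hb
      obtain ⟨b, _, rfl⟩ := List.mem_map.1 hb
      have := lanes_lt ha; omega
    · exact ih

theorem exists_mem_lanes (S α : ℕ → Bool) (n : ℕ) :
    ∃ a ∈ lanes S n, ∀ x < n, a.testBit x = (S x && α x) := by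
  induction n with
  | zero => exact ⟨0, by simp [lanes], fun x hx => by omega⟩
  | succ n ih =>
    obtain ⟨a, ha, hb⟩ := ih
    have hlt := lanes_lt ha
    by_cases h : (S n && α n) = true
    · have hS : S n = true := by revert h; cases S n <;> simp
      refine ⟨a + 2 ^ n, ?_, fun x hx => ?_⟩
      · simp only [lanes, hS, if_true, List.mem_append, List.mem_map]
        exact Or.inr ⟨a, ha, rfl⟩
      · rcases (Nat.lt_succ_iff_lt_or_eq.1 hx) with hx | rfl
        · rw [add_comm, Nat.testBit_two_pow_add_gt hx, hb x hx]
        · rw [add_comm, Nat.testBit_two_pow_add_eq, Nat.testBit_lt_two_pow hlt, h]; rfl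
    · refine ⟨a, ?_, fun x hx => ?_⟩
      · simp only [lanes]; split_ifs
        · exact List.mem_append_left _ ha
        · exact ha
      · rcases (Nat.lt_succ_iff_lt_or_eq.1 hx) with hx | rfl
        · exact hb x hx
        · rw [Nat.testBit_lt_two_pow hlt]; simpa using h

/-! ## The track system of a formula -/

/-- The set of variables of row `ρ`: those whose residue modulo `r` is one of the three lowest
base-`r` digits of `ρ`. -/
def rowSet (r ρ x : ℕ) : Bool :=
  decide (x % r = ρ % r) || decide (x % r = ρ / r % r) || decide (x % r = ρ / r / r % r)

/-- The literal is satisfied by the digits of `a`, or its variable lies outside `S`. -/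
def litPass {n : ℕ} (S : ℕ → Bool) (a : ℕ) (l : Lit n) : Bool :=
  !S l.1 || (a.testBit l.1 == l.2)

/-- No clause with all variables in `S` is violated by the digits of `a`. -/
def laneOK (φ : CNF3) (S : ℕ → Bool) (a : ℕ) : Bool :=
  φ.clauses.all fun c => litPass S a c.1 || litPass S a c.2.1 || litPass S a c.2.2

/-- The value of the number `a` on track `τ`: it is complemented on odd tracks. -/
def trackVal (N τ a : ℕ) : ℕ := if τ % 2 = 0 then a else 2 ^ N - 1 - a

/-- The variable that is treated in block `i` of pass `q`. -/
def blockVar (N q i : ℕ) : ℕ := if q < 2 then N - 1 - i else i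

/-- The bit for which track `τ` touches its checkpoint at position `s` in pass `q`. -/
def touchBit (q τ s : ℕ) : Bool := xor (decide (q < 2)) (decide ((τ + s) % 2 = 0))

/-- The candidates of the number `a` on track `τ` at position `s`, which is in block `i` of
pass `q`. -/
def laneCands (S : ℕ → Bool) (N τ q i s a : ℕ) : List (ℕ × Bool) :=
  (if (!S (blockVar N q i) || !a.testBit (blockVar N q i)) = true then
    [((8 * N + 8) * trackVal N τ a + 2 * (4 * N - (q * N + i)), !touchBit q τ s)] else []) ++
  (if (!S (blockVar N q i) || a.testBit (blockVar N q i)) = true then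
    [((8 * N + 8) * trackVal N τ a + 2 * (4 * N - (q * N + i)) + 1, touchBit q τ s)] else [])

/-- The candidates on track `τ` at position `s`, which is in block `i` of pass `q`. -/
def blockCands (φ : CNF3) (r τ q i s : ℕ) : List (ℕ × Bool) :=
  (lanes (rowSet r (τ / 2)) φ.numVars).flatMap fun a =>
    if laneOK φ (rowSet r (τ / 2)) a = true then
      laneCands (rowSet r (τ / 2)) φ.numVars τ q i s a else []

/-- The uniform form of the two guarded candidates: the bit `β` is the digit of `a` if the current
variable belongs to the row, and is free otherwise. Free bits let a row relay variables it does not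
know. -/
theorem mem_laneCands {S : ℕ → Bool} {N τ q i s a : ℕ} {c : ℕ × Bool} :
    c ∈ laneCands S N τ q i s a ↔ ∃ β : Bool, (S (blockVar N q i) = true →
      a.testBit (blockVar N q i) = β) ∧ c = ((8 * N + 8) * trackVal N τ a +
        2 * (4 * N - (q * N + i)) + β.toNat, β == touchBit q τ s) := by
  unfold laneCands
  generalize S (blockVar N q i) = b1
  generalize a.testBit (blockVar N q i) = b2
  generalize touchBit q τ s = t
  cases b1 <;> cases b2 <;> cases t <;> simp

theorem laneCands_nodup (S : ℕ → Bool) (N τ q i s a : ℕ) :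
    ((laneCands S N τ q i s a).map Prod.fst).Nodup := by
  unfold laneCands
  split_ifs <;> simp

theorem trackVal_lt {N τ a : ℕ} (h : a < 2 ^ N) : trackVal N τ a < 2 ^ N := by
  unfold trackVal; split_ifs <;> omega

theorem trackVal_inj {N τ a b : ℕ} (ha : a < 2 ^ N) (hb : b < 2 ^ N)
    (h : trackVal N τ a = trackVal N τ b) : a = b := by
  unfold trackVal at h; split_ifs at h <;> omega

/-- The number is the leading digit of a label in base `8 * N + 8`. The rest, twice the number of
remaining blocks plus a bit, is at most `8 * N + 1` and cannot overturn it. -/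
theorem le_of_label_le {N a b u v : ℕ} (h : (8 * N + 8) * a + u ≤ (8 * N + 8) * b + v)
    (hv : v < 8 * N + 8) : a ≤ b := by
  by_contra hc
  have := Nat.mul_le_mul_left (8 * N + 8) (not_le.1 hc)
  rw [Nat.mul_succ] at this; omega

theorem blockCands_label_lt {φ : CNF3} {r τ q i s : ℕ} {c : ℕ × Bool}
    (h : c ∈ blockCands φ r τ q i s) : c.1 < (8 * φ.numVars + 8) * 2 ^ φ.numVars := by
  simp only [blockCands, List.mem_flatMap] at h
  obtain ⟨a, ha, hc⟩ := h
  split_ifs at hc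
  · obtain ⟨β, -, rfl⟩ := mem_laneCands.1 hc
    have h1 := trackVal_lt (τ := τ) (lanes_lt ha)
    have h2 := Nat.mul_le_mul_left (8 * φ.numVars + 8) h1
    rw [Nat.mul_succ] at h2
    have : β.toNat ≤ 1 := Bool.toNat_le β
    simp only; omega
  · simp at hc

theorem blockCands_nodup (φ : CNF3) (r τ q i s : ℕ) :
    ((blockCands φ r τ q i s).map Prod.fst).Nodup := by
  rw [blockCands, List.map_flatMap]
  refine List.nodup_flatMap.2 ⟨fun a _ => ?_, ?_⟩
  · split_ifs
    · exact laneCands_nodup _ _ _ _ _ _ _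
    · simp
  · refine (lanes_nodup (rowSet r (τ / 2)) φ.numVars).pairwise_of_forall_ne
      fun a ha b hb hab => ?_
    simp only [Function.onFun, List.disjoint_left, List.mem_map]
    rintro l ⟨c, hc, rfl⟩ ⟨d, hd, hcd⟩
    split_ifs at hc hd
    · obtain ⟨β, -, rfl⟩ := mem_laneCands.1 hc
      obtain ⟨γ, -, rfl⟩ := mem_laneCands.1 hd
      have h1 : β.toNat ≤ 1 := Bool.toNat_le β
      have h2 : γ.toNat ≤ 1 := Bool.toNat_le γ
      have h3 := le_of_label_le (N := φ.numVars) (u := 2 * (4 * φ.numVars - (q * φ.numVars + i)) +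
        β.toNat) (v := 2 * (4 * φ.numVars - (q * φ.numVars + i)) + γ.toNat)
        (by rw [← add_assoc, ← add_assoc]; exact hcd.ge) (by omega)
      have h4 := le_of_label_le (N := φ.numVars) (u := 2 * (4 * φ.numVars - (q * φ.numVars + i)) +
        γ.toNat) (v := 2 * (4 * φ.numVars - (q * φ.numVars + i)) + β.toNat)
        (by rw [← add_assoc, ← add_assoc]; exact hcd.le) (by omega)
      exact hab (trackVal_inj (lanes_lt ha) (lanes_lt hb) (le_antisymm h3 h4))
    all_goals simp at hc hd

/-- The length of a block. -/
def blockLen (r : ℕ) : ℕ := 2 * r ^ 3 + 2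

/-- The track system of a formula. -/
def formulaTracks (φ : CNF3) (r : ℕ) (hr : 0 < r) : TrackSystem where
  P := 2 * r ^ 3
  L := 4 * φ.numVars * blockLen r
  A := (8 * φ.numVars + 8) * 2 ^ φ.numVars
  cand τ s := blockCands φ r τ ((s - 1) / blockLen r / φ.numVars)
    ((s - 1) / blockLen r % φ.numVars) s
  label_lt _ _ _ h := blockCands_label_lt h
  label_nodup _ _ := blockCands_nodup _ _ _ _ _ _
  P_pos := by positivity
  A_pos := by positivity

/-- Comparing a nonincreasing and a nondecreasing sequence of numbers digit by digit, from the
highest digit on. -/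
theorem div_two_pow_le_of_testBit {f g : ℕ → ℕ} {N : ℕ} (hf : ∀ i, i + 1 < N → f (i + 1) ≤ f i)
    (hg : ∀ i, i + 1 < N → g i ≤ g (i + 1)) (hlt : ∀ i < N, f i < 2 ^ N)
    (hbit : ∀ i < N, (f i).testBit (N - 1 - i) = true → (g i).testBit (N - 1 - i) = true) :
    ∀ i < N, f i / 2 ^ (N - 1 - i) ≤ g i / 2 ^ (N - 1 - i) := by
  -- One digit extends the comparison of leading digits. Between two digits `f` may fall and `g` may
  -- rise, which keeps the inequality, so the digits may be inspected at different times.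
  have step : ∀ a b k : ℕ, a / 2 ^ (k + 1) ≤ b / 2 ^ (k + 1) →
      (a.testBit k = true → b.testBit k = true) → a / 2 ^ k ≤ b / 2 ^ k := by
    intro a b k h1 h2
    rw [Nat.testBit_eq_decide_div_mod_eq, Nat.testBit_eq_decide_div_mod_eq,
      decide_eq_true_eq, decide_eq_true_eq] at h2
    rw [pow_succ, ← Nat.div_div_eq_div_mul, ← Nat.div_div_eq_div_mul] at h1
    omega
  intro i
  induction i with
  | zero =>
    intro h0
    refine step _ _ _ ?_ (hbit 0 h0)
    rw [Nat.sub_zero, Nat.sub_add_cancel h0, Nat.div_eq_of_lt (hlt 0 h0)]; exact Nat.zero_le _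
  | succ i ih =>
    intro hi
    refine step _ _ _ ?_ (hbit _ hi)
    rw [show N - 1 - (i + 1) + 1 = N - 1 - i by omega]
    exact (Nat.div_le_div_right (hf i hi)).trans ((ih (by omega)).trans
      (Nat.div_le_div_right (hg i hi)))

theorem antitone_of_succ_le {L : ℕ} {f : ℕ → ℕ} (h : ∀ s, 1 ≤ s → s + 1 ≤ L → f (s + 1) ≤ f s)
    {s t : ℕ} (hs : 1 ≤ s) (hst : s ≤ t) (ht : t ≤ L) : f t ≤ f s := by
  induction t, hst using Nat.le_induction with
  | base => exact le_rfl
  | succ t hst ih => exact (h t (by omega) ht).trans (ih (by omega))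

/-- The position with offset `o` in block `i` of pass `q`. -/
def blockPos (r N q i o : ℕ) : ℕ := (q * N + i) * blockLen r + o + 1

section
variable {r N q i o : ℕ}

theorem blockPos_div (hi : i < N) (ho : o < blockLen r) :
    (blockPos r N q i o - 1) / blockLen r / N = q ∧
      (blockPos r N q i o - 1) / blockLen r % N = i := by
  have h1 : (blockPos r N q i o - 1) / blockLen r = q * N + i := by
    rw [blockPos, Nat.add_sub_cancel, mul_comm,
      Nat.mul_add_div (by omega), Nat.div_eq_of_lt ho, add_zero]
  rw [h1, mul_comm q N]
  exact ⟨by rw [Nat.mul_add_div (by omega), Nat.div_eq_of_lt hi, add_zero],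
    by rw [Nat.mul_add_mod, Nat.mod_eq_of_lt hi]⟩

theorem blockPos_le (hq : q < 4) (hi : i < N) (ho : o < blockLen r) :
    1 ≤ blockPos r N q i o ∧ blockPos r N q i o ≤ 4 * N * blockLen r := by
  have h1 : q * N + i + 1 ≤ 4 * N := by
    have := Nat.mul_le_mul_right N (show q + 1 ≤ 4 by omega)
    rw [Nat.add_mul] at this; omega
  have h2 := Nat.mul_le_mul_right (blockLen r) h1
  rw [Nat.add_mul _ 1] at h2
  unfold blockPos; omega

theorem exists_blockPos {s : ℕ} (hs : 1 ≤ s) (hs' : s ≤ 4 * N * blockLen r) :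
    ∃ q i o, q < 4 ∧ i < N ∧ o < blockLen r ∧ s = blockPos r N q i o := by
  have hB : 0 < blockLen r := by unfold blockLen; omega
  have h1 : (s - 1) / blockLen r < 4 * N := by rw [Nat.div_lt_iff_lt_mul hB]; omega
  have hN : 0 < N := by by_contra h; simp [show N = 0 by omega] at h1
  refine ⟨(s - 1) / blockLen r / N, (s - 1) / blockLen r % N, (s - 1) % blockLen r,
    by rwa [Nat.div_lt_iff_lt_mul hN], Nat.mod_lt _ hN, Nat.mod_lt _ hB, ?_⟩
  unfold blockPos
  rw [mul_comm _ N, Nat.div_add_mod, mul_comm, Nat.div_add_mod]; omega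

theorem blockPos_le_of_lt {q' i' o' : ℕ} (ho : o < blockLen r)
    (h : q * N + i < q' * N + i') : blockPos r N q i o ≤ blockPos r N q' i' o' := by
  have := Nat.mul_le_mul_right (blockLen r) (show q * N + i + 1 ≤ q' * N + i' from h)
  rw [Nat.add_mul _ 1] at this
  unfold blockPos; omega

/-- Blocks have even length. So the checkpoint pattern is the same in all blocks, and a program
unrolled over the offsets knows the parity of the position in advance. -/
theorem blockPos_mod_two : blockPos r N q i o % 2 = (o + 1) % 2 := by
  unfold blockPos blockLen
  rw [show (q * N + i) * (2 * r ^ 3 + 2) + o + 1 = 2 * ((q * N + i) * (r ^ 3 + 1)) + (o + 1) by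
    ring, Nat.mul_add_mod]

end

theorem rowSet_eq_true {r ρ x : ℕ} : rowSet r ρ x = true ↔
    (x % r = ρ % r ∨ x % r = ρ / r % r) ∨ x % r = ρ / r / r % r := by
  simp [rowSet]

/-- Take the three residues as the base-`r` digits of `ρ`. -/
theorem exists_row {r : ℕ} (hr : 0 < r) (x y z : ℕ) : ∃ ρ < r ^ 3,
    rowSet r ρ x = true ∧ rowSet r ρ y = true ∧ rowSet r ρ z = true := by
  have hx := Nat.mod_lt x hr
  have hy := Nat.mod_lt y hr
  have hz := Nat.mod_lt z hr
  have h1 : (r * (r * (z % r) + y % r) + x % r) % r = x % r := by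
    rw [Nat.mul_add_mod, Nat.mod_mod]
  have h2 : (r * (r * (z % r) + y % r) + x % r) / r = r * (z % r) + y % r := by
    rw [Nat.mul_add_div hr, Nat.div_eq_of_lt hx, add_zero]
  have h3 : (r * (z % r) + y % r) % r = y % r := by rw [Nat.mul_add_mod, Nat.mod_mod]
  have h4 : (r * (z % r) + y % r) / r % r = z % r := by
    rw [Nat.mul_add_div hr, Nat.div_eq_of_lt hy, add_zero, Nat.mod_mod]
  refine ⟨r * (r * (z % r) + y % r) + x % r, ?_, ?_⟩
  · have h5 : r * (z % r) + y % r + 1 ≤ r * r := by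
      have := Nat.mul_le_mul_left r (show z % r + 1 ≤ r from hz)
      rw [Nat.mul_succ] at this; omega
    have h6 := Nat.mul_le_mul_left r h5
    rw [Nat.mul_succ] at h6
    calc _ < r * (r * r) := by omega
      _ = r ^ 3 := by ring
  · simp only [rowSet_eq_true, h1, h2, h3, h4]; simp

theorem litPass_eq_true {n : ℕ} {S : ℕ → Bool} {a : ℕ} {l : Lit n} (hS : S l.1 = true) :
    litPass S a l = true ↔ a.testBit l.1 = l.2 := by
  simp [litPass, hS]

/-! ### Feasibility of the track system and satisfiability of the formula -/

section
variable {φ : CNF3} {r : ℕ} {hr : 0 < r}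

/-- The outer passes freeze the number of every row, and the inner passes make all rows agree on
common variables. The resulting global assignment agrees on each clause with a row that contains the
clause and has checked it. -/
theorem satisfiable_of_feasible (h : (formulaTracks φ r hr).Feasible) : φ.Satisfiable := by
  obtain ⟨σ, hσ, hmono, hcheck⟩ := h
  set N := φ.numVars with hN
  set P := 2 * r ^ 3 with hP
  set L := 4 * N * blockLen r with hL
  have hB : blockLen r = P + 2 := rfl
  -- the numbers and bits of the chosen candidates
  have hex : ∀ τ s, ∃ (a : ℕ) (β : Bool), τ < P → ∀ q i o, q < 4 → i < N → o < blockLen r →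
      s = blockPos r N q i o → a ∈ lanes (rowSet r (τ / 2)) N ∧
      laneOK φ (rowSet r (τ / 2)) a = true ∧
      (rowSet r (τ / 2) (blockVar N q i) = true → a.testBit (blockVar N q i) = β) ∧
      (σ τ s).1 = (8 * N + 8) * trackVal N τ a + 2 * (4 * N - (q * N + i)) + β.toNat ∧
      (σ τ s).2 = (β == touchBit q τ s) := by
    intro τ s
    by_cases hτ : τ < P ∧ 1 ≤ s ∧ s ≤ L
    · obtain ⟨hτ, h1, h2⟩ := hτ
      obtain ⟨q, i, o, hq, hi, ho, rfl⟩ := exists_blockPos h1 h2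
      have h3 := hσ τ _ hτ h1 h2
      change _ ∈ blockCands _ _ _ _ _ _ at h3
      rw [← hN, (blockPos_div hi ho).1, (blockPos_div hi ho).2] at h3
      simp only [blockCands, List.mem_flatMap] at h3
      obtain ⟨a, ha, hc⟩ := h3
      split_ifs at hc with hok
      · obtain ⟨β, hβ, hc⟩ := mem_laneCands.1 hc
        refine ⟨a, β, fun _ q' i' o' hq' hi' ho' he => ?_⟩
        have e1 := blockPos_div (q := q) hi ho
        have e2 := blockPos_div (q := q') hi' ho'
        rw [← he] at e2
        obtain rfl : q = q' := e1.1.symm.trans e2.1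
        obtain rfl : i = i' := e1.2.symm.trans e2.2
        rw [hc]
        exact ⟨ha, hok, hβ, rfl, rfl⟩
      · simp at hc
    · refine ⟨0, true, fun h q i o hq hi ho he => absurd ⟨h, ?_⟩ hτ⟩
      rw [he]; exact blockPos_le hq hi ho
  choose A β hA using hex
  have hA' : ∀ τ s, τ < P → 1 ≤ s → s ≤ L → A τ s ∈ lanes (rowSet r (τ / 2)) N ∧
      laneOK φ (rowSet r (τ / 2)) (A τ s) = true := by
    intro τ s hτ h1 h2
    obtain ⟨q, i, o, hq, hi, ho, rfl⟩ := exists_blockPos h1 h2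
    have := hA τ _ hτ q i o hq hi ho rfl
    exact ⟨this.1, this.2.1⟩
  have hval : ∀ τ s, τ < P → 1 ≤ s → s + 1 ≤ L →
      trackVal N τ (A τ (s + 1)) ≤ trackVal N τ (A τ s) := by
    intro τ s hτ h1 h2
    have hm := hmono τ s hτ h1 h2
    obtain ⟨q, i, o, hq, hi, ho, he⟩ := exists_blockPos h1 (show s ≤ L by omega)
    obtain ⟨q', i', o', hq', hi', ho', he'⟩ := exists_blockPos (show 1 ≤ s + 1 by omega) h2
    have e1 := (hA τ s hτ q i o hq hi ho he).2.2.2.1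
    have e2 := (hA τ (s + 1) hτ q' i' o' hq' hi' ho' he').2.2.2.1
    rw [e1, e2, add_assoc, add_assoc] at hm
    have := Bool.toNat_le (β τ s)
    exact le_of_label_le hm (by omega)
  -- Labels fall on all tracks; because of the complement on odd tracks, the number falls on the
  -- even track of a row and rises on the odd one.
  have heven : ∀ ρ s t, ρ < r ^ 3 → 1 ≤ s → s ≤ t → t ≤ L → A (2 * ρ) t ≤ A (2 * ρ) s := by
    intro ρ s t hρ h1 h2 h3
    refine antitone_of_succ_le (f := A (2 * ρ)) (L := L) (fun s h1 h2 => ?_) h1 h2 h3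
    have := hval (2 * ρ) s (by omega) h1 h2
    simpa [trackVal] using this
  have hodd : ∀ ρ s t, ρ < r ^ 3 → 1 ≤ s → s ≤ t → t ≤ L →
      A (2 * ρ + 1) s ≤ A (2 * ρ + 1) t := by
    intro ρ s t hρ h1 h2 h3
    have := antitone_of_succ_le (f := fun s => trackVal N (2 * ρ + 1) (A (2 * ρ + 1) s)) (L := L)
      (fun s h1 h2 => hval _ s (by omega) h1 h2) h1 h2 h3
    have g1 := lanes_lt (hA' (2 * ρ + 1) s (by omega) h1 (by omega)).1
    have g2 := lanes_lt (hA' (2 * ρ + 1) t (by omega) (by omega) (by omega)).1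
    simp only [trackVal, Nat.mul_add_mod] at this
    norm_num at this; omega
  -- the checkpoints
  have hck : ∀ τ q i o, τ + 1 < P → q < 4 → i < N → o < blockLen r → (τ + o) % 2 = 1 →
      if q < 2 then (β τ (blockPos r N q i o) = true → β (τ + 1) (blockPos r N q i o) = true)
      else (β (τ + 1) (blockPos r N q i o) = true → β τ (blockPos r N q i o) = true) := by
    intro τ q i o hτ hq hi ho hpar
    have hp := blockPos_mod_two (r := r) (N := N) (q := q) (i := i) (o := o)
    have hb := blockPos_le hq hi ho
    have h0 := hcheck τ _ hb.1 hb.2 ⟨hτ, by omega⟩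
    rw [(hA τ _ (by omega) q i o hq hi ho rfl).2.2.2.2,
      (hA (τ + 1) _ hτ q i o hq hi ho rfl).2.2.2.2] at h0
    have t1 : touchBit q τ (blockPos r N q i o) = !decide (q < 2) := by
      unfold touchBit; rw [decide_eq_true (p := (τ + blockPos r N q i o) % 2 = 0) (by omega)]; simp
    have t2 : touchBit q (τ + 1) (blockPos r N q i o) = decide (q < 2) := by
      unfold touchBit
      rw [decide_eq_false (p := (τ + 1 + blockPos r N q i o) % 2 = 0) (by omega)]; simp
    rw [t1, t2] at h0
    split_ifs with hq2 <;> simp only [hq2, decide_true, decide_false] at h0 <;>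
      revert h0 <;> cases β τ (blockPos r N q i o) <;> cases β (τ + 1) (blockPos r N q i o) <;> simp
  have hbitS : ∀ τ s x, τ < P → 1 ≤ s → s ≤ L → (A τ s).testBit x = true →
      rowSet r (τ / 2) x = true := fun τ s x hτ h1 h2 hx =>
    lanes_testBit (hA' τ s hτ h1 h2).1 x hx
  have hβ : ∀ τ q i o, τ < P → q < 4 → i < N → o < blockLen r →
      rowSet r (τ / 2) (blockVar N q i) = true →
      (A τ (blockPos r N q i o)).testBit (blockVar N q i) = β τ (blockPos r N q i o) :=
    fun τ q i o hτ hq hi ho hS => (hA τ _ hτ q i o hq hi ho rfl).2.2.1 hS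
  have hB1 : 1 < blockLen r := by omega
  have hB0 : 0 < blockLen r := by omega
  rcases Nat.eq_zero_or_pos N with hN0 | hN0
  -- Without variables there is no clause; the argument below needs the block `N - 1`.
  · refine ⟨fun _ => true, fun c _ => ?_⟩
    exact absurd c.1.1.2 (by omega)
  -- `sL` and `sR` are the checkpoints where the outer passes inspect the lowest digit: pass 0 goes
  -- from the highest digit down, pass 3 from the lowest up. Offset 1 has the parity of the
  -- checkpoints between the two tracks of a row.
  set sL := blockPos r N 0 (N - 1) 1 with hsL
  set sR := blockPos r N 3 0 1 with hsR
  have hsL1 := blockPos_le (r := r) (N := N) (q := 0) (i := N - 1) (o := 1) (by omega)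
    (by omega) hB1
  have hsR1 := blockPos_le (r := r) (N := N) (q := 3) (i := 0) (o := 1) (by omega) hN0 hB1
  have hleft : ∀ ρ < r ^ 3, A (2 * ρ) sL ≤ A (2 * ρ + 1) sL := by
    intro ρ hρ
    have hpos : ∀ i < N, 1 ≤ blockPos r N 0 i 1 ∧ blockPos r N 0 i 1 ≤ L :=
      fun i hi => blockPos_le (by omega) hi hB1
    have := div_two_pow_le_of_testBit (N := N) (f := fun i => A (2 * ρ) (blockPos r N 0 i 1))
      (g := fun i => A (2 * ρ + 1) (blockPos r N 0 i 1)) ?_ ?_ ?_ ?_ (N - 1) (by omega)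
    · simpa using this
    · intro i hi
      exact heven ρ _ _ hρ (hpos i (by omega)).1 (blockPos_le_of_lt hB1 (by omega)) (hpos _ hi).2
    · intro i hi
      exact hodd ρ _ _ hρ (hpos i (by omega)).1 (blockPos_le_of_lt hB1 (by omega)) (hpos _ hi).2
    · intro i hi
      exact lanes_lt (hA' (2 * ρ) _ (by omega) (hpos i hi).1 (hpos i hi).2).1
    · intro i hi hx
      have hS := hbitS _ _ _ (show 2 * ρ < P by omega) (hpos i hi).1 (hpos i hi).2 hx
      have hS' : rowSet r ((2 * ρ + 1) / 2) (N - 1 - i) = true := by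
        rwa [show (2 * ρ + 1) / 2 = 2 * ρ / 2 by omega]
      have h1 := hβ (2 * ρ) 0 i 1 (by omega) (by omega) hi hB1 hS
      have h2 := hβ (2 * ρ + 1) 0 i 1 (by omega) (by omega) hi hB1 hS'
      have h3 := hck (2 * ρ) 0 i 1 (by omega) (by omega) hi hB1 (by omega)
      simp only [blockVar, Nat.zero_lt_two, if_true] at h1 h2 h3
      rw [h2]; exact h3 (h1 ▸ hx)
  -- The mirror image of `hleft`: read backwards, pass 3 starts with the highest digit, and the odd
  -- track is the falling one.
  have hright : ∀ ρ < r ^ 3, A (2 * ρ + 1) sR ≤ A (2 * ρ) sR := by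
    intro ρ hρ
    have hpos : ∀ i < N, 1 ≤ blockPos r N 3 (N - 1 - i) 1 ∧ blockPos r N 3 (N - 1 - i) 1 ≤ L :=
      fun i hi => blockPos_le (by omega) (by omega) hB1
    have := div_two_pow_le_of_testBit (N := N)
      (f := fun i => A (2 * ρ + 1) (blockPos r N 3 (N - 1 - i) 1))
      (g := fun i => A (2 * ρ) (blockPos r N 3 (N - 1 - i) 1)) ?_ ?_ ?_ ?_ (N - 1) (by omega)
    · simpa using this
    · intro i hi
      exact hodd ρ _ _ hρ (hpos _ hi).1 (blockPos_le_of_lt hB1 (by omega)) (hpos i (by omega)).2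
    · intro i hi
      exact heven ρ _ _ hρ (hpos _ hi).1 (blockPos_le_of_lt hB1 (by omega)) (hpos i (by omega)).2
    · intro i hi
      exact lanes_lt (hA' (2 * ρ + 1) _ (by omega) (hpos i hi).1 (hpos i hi).2).1
    · intro i hi hx
      have hS := hbitS _ _ _ (show 2 * ρ + 1 < P by omega) (hpos i hi).1 (hpos i hi).2 hx
      have hS' : rowSet r ((2 * ρ) / 2) (N - 1 - i) = true := by
        rwa [show 2 * ρ / 2 = (2 * ρ + 1) / 2 by omega]
      have h1 := hβ (2 * ρ + 1) 3 (N - 1 - i) 1 (by omega) (by omega) (by omega) hB1 hS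
      have h2 := hβ (2 * ρ) 3 (N - 1 - i) 1 (by omega) (by omega) (by omega) hB1 hS'
      have h3 := hck (2 * ρ) 3 (N - 1 - i) 1 (by omega) (by omega) (by omega) hB1 (by omega)
      simp only [blockVar, show ¬ (3 < 2) by omega, if_false] at h1 h2 h3
      rw [h2]; exact h3 (h1 ▸ hx)
  -- the numbers are constant between the two outer passes
  have hconst : ∀ τ s, τ < P → sL ≤ s → s ≤ sR → A τ s = A (2 * (τ / 2)) sL := by
    intro τ s hτ h1 h2
    have hρ : τ / 2 < r ^ 3 := by omega
    -- Odd at `sR` ≤ even at `sR` ≤ even at `sL` ≤ odd at `sL` ≤ odd at `sR`, so all values in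
    -- between coincide.
    have g1 := heven (τ / 2) sL s hρ hsL1.1 h1 (by omega)
    have g2 := heven (τ / 2) s sR hρ (by omega) h2 hsR1.2
    have g3 := hodd (τ / 2) sL s hρ hsL1.1 h1 (by omega)
    have g4 := hodd (τ / 2) s sR hρ (by omega) h2 hsR1.2
    have g5 := hleft _ hρ
    have g6 := hright _ hρ
    rcases Nat.even_or_odd' τ with ⟨k, hk | hk⟩
    · rw [show 2 * (τ / 2) = τ by omega] at *; omega
    · rw [show 2 * (τ / 2) + 1 = τ by omega] at *; omega
  have hmid : ∀ q i o, (q = 1 ∨ q = 2) → i < N → o < blockLen r →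
      sL ≤ blockPos r N q i o ∧ blockPos r N q i o ≤ sR := by
    intro q i o hq hi ho
    rcases hq with rfl | rfl <;>
      exact ⟨blockPos_le_of_lt hB1 (by omega), blockPos_le_of_lt ho (by omega)⟩
  -- Inside a block of an inner pass the number and the block index are fixed, so the falling label
  -- leaves only a falling bit.
  have hβmono : ∀ τ q i o, τ < P → (q = 1 ∨ q = 2) → i < N → o + 1 < blockLen r →
      β τ (blockPos r N q i (o + 1)) = true → β τ (blockPos r N q i o) = true := by
    intro τ q i o hτ hq hi ho
    have e : blockPos r N q i (o + 1) = blockPos r N q i o + 1 := by unfold blockPos; omega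
    have hq4 : q < 4 := by omega
    have hb := blockPos_le hq4 hi ho
    have hb' := blockPos_le (r := r) (o := o) hq4 hi (by omega)
    have hm := hmono τ (blockPos r N q i o) hτ hb'.1 (by rw [← e]; exact hb.2)
    rw [← e, (hA τ _ hτ q i o hq4 hi (by omega) rfl).2.2.2.1,
      (hA τ _ hτ q i (o + 1) hq4 hi ho rfl).2.2.2.1] at hm
    have c1 := hmid q i o hq hi (by omega)
    have c2 := hmid q i (o + 1) hq hi ho
    rw [hconst τ _ hτ c1.1 c1.2, hconst τ _ hτ c2.1 c2.2] at hm
    revert hm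
    cases β τ (blockPos r N q i (o + 1)) <;> cases β τ (blockPos r N q i o) <;> simp
  -- Checkpoints alternate in parity from track to track, so crossing one track costs one position.
  -- A true bit stays true towards smaller positions, hence upward travel moves left; in `hchain2`
  -- the downward travel starts at the right end for the same reason.
  have hchain1 : ∀ i < N, ∀ d τ o, τ + d < P → (τ + o) % 2 = 1 → d ≤ o → o < blockLen r →
      β τ (blockPos r N 1 i o) = true → β (τ + d) (blockPos r N 1 i (o - d)) = true := by
    intro i hi d
    induction d with
    | zero => exact fun τ o _ _ _ _ h => h
    | succ d ih =>
      intro τ o h1 h2 h3 h4 h5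
      have h6 := hck τ 1 i o (by omega) (by omega) hi h4 h2
      rw [if_pos (by omega)] at h6
      have h7 := h6 h5
      rw [show o = o - 1 + 1 by omega] at h7
      have h8 := hβmono (τ + 1) 1 i (o - 1) (by omega) (Or.inl rfl) hi (by omega) h7
      have h9 := ih (τ + 1) (o - 1) (by omega) (by omega) (by omega) (by omega) h8
      rwa [show τ + 1 + d = τ + (d + 1) by omega, show o - 1 - d = o - (d + 1) by omega] at h9
  have hchain2 : ∀ i < N, ∀ d τ o, τ + d < P → (τ + o) % 2 = 1 → o + d < blockLen r →
      β (τ + d) (blockPos r N 2 i (o + d)) = true → β τ (blockPos r N 2 i o) = true := by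
    intro i hi d
    induction d with
    | zero => exact fun τ o _ _ _ h => h
    | succ d ih =>
      intro τ o h1 h2 h3 h5
      have h6 := hck τ 2 i o (by omega) (by omega) hi (by omega) h2
      rw [if_neg (by omega)] at h6
      refine h6 (hβmono (τ + 1) 2 i o (by omega) (Or.inr rfl) hi (by omega)
        (ih (τ + 1) (o + 1) (by omega) (by omega) (by omega) ?_))
      rwa [show τ + 1 + d = τ + (d + 1) by omega, show o + 1 + d = o + (d + 1) by omega]
  -- all rows agree on their common variables
  have hagree_lt : ∀ x < N, ∀ ρ ρ', ρ < ρ' → ρ' < r ^ 3 → rowSet r ρ x = true →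
      rowSet r ρ' x = true → (A (2 * ρ) sL).testBit x = (A (2 * ρ') sL).testBit x := by
    intro x hx ρ ρ' hlt hρ' hS hS'
    have k1 : 2 * ρ / 2 = ρ := by omega
    have k2 : 2 * ρ' / 2 = ρ' := by omega
    have v1 : blockVar N 1 (N - 1 - x) = x := by simp [blockVar]; omega
    have v2 : blockVar N 2 x = x := by simp [blockVar]
    have a1 : ∀ ρ q i o, ρ < r ^ 3 → (q = 1 ∨ q = 2) → i < N → o < blockLen r →
        blockVar N q i = x → rowSet r ρ x = true →
        (A (2 * ρ) sL).testBit x = β (2 * ρ) (blockPos r N q i o) := by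
      intro ρ q i o hρ hq hi ho hv hS
      have c := hmid q i o hq hi ho
      have := hβ (2 * ρ) q i o (by omega) (by omega) hi ho
        (by rw [hv, show 2 * ρ / 2 = ρ by omega]; exact hS)
      rwa [hconst _ _ (by omega) c.1 c.2, hv, show 2 * (2 * ρ / 2) = 2 * ρ by omega] at this
    have imp1 : (A (2 * ρ) sL).testBit x = true → (A (2 * ρ') sL).testBit x = true := by
      -- The walk starts at the last offset `P + 1` of the block, which is odd as `P` is even. The
      -- block length `P + 2` leaves room for crossing all tracks.
      rw [a1 ρ 1 (N - 1 - x) (P + 1) (by omega) (Or.inl rfl) (by omega) (by omega) v1 hS,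
        a1 ρ' 1 (N - 1 - x) (P + 1 - (2 * ρ' - 2 * ρ)) (by omega) (Or.inl rfl) (by omega)
          (by omega) v1 hS']
      intro hb
      have := hchain1 (N - 1 - x) (by omega) (2 * ρ' - 2 * ρ) (2 * ρ) (P + 1) (by omega)
        (by omega) (by omega) (by omega) hb
      rwa [show 2 * ρ + (2 * ρ' - 2 * ρ) = 2 * ρ' by omega] at this
    have imp2 : (A (2 * ρ') sL).testBit x = true → (A (2 * ρ) sL).testBit x = true := by
      rw [a1 ρ 2 x 1 (by omega) (Or.inr rfl) hx (by omega) v2 hS,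
        a1 ρ' 2 x (1 + (2 * ρ' - 2 * ρ)) hρ' (Or.inr rfl) hx (by omega) v2 hS']
      intro hb
      refine hchain2 x hx (2 * ρ' - 2 * ρ) (2 * ρ) 1 (by omega) (by omega) (by omega) ?_
      rwa [show 2 * ρ + (2 * ρ' - 2 * ρ) = 2 * ρ' by omega]
    exact Bool.eq_iff_iff.2 ⟨imp1, imp2⟩
  have hagree : ∀ x < N, ∀ ρ ρ', ρ < r ^ 3 → ρ' < r ^ 3 → rowSet r ρ x = true →
      rowSet r ρ' x = true → (A (2 * ρ) sL).testBit x = (A (2 * ρ') sL).testBit x := by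
    intro x hx ρ ρ' hρ hρ' hS hS'
    rcases lt_trichotomy ρ ρ' with h | rfl | h
    · exact hagree_lt x hx ρ ρ' h hρ' hS hS'
    · rfl
    · exact (hagree_lt x hx ρ' ρ h hρ hS' hS).symm
  -- Any row containing `x` may define its value; by `hagree` the choice does not matter.
  choose ρ₀ hρ₀ hS₀ using fun x => exists_row hr x x x
  refine ⟨fun x => (A (2 * ρ₀ x) sL).testBit x, fun c hc => ?_⟩
  obtain ⟨ρ, hρ, hx, hy, hz⟩ := exists_row hr c.1.1 c.2.1.1 c.2.2.1
  have hok := (hA' (2 * ρ) sL (by omega) hsL1.1 hsL1.2).2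
  rw [show 2 * ρ / 2 = ρ by omega, laneOK, List.all_eq_true] at hok
  have h := hok c hc
  rw [Bool.or_eq_true, Bool.or_eq_true, litPass_eq_true hx, litPass_eq_true hy,
    litPass_eq_true hz] at h
  beta_reduce
  rw [hagree _ c.1.1.2 _ ρ (hρ₀ _) hρ (hS₀ _).1 hx,
    hagree _ c.2.1.1.2 _ ρ (hρ₀ _) hρ (hS₀ _).1 hy,
    hagree _ c.2.2.1.2 _ ρ (hρ₀ _) hρ (hS₀ _).1 hz]
  tauto

/-- Every row constantly chooses the restriction of the satisfying assignment, and free bits take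
the global value. Then the two tracks at a checkpoint carry the same bit but touch for opposite
bits, so exactly one of them touches. -/
theorem feasible_of_satisfiable (h : φ.Satisfiable) : (formulaTracks φ r hr).Feasible := by
  set N := φ.numVars with hN
  obtain ⟨α, hα⟩ := h
  let α' : ℕ → Bool := fun x => if hx : x < N then α ⟨x, hx⟩ else false
  choose a ha hbit using fun ρ => exists_mem_lanes (rowSet r ρ) α' N
  have hlit : ∀ ρ (l : Lit φ.numVars), α l.1 = l.2 → litPass (rowSet r ρ) (a ρ) l = true := by
    intro ρ l hl
    unfold litPass
    cases hS : rowSet r ρ l.1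
    · rfl
    · rw [hbit ρ l.1 l.1.2, hS]
      have hlt : (l.1 : ℕ) < N := l.1.2
      simp [α', hlt, hl]
  have hok : ∀ ρ, laneOK φ (rowSet r ρ) (a ρ) = true := by
    intro ρ
    rw [laneOK, List.all_eq_true]
    intro c hc
    rw [Bool.or_eq_true, Bool.or_eq_true]
    rcases hα c hc with h | h | h
    · exact Or.inl (Or.inl (hlit ρ _ h))
    · exact Or.inl (Or.inr (hlit ρ _ h))
    · exact Or.inr (hlit ρ _ h)
  let Q : ℕ → ℕ := fun s => (s - 1) / blockLen r / N
  let I : ℕ → ℕ := fun s => (s - 1) / blockLen r % N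
  let bit : ℕ → Bool := fun s => α' (blockVar N (Q s) (I s))
  have hvar : ∀ {s}, 1 ≤ s → s ≤ 4 * N * blockLen r → blockVar N (Q s) (I s) < N := by
    intro s h1 h2
    obtain ⟨q, i, o, hq, hi, ho, rfl⟩ := exists_blockPos h1 h2
    simp only [Q, I, (blockPos_div hi ho).1, (blockPos_div hi ho).2, blockVar]
    split_ifs <;> omega
  refine ⟨fun τ s => ((8 * N + 8) * trackVal N τ (a (τ / 2)) + 2 * (4 * N - (Q s * N + I s)) +
    (bit s).toNat, bit s == touchBit (Q s) τ s), ?_, ?_, ?_⟩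
  · intro τ s hτ h1 h2
    change _ ∈ blockCands φ r τ (Q s) (I s) s
    rw [blockCands, List.mem_flatMap]
    refine ⟨a (τ / 2), ha _, ?_⟩
    rw [if_pos (hok _)]
    refine mem_laneCands.2 ⟨bit s, fun hS => ?_, rfl⟩
    rw [hbit _ _ (hvar h1 h2), hS]; rfl
  · intro τ s hτ h1 h2
    have hdm : ∀ s, Q s * N + I s = (s - 1) / blockLen r := by
      intro s; simp only [Q, I]; rw [mul_comm]; exact Nat.div_add_mod _ _
    have hB : 0 < blockLen r := by unfold blockLen; omega
    simp only
    rw [add_assoc, add_assoc, Nat.add_le_add_iff_left]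
    by_cases hblk : (s + 1 - 1) / blockLen r = (s - 1) / blockLen r
    · have e1 : Q (s + 1) = Q s := by simp only [Q]; rw [hblk]
      have e2 : I (s + 1) = I s := by simp only [I]; rw [hblk]
      simp only [bit, e1, e2, le_refl]
    -- Entering a new block lowers the label by 2, which pays for any change of the bit. The index
    -- stays below `4 * N`, so the truncated subtraction is genuine.
    · have h3 : (s - 1) / blockLen r ≤ (s + 1 - 1) / blockLen r := Nat.div_le_div_right (by omega)
      have h4 : (s + 1 - 1) / blockLen r < 4 * N := by
        rw [Nat.div_lt_iff_lt_mul hB]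
        have : s + 1 ≤ 4 * N * blockLen r := h2
        omega
      rw [hdm, hdm]
      have := Bool.toNat_le (bit (s + 1))
      omega
  · intro τ s h1 h2 h3
    have hpar := h3.2
    have t1 : touchBit (Q s) τ s = !decide (Q s < 2) := by
      unfold touchBit; rw [decide_eq_true hpar]; simp
    have t2 : touchBit (Q s) (τ + 1) s = decide (Q s < 2) := by
      unfold touchBit; rw [decide_eq_false (p := (τ + 1 + s) % 2 = 0) (by omega)]; simp
    simp only [t1, t2]
    cases bit s <;> cases decide (Q s < 2) <;> simp

theorem feasible_iff_satisfiable : (formulaTracks φ r hr).Feasible ↔ φ.Satisfiable :=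
  ⟨satisfiable_of_feasible, feasible_of_satisfiable⟩

end
/-! ## Reasoning about programs -/

/-- Sequential composition. -/
infixr:30 " ;; " => Program.seq

@[simp] theorem State.setReg_reg (s : State) (x v y : ℕ) :
    (s.setReg x v).reg y = if y = x then v else s.reg y := by
  simp [State.setReg, Function.update_apply]

@[simp] theorem State.setReg_arr (s : State) (x v : ℕ) : (s.setReg x v).arr = s.arr := rfl

@[simp] theorem State.setArr_reg (s : State) (a i v : ℕ) : (s.setArr a i v).reg = s.reg := rfl

@[simp] theorem State.setArr_arr (s : State) (a i v b j : ℕ) :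
    (s.setArr a i v).arr b j = if b = a ∧ j = i then v else s.arr b j := by
  by_cases h : b = a
  · subst h; simp [State.setArr, Function.update_apply]
  · simp [State.setArr, h]

/-- `p` halts on `s` within `T` steps, in a state that satisfies `Q`. -/
def Runs (p : Program) (s : State) (T : ℕ) (Q : State → Prop) : Prop :=
  ∃ t s', Exec p s t s' ∧ t ≤ T ∧ Q s'

theorem Runs.mono {p : Program} {s : State} {T T' : ℕ} {Q Q' : State → Prop} (h : Runs p s T Q)
    (hT : T ≤ T') (hQ : ∀ s', Q s' → Q' s') : Runs p s T' Q' := by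
  obtain ⟨t, s', h1, h2, h3⟩ := h
  exact ⟨t, s', h1, h2.trans hT, hQ _ h3⟩

theorem Runs.seq {p q : Program} {s : State} {T T' : ℕ} {Q R : State → Prop} (h : Runs p s T R)
    (h' : ∀ s', R s' → Runs q s' T' Q) : Runs (p ;; q) s (T + T') Q := by
  obtain ⟨t, s', h1, h2, h3⟩ := h
  obtain ⟨t', s'', h4, h5, h6⟩ := h' s' h3
  exact ⟨t + t', s'', .seq h1 h4, by omega, h6⟩

theorem Runs.ite {p q : Program} {s : State} {x T : ℕ} {Q : State → Prop}
    (hp : s.reg x ≠ 0 → Runs p s T Q) (hq : s.reg x = 0 → Runs q s T Q) :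
    Runs (.ite x p q) s (T + 1) Q := by
  by_cases h : s.reg x = 0
  · obtain ⟨t, s', h1, h2, h3⟩ := hq h
    exact ⟨t + 1, s', .ite_false h h1, by omega, h3⟩
  · obtain ⟨t, s', h1, h2, h3⟩ := hp h
    exact ⟨t + 1, s', .ite_true h h1, by omega, h3⟩

namespace Program

/-- A program without loops. -/
def LoopFree : Program → Prop
  | seq p q => p.LoopFree ∧ q.LoopFree
  | ite _ p q => p.LoopFree ∧ q.LoopFree
  | loop _ _ => False
  | _ => True

/-- A bound for the number of steps of a program without loops. -/
def cost : Program → ℕ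
  | seq p q => p.cost + q.cost
  | ite _ p q => p.cost + q.cost + 1
  | _ => 1

/-- The effect of a program without loops. -/
def run : Program → State → State
  | const x n, s => s.setReg x n
  | add x y z, s => s.setReg x (s.reg y + s.reg z)
  | sub x y z, s => s.setReg x (s.reg y - s.reg z)
  | load x a y, s => s.setReg x (s.arr a (s.reg y))
  | store a x y, s => s.setArr a (s.reg x) (s.reg y)
  | seq p q, s => q.run (p.run s)
  | ite x p q, s => if s.reg x = 0 then q.run s else p.run s
  | loop _ _, s => s

/-- The program does not write to register `x`. -/
def KeepsReg : Program → ℕ → Prop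
  | const y _, x => x ≠ y
  | add y _ _, x => x ≠ y
  | sub y _ _, x => x ≠ y
  | load y _ _, x => x ≠ y
  | store _ _ _, _ => True
  | seq p q, x => p.KeepsReg x ∧ q.KeepsReg x
  | ite _ p q, x => p.KeepsReg x ∧ q.KeepsReg x
  | loop _ p, x => p.KeepsReg x

/-- The program does not write to array `a`. -/
def KeepsArr : Program → ℕ → Prop
  | store b _ _, a => a ≠ b
  | seq p q, a => p.KeepsArr a ∧ q.KeepsArr a
  | ite _ p q, a => p.KeepsArr a ∧ q.KeepsArr a
  | loop _ p, a => p.KeepsArr a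
  | _, _ => True

/-- The states agree on everything that the program does not write to. -/
structure Frame (p : Program) (s s' : State) : Prop where
  reg : ∀ x, p.KeepsReg x → s'.reg x = s.reg x
  arr : ∀ a, p.KeepsArr a → s'.arr a = s.arr a

theorem Frame.refl (p : Program) (s : State) : p.Frame s s := ⟨fun _ _ => rfl, fun _ _ => rfl⟩

theorem Frame.trans {p : Program} {s s' s'' : State} (h : p.Frame s s') (h' : p.Frame s' s'') :
    p.Frame s s'' :=
  ⟨fun x hx => (h'.reg x hx).trans (h.reg x hx), fun a ha => (h'.arr a ha).trans (h.arr a ha)⟩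

end Program

theorem Exec.frame {p : Program} {s s' : State} {t : ℕ} (h : Exec p s t s') : p.Frame s s' := by
  induction h with
  | const | add | sub | load =>
    exact ⟨fun x hx => by rw [State.setReg_reg, if_neg hx], fun a _ => rfl⟩
  | store s a x y =>
    refine ⟨fun x _ => rfl, fun b hb => ?_⟩
    funext j; rw [State.setArr_arr, if_neg fun h => hb h.1]
  | seq _ _ ih ih' =>
    exact ⟨fun x hx => (ih'.reg x hx.2).trans (ih.reg x hx.1),
      fun a ha => (ih'.arr a ha.2).trans (ih.arr a ha.1)⟩
  | ite_true _ _ ih => exact ⟨fun x hx => ih.reg x hx.1, fun a ha => ih.arr a ha.1⟩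
  | ite_false _ _ ih => exact ⟨fun x hx => ih.reg x hx.2, fun a ha => ih.arr a ha.2⟩
  | loop_done => exact ⟨fun _ _ => rfl, fun _ _ => rfl⟩
  | loop_step _ _ _ ih ih' =>
    exact ⟨fun x hx => (ih'.reg x hx).trans (ih.reg x hx),
      fun a ha => (ih'.arr a ha).trans (ih.arr a ha)⟩

theorem Runs.frame {p : Program} {s : State} {T : ℕ} {Q : State → Prop} (h : Runs p s T Q) :
    Runs p s T fun s' => Q s' ∧ p.Frame s s' := by
  obtain ⟨t, s', h1, h2, h3⟩ := h
  exact ⟨t, s', h1, h2, h3, h1.frame⟩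

theorem Program.LoopFree.exec {p : Program} (hp : p.LoopFree) (s : State) :
    ∃ t ≤ p.cost, Exec p s t (p.run s) := by
  induction p generalizing s with
  | const => exact ⟨1, le_rfl, .const _ _ _⟩
  | add => exact ⟨1, le_rfl, .add _ _ _ _⟩
  | sub => exact ⟨1, le_rfl, .sub _ _ _ _⟩
  | load => exact ⟨1, le_rfl, .load _ _ _ _⟩
  | store => exact ⟨1, le_rfl, .store _ _ _ _⟩
  | seq p q ihp ihq =>
    obtain ⟨t, ht, h⟩ := ihp hp.1 s
    obtain ⟨t', ht', h'⟩ := ihq hp.2 (p.run s)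
    exact ⟨t + t', by simp only [Program.cost]; omega, .seq h h'⟩
  | ite x p q ihp ihq =>
    by_cases hx : s.reg x = 0
    · obtain ⟨t, ht, h⟩ := ihq hp.2 s
      refine ⟨t + 1, by simp only [Program.cost]; omega, ?_⟩
      simp only [Program.run, hx, if_true]; exact .ite_false hx h
    · obtain ⟨t, ht, h⟩ := ihp hp.1 s
      refine ⟨t + 1, by simp only [Program.cost]; omega, ?_⟩
      simp only [Program.run, hx, if_false]; exact .ite_true hx h
  | loop => exact hp.elim

theorem Runs.loopFree {p : Program} {s : State} {Q : State → Prop} (hp : p.LoopFree)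
    (h : Q (p.run s)) : Runs p s p.cost Q := by
  obtain ⟨t, ht, he⟩ := hp.exec s
  exact ⟨t, _, he, ht, h⟩

/-- A loop that counts register `c` down. The invariant is indexed by the value of `c`. -/
theorem Runs.loop {c : ℕ} {p : Program} {s : State} {n T : ℕ} (I : ℕ → State → Prop)
    (hc : ∀ k s', I k s' → s'.reg c = k) (h0 : I n s)
    (hstep : ∀ k s', k < n → p.Frame s s' → I (k + 1) s' → Runs p s' T (I k)) :
    Runs (.loop c p) s (n * (T + 1) + 1) (I 0) := by
  have key : ∀ k s', k ≤ n → p.Frame s s' → I k s' →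
      Runs (.loop c p) s' (k * (T + 1) + 1) (I 0) := by
    intro k
    induction k with
    | zero => exact fun s' _ _ hI => ⟨1, s', .loop_done (hc _ _ hI), by omega, hI⟩
    | succ k ih =>
      intro s' hk hf hI
      obtain ⟨t, s'', h1, h2, h3⟩ := hstep k s' hk hf hI
      obtain ⟨t', s''', h4, h5, h6⟩ := ih s'' (by omega) (hf.trans h1.frame) h3
      refine ⟨t + t' + 1, s''', .loop_step (by rw [hc _ _ hI]; omega) h1 h4, ?_, h6⟩
      rw [Nat.add_mul]; omega
  exact key n s le_rfl (Program.Frame.refl _ _) h0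

namespace Program

/-- A program that does nothing of interest: it clears the scratch register `4`. -/
def skip : Program := const 4 0

/-- Add register `y` to register `x`, `n` times. -/
def addN (x y : ℕ) : ℕ → Program
  | 0 => skip
  | n + 1 => addN x y n ;; add x x y

theorem addN_loopFree (x y n : ℕ) : (addN x y n).LoopFree := by
  induction n with
  | zero => trivial
  | succ n ih => exact ⟨ih, trivial⟩

@[simp] theorem addN_cost (x y n : ℕ) : (addN x y n).cost = n + 1 := by
  induction n with
  | zero => rfl
  | succ n ih => simp only [addN, cost, ih]

theorem addN_keepsReg {x y n z : ℕ} (h : z ≠ x) (h4 : z ≠ 4) : (addN x y n).KeepsReg z := by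
  induction n with
  | zero => exact h4
  | succ n ih => exact ⟨ih, h⟩

theorem addN_run {x y n : ℕ} (s : State) (hx : x ≠ 4) (hy : y ≠ 4) (hxy : y ≠ x) :
    (addN x y n).run s = (s.setReg 4 0).setReg x (s.reg x + n * s.reg y) := by
  induction n with
  | zero =>
    simp only [addN, skip, run, State.setReg, Nat.zero_mul, add_zero]
    congr 1; funext z; simp only [Function.update_apply]; split_ifs <;> simp_all
  | succ n ih =>
    simp only [addN, run, ih, State.setReg_reg, if_true, hxy, hy, if_false]
    simp only [State.setReg, Function.update_idem]
    congr 2; ring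

/-- Run all programs of a list. -/
def all : List Program → Program
  | [] => skip
  | p :: l => p ;; all l

theorem all_keepsReg {l : List Program} {x : ℕ} (h : ∀ p ∈ l, p.KeepsReg x) (h4 : x ≠ 4) :
    (all l).KeepsReg x := by
  induction l with
  | nil => exact h4
  | cons p l ih => exact ⟨h p List.mem_cons_self, ih fun q hq => h q (List.mem_cons_of_mem _ hq)⟩

end Program

/-- Running a list of programs that is indexed by `0, …, n - 1`. -/
theorem Runs.all_range {f : ℕ → Program} {n T : ℕ} {s : State} (I : ℕ → State → Prop)
    (h0 : I 0 s) (h4 : ∀ k s', I k s' → I k (s'.setReg 4 0))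
    (hstep : ∀ k s', k < n → I k s' → Runs (f k) s' T (I (k + 1))) :
    Runs (.all ((List.range n).map f)) s (n * T + 1) (I n) := by
  have key : ∀ d k s', k + d = n → I k s' →
      Runs (.all ((List.range' k d).map f)) s' (d * T + 1) (I n) := by
    intro d
    induction d with
    | zero =>
      rintro k s' rfl hI
      exact ⟨1, _, .const _ _ _, by omega, h4 _ _ hI⟩
    | succ d ih =>
      intro k s' hk hI
      rw [List.range'_succ, List.map_cons]
      refine ((hstep k s' (by omega) hI).seq fun s'' h => ih (k + 1) s'' (by omega) h).mono ?_
        fun _ h => h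
      rw [Nat.add_mul]; omega
  rw [List.range_eq_range']
  exact key n 0 s (by omega) h0

/-! ## Relocating a program -/

/-- Shift all registers by `100` and all arrays by `50`. -/
def Program.shift : Program → Program
  | const x n => const (x + 100) n
  | add x y z => add (x + 100) (y + 100) (z + 100)
  | sub x y z => sub (x + 100) (y + 100) (z + 100)
  | load x a y => load (x + 100) (a + 50) (y + 100)
  | store a x y => store (a + 50) (x + 100) (y + 100)
  | seq p q => seq p.shift q.shift
  | ite x p q => ite (x + 100) p.shift q.shift
  | loop x p => loop (x + 100) p.shift

/-- The upper part of `ŝ` is `s`. -/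
def State.Shifted (s ŝ : State) : Prop :=
  (∀ x, ŝ.reg (x + 100) = s.reg x) ∧ ∀ a, ŝ.arr (a + 50) = s.arr a

theorem State.Shifted.setReg {s ŝ : State} (h : s.Shifted ŝ) (x v : ℕ) :
    (s.setReg x v).Shifted (ŝ.setReg (x + 100) v) :=
  ⟨fun y => by simp [h.1 y], fun a => h.2 a⟩

/-- A step-by-step simulation. It lets an arbitrary solver run after the reduction without seeing
the memory that the reduction has used. -/
theorem Exec.shift {p : Program} {s s' : State} {t : ℕ} (h : Exec p s t s') :
    ∀ ŝ, s.Shifted ŝ → ∃ ŝ', Exec p.shift ŝ t ŝ' ∧ s'.Shifted ŝ' := by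
  induction h with
  | const s x n => exact fun ŝ hs => ⟨_, .const _ _ _, hs.setReg _ _⟩
  | add s x y z =>
    intro ŝ hs; rw [← hs.1 y, ← hs.1 z]; exact ⟨_, .add _ _ _ _, hs.setReg _ _⟩
  | sub s x y z =>
    intro ŝ hs; rw [← hs.1 y, ← hs.1 z]; exact ⟨_, .sub _ _ _ _, hs.setReg _ _⟩
  | load s x a y =>
    intro ŝ hs; rw [← hs.1 y, ← hs.2 a]; exact ⟨_, .load _ _ _ _, hs.setReg _ _⟩
  | store s a x y =>
    intro ŝ hs
    refine ⟨_, .store _ _ _ _, fun z => hs.1 z, fun b => ?_⟩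
    funext j; simp [hs.1, hs.2 b]
  | seq _ _ ih ih' =>
    intro ŝ hs
    obtain ⟨ŝ', h1, h2⟩ := ih ŝ hs
    obtain ⟨ŝ'', h3, h4⟩ := ih' ŝ' h2
    exact ⟨_, .seq h1 h3, h4⟩
  | ite_true hx _ ih =>
    intro ŝ hs
    obtain ⟨ŝ', h1, h2⟩ := ih ŝ hs
    exact ⟨_, .ite_true (by rwa [hs.1]) h1, h2⟩
  | ite_false hx _ ih =>
    intro ŝ hs
    obtain ⟨ŝ', h1, h2⟩ := ih ŝ hs
    exact ⟨_, .ite_false (by rwa [hs.1]) h1, h2⟩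
  | loop_done hx => exact fun ŝ hs => ⟨_, .loop_done (by rwa [hs.1]), hs⟩
  | loop_step hx _ _ ih ih' =>
    intro ŝ hs
    obtain ⟨ŝ', h1, h2⟩ := ih ŝ hs
    obtain ⟨ŝ'', h3, h4⟩ := ih' ŝ' h2
    exact ⟨_, .loop_step (by rwa [hs.1]) h1 h3, h4⟩

/-! ## Step bounds that are powers of one number -/

section StepBounds

variable {p q : Program} {s : State} {Y : ℕ} {Q R : State → Prop}

/-- `Y ^ a + Y ^ b ≤ 2 * Y ^ (e - 1) ≤ Y ^ e`. Rounding all times up to powers of `Y` reduces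
running time analysis to comparing numerals; a loop costs two further exponents. -/
theorem Runs.seq_pow (hY : 2 ≤ Y) {a b e : ℕ} (h : Runs p s (Y ^ a) R)
    (h' : ∀ s', R s' → p.Frame s s' → Runs q s' (Y ^ b) Q) (ha : a < e) (hb : b < e) :
    Runs (p ;; q) s (Y ^ e) Q := by
  obtain ⟨e, rfl⟩ : ∃ e', e = e' + 1 := ⟨e - 1, by omega⟩
  refine (h.frame.seq fun s' hs => h' s' hs.1 hs.2).mono ?_ fun _ h => h
  have h1 : Y ^ a ≤ Y ^ e := Nat.pow_le_pow_right (by omega) (by omega)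
  have h2 : Y ^ b ≤ Y ^ e := Nat.pow_le_pow_right (by omega) (by omega)
  rw [pow_succ]; nlinarith [Nat.mul_le_mul_left (Y ^ e) hY]

theorem Runs.ite_pow (hY : 2 ≤ Y) {x a e : ℕ} (hp : s.reg x ≠ 0 → Runs p s (Y ^ a) Q)
    (hq : s.reg x = 0 → Runs q s (Y ^ a) Q) (ha : a < e) : Runs (.ite x p q) s (Y ^ e) Q := by
  refine (Runs.ite hp hq).mono ?_ fun _ h => h
  have h1 : Y ^ (a + 1) ≤ Y ^ e := Nat.pow_le_pow_right (by omega) (by omega)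
  have h2 : 1 ≤ Y ^ a := Nat.one_le_pow _ _ (by omega)
  rw [pow_succ] at h1; nlinarith

theorem mul_pow_add_one_le (hY : 3 ≤ Y) {n a : ℕ} (hn : n ≤ Y) :
    n * (Y ^ a + 1) + 1 ≤ Y ^ (a + 2) := by
  have h2 : 1 ≤ Y ^ a := Nat.one_le_pow _ _ (by omega)
  calc n * (Y ^ a + 1) + 1 ≤ Y * (Y ^ a + 1) + 1 := by gcongr
    _ ≤ Y * (2 * Y ^ a) + Y * Y ^ a := by nlinarith
    _ = 3 * (Y * Y ^ a) := by ring
    _ ≤ Y * (Y * Y ^ a) := by gcongr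
    _ = Y ^ (a + 2) := by ring

theorem Runs.loop_pow (hY : 3 ≤ Y) {c n a e : ℕ} (hn : n ≤ Y) (I : ℕ → State → Prop)
    (hc : ∀ k s', I k s' → s'.reg c = k) (h0 : I n s)
    (hstep : ∀ k s', k < n → p.Frame s s' → I (k + 1) s' → Runs p s' (Y ^ a) (I k))
    (ha : a + 2 ≤ e) : Runs (.loop c p) s (Y ^ e) (I 0) :=
  (Runs.loop I hc h0 hstep).mono ((mul_pow_add_one_le hY hn).trans
    (Nat.pow_le_pow_right (by omega) ha)) fun _ h => h

theorem Runs.all_range_pow (hY : 3 ≤ Y) {f : ℕ → Program} {n a e : ℕ} (hn : n ≤ Y)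
    (I : ℕ → State → Prop) (h0 : I 0 s) (h4 : ∀ k s', I k s' → I k (s'.setReg 4 0))
    (hstep : ∀ k s', k < n → I k s' → Runs (f k) s' (Y ^ a) (I (k + 1))) (ha : a + 2 ≤ e) :
    Runs (.all ((List.range n).map f)) s (Y ^ e) (I n) := by
  refine (Runs.all_range I h0 h4 hstep).mono ?_ fun _ h => h
  refine le_trans ?_ ((mul_pow_add_one_le hY hn).trans (Nat.pow_le_pow_right (by omega) ha))
  gcongr; omega

theorem Runs.loopFree_pow {e : ℕ} (hp : p.LoopFree) (hc : p.cost ≤ Y) (he : 0 < e)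
    (h : Q (p.run s)) : Runs p s (Y ^ e) Q :=
  (Runs.loopFree hp h).mono (hc.trans (Nat.le_self_pow he.ne' Y)) fun _ h => h

theorem Runs.mono_pow (hY : 0 < Y) {a e : ℕ} (h : Runs p s (Y ^ a) Q) (ha : a ≤ e)
    (hQ : ∀ s', p.Frame s s' → Q s' → R s') : Runs p s (Y ^ e) R :=
  h.frame.mono (Nat.pow_le_pow_right hY ha) fun s' hs => hQ s' hs.2 hs.1

end StepBounds

/-! ## Which memory a program writes to -/

/-- The program writes only to registers below `k` and to the arrays in the list. -/
def Program.Within (k : ℕ) (as : List ℕ) : Program → Prop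
  | .const x _ => x < k
  | .add x _ _ => x < k
  | .sub x _ _ => x < k
  | .load x _ _ => x < k
  | .store a _ _ => a ∈ as
  | .seq p q => p.Within k as ∧ q.Within k as
  | .ite _ p q => p.Within k as ∧ q.Within k as
  | .loop _ p => p.Within k as

namespace Program

theorem Within.mono {k l : ℕ} {as bs : List ℕ} {p : Program} (h : p.Within k as) (hk : k ≤ l)
    (hs : as ⊆ bs) : p.Within l bs := by
  induction p with
  | const | add | sub | load => exact lt_of_lt_of_le h hk
  | store => exact hs h
  | seq _ _ ih ih' => exact ⟨ih h.1, ih' h.2⟩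
  | ite _ _ _ ih ih' => exact ⟨ih h.1, ih' h.2⟩
  | loop _ _ ih => exact ih h

theorem Within.keepsReg {k : ℕ} {as : List ℕ} {p : Program} (h : p.Within k as) {x : ℕ}
    (hx : k ≤ x) : p.KeepsReg x := by
  induction p with
  | const | add | sub | load => exact (lt_of_lt_of_le h hx).ne'
  | store => trivial
  | seq _ _ ih ih' => exact ⟨ih h.1, ih' h.2⟩
  | ite _ _ _ ih ih' => exact ⟨ih h.1, ih' h.2⟩
  | loop _ _ ih => exact ih h

theorem Within.keepsArr {k : ℕ} {as : List ℕ} {p : Program} (h : p.Within k as) {a : ℕ}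
    (ha : a ∉ as) : p.KeepsArr a := by
  induction p with
  | const | add | sub | load => trivial
  | store => exact fun e => ha (e ▸ h)
  | seq _ _ ih ih' => exact ⟨ih h.1, ih' h.2⟩
  | ite _ _ _ ih ih' => exact ⟨ih h.1, ih' h.2⟩
  | loop _ _ ih => exact ih h

theorem addN_within {x y n k : ℕ} {as : List ℕ} (hx : x < k) (h4 : 4 < k) :
    (addN x y n).Within k as := by
  induction n with
  | zero => exact h4
  | succ n ih => exact ⟨ih, hx⟩

theorem all_within {l : List Program} {k : ℕ} {as : List ℕ} (h4 : 4 < k)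
    (h : ∀ p ∈ l, p.Within k as) : (all l).Within k as := by
  induction l with
  | nil => exact h4
  | cons p l ih => exact ⟨h p List.mem_cons_self, ih fun q hq => h q (List.mem_cons_of_mem _ hq)⟩

end Program

/-! ## Emission of lattice points

Registers: `2` is the index of the last written cell of the output, `3` the number of emitted
points, `40` holds `1`, `45` holds the denominator. The output is array `50`. -/

/-- The input of a point of a grid with denominator `D`. -/
def record (D : ℕ) (p : ℕ × ℕ) : List ℕ := [0, 2 * p.1 + 1, D, 0, 2 * p.2 + 1, D]

@[simp] theorem record_length (D : ℕ) (p : ℕ × ℕ) : (record D p).length = 6 := rfl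

/-- The output consists of the records of the points of `l`, after three cells that are `0`. -/
structure Emitted (D : ℕ) (l : List (ℕ × ℕ)) (s : State) : Prop where
  ptr : s.reg 2 = 2 + 6 * l.length
  cnt : s.reg 3 = l.length
  out : ∀ j, s.arr 50 j = (0 :: 0 :: 0 :: l.flatMap (record D)).getD j 0

theorem length_flatMap_record (D : ℕ) (l : List (ℕ × ℕ)) :
    (l.flatMap (record D)).length = 6 * l.length := by
  induction l with
  | nil => rfl
  | cons a l ih => simp [ih]; ring

theorem Emitted.congr {D : ℕ} {l : List (ℕ × ℕ)} {s s' : State} (h : Emitted D l s)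
    (h2 : s'.reg 2 = s.reg 2) (h3 : s'.reg 3 = s.reg 3) (h50 : s'.arr 50 = s.arr 50) :
    Emitted D l s' :=
  ⟨h2.trans h.ptr, h3.trans h.cnt, fun j => by rw [h50, h.out]⟩

theorem Emitted.frame {D : ℕ} {l : List (ℕ × ℕ)} {s s' : State} {p : Program}
    (h : Emitted D l s) (hf : p.Frame s s') (h2 : p.KeepsReg 2) (h3 : p.KeepsReg 3)
    (h50 : p.KeepsArr 50) : Emitted D l s' :=
  h.congr (hf.reg _ h2) (hf.reg _ h3) (hf.arr _ h50)

/-- The sign cells `n` and `n + 3` hold the default value 0, which is why emission skips them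
without writing. -/
theorem getD_append_record {A : List ℕ} {n : ℕ} (hA : A.length = n) (D : ℕ) (p : ℕ × ℕ) (j : ℕ) :
    (A ++ record D p).getD j 0 = if j = n + 5 then D else if j = n + 4 then 2 * p.2 + 1 else
      if j = n + 2 then D else if j = n + 1 then 2 * p.1 + 1 else A.getD j 0 := by
  rcases lt_or_ge j n with hj | hj
  · rw [List.getD_append _ _ _ _ (by omega)]
    repeat rw [if_neg (by omega)]
  · rw [List.getD_append_right _ _ _ _ (by omega), List.getD_eq_default A _ (by omega), hA]
    obtain ⟨d, rfl⟩ := Nat.exists_eq_add_of_le hj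
    rw [Nat.add_sub_cancel_left]
    rcases d with _ | _ | _ | _ | _ | _ | d <;> simp [record]

namespace Program

/-- Emit the point whose coordinates are in the registers `8` and `7`. -/
def emit : Program :=
  add 2 2 40 ;; add 2 2 40 ;; add 5 8 8 ;; add 5 5 40 ;; store 50 2 5 ;;
  add 2 2 40 ;; store 50 2 45 ;; add 2 2 40 ;; add 2 2 40 ;; add 5 7 7 ;; add 5 5 40 ;;
  store 50 2 5 ;; add 2 2 40 ;; store 50 2 45 ;; add 3 3 40

theorem emit_spec {D : ℕ} {l : List (ℕ × ℕ)} {s : State} (h : Emitted D l s)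
    (h1 : s.reg 40 = 1) (hD : s.reg 45 = D) :
    Emitted D (l ++ [(s.reg 8, s.reg 7)]) (emit.run s) := by
  refine ⟨?_, ?_, fun j => ?_⟩
  · simp [emit, run, h1, h.ptr]; ring
  · simp [emit, run, h1, h.cnt]
  · rw [List.flatMap_append, ← List.cons_append, ← List.cons_append, ← List.cons_append,
      List.flatMap_cons, List.flatMap_nil, List.append_nil, getD_append_record (n := 3 + 6 * l.length)
        (by simp; omega)]
    simp only [emit, run, State.setReg_reg, State.setReg_arr, State.setArr_reg, State.setArr_arr,
      h1, hD, h.ptr, ← h.out j]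
    simp
    split_ifs <;> first | rfl | omega

/-- Emit the point with horizontal coordinate in register `8`, on level `g` with offset `c`. -/
def emitRow (g c : ℕ) : Program := add 7 25 43 ;; addN 7 44 g ;; addN 7 40 c ;; emit

theorem emitRow_within (g c : ℕ) : (emitRow g c).Within 8 [50] :=
  ⟨by simp [Within], addN_within (by decide) (by decide), addN_within (by decide) (by decide),
    by simp [emit, Within]⟩

theorem emitRow_spec {D : ℕ} {l : List (ℕ × ℕ)} {s : State} {g c Y : ℕ} (h : Emitted D l s)
    (h1 : s.reg 40 = 1) (hz : s.reg 43 = 0) (hD : s.reg 45 = D) (hY : g + c + 20 ≤ Y) :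
    Runs (emitRow g c) s (Y ^ 1)
      (Emitted D (l ++ [(s.reg 8, s.reg 25 + g * s.reg 44 + c)])) := by
  refine Runs.loopFree_pow ⟨trivial, addN_loopFree _ _ _, addN_loopFree _ _ _, ?_⟩ ?_ one_pos ?_
  · simp [emit, LoopFree]
  · simp [emitRow, emit, cost]; omega
  · simp only [emitRow, run, addN_run _ (show 7 ≠ 4 by decide) (show 44 ≠ 4 by decide)
      (show 44 ≠ 7 by decide), addN_run _ (show 7 ≠ 4 by decide) (show 40 ≠ 4 by decide)
      (show 40 ≠ 7 by decide)]
    generalize hs : (State.setReg _ _ _) = s'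
    have e8 : s'.reg 8 = s.reg 8 := by rw [← hs]; simp
    have e7 : s'.reg 7 = s.reg 25 + g * s.reg 44 + c := by rw [← hs]; simp [h1, hz]
    rw [← e7, ← e8]
    exact emit_spec (h.congr (by rw [← hs]; simp) (by rw [← hs]; simp) (by rw [← hs]; simp))
      (by rw [← hs]; simp [h1]) (by rw [← hs]; simp [hD])

/-- Emit the point on level `g` with offset `c` whose horizontal coordinate is in register `24`,
increased by register `47` if `h` is `true`. -/
def emitPoint (h : Bool) (g c : ℕ) : Program := add 8 24 (if h then 47 else 43) ;; emitRow g c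

theorem emitPoint_within (h : Bool) (g c : ℕ) : (emitPoint h g c).Within 9 [50] :=
  ⟨by simp [Within], (emitRow_within g c).mono (by decide) (by simp)⟩

theorem emitPoint_spec {D : ℕ} {l : List (ℕ × ℕ)} {s : State} {h : Bool} {g c Y : ℕ}
    (hE : Emitted D l s) (h1 : s.reg 40 = 1) (hz : s.reg 43 = 0) (hD : s.reg 45 = D)
    (hY : g + c + 20 ≤ Y) :
    Runs (emitPoint h g c) s (Y ^ 2) (Emitted D
      (l ++ [(s.reg 24 + if h then s.reg 47 else 0, s.reg 25 + g * s.reg 44 + c)])) := by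
  refine Runs.seq_pow (by omega) (a := 1) (b := 1) (R := fun s' => s' = _)
    (Runs.loopFree_pow trivial (show 1 ≤ Y by omega) one_pos rfl) ?_ (by decide) (by decide)
  rintro s' rfl -
  have := emitRow_spec (Y := Y) (g := g) (c := c) (s := (add 8 24 (if h then 47 else 43)).run s)
    (D := D) (l := l) (hE.congr (by simp [run]) (by simp [run]) (by simp [run])) (by simp [run, h1])
    (by simp [run, hz]) (by simp [run, hD]) hY
  refine this.mono_pow (by omega) le_rfl fun s' _ h' => ?_
  convert h' using 4
  · cases h <;> simp [run, hz]
  · simp [run]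
  
end Program

/-! ## Decoding a number and checking the clauses -/

/-- The contents of the registers from `40` on, and of the arrays `0` and `1`: constants of the
reduction for the formula `φ`, with mesh `G` and denominator `D`. -/
structure Env (φ : CNF3) (r G D : ℕ) (s : State) : Prop where
  one : s.reg 40 = 1
  vars : s.reg 41 = φ.numVars
  clauses : s.reg 42 = φ.clauses.length
  zero : s.reg 43 = 0
  mesh : s.reg 44 = G
  den : s.reg 45 = D
  base : s.reg 46 = 2 * (4 * φ.numVars * blockLen r) + 2
  far : s.reg 47 = 2 * (4 * φ.numVars * blockLen r) + 2 + 2 * ((8 * φ.numVars + 8) * 2 ^ φ.numVars)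
  full : s.reg 48 = (8 * φ.numVars + 8) * (2 ^ φ.numVars - 1)
  mesh_two : s.reg 49 = G + 2
  six : s.reg 50 = 6
  input : ∀ j, s.arr 0 j = φ.encode.getD j 0
  pow : ∀ y < φ.numVars, s.arr 1 y = (8 * φ.numVars + 8) * 2 ^ y

theorem Env.congr {φ : CNF3} {r G D : ℕ} {s s' : State} (h : Env φ r G D s)
    (hr : ∀ x, 40 ≤ x → s'.reg x = s.reg x) (h0 : s'.arr 0 = s.arr 0) (h1 : s'.arr 1 = s.arr 1) :
    Env φ r G D s' where
  one := (hr _ (by decide)).trans h.one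
  vars := (hr _ (by decide)).trans h.vars
  clauses := (hr _ (by decide)).trans h.clauses
  zero := (hr _ (by decide)).trans h.zero
  mesh := (hr _ (by decide)).trans h.mesh
  den := (hr _ (by decide)).trans h.den
  base := (hr _ (by decide)).trans h.base
  far := (hr _ (by decide)).trans h.far
  full := (hr _ (by decide)).trans h.full
  mesh_two := (hr _ (by decide)).trans h.mesh_two
  six := (hr _ (by decide)).trans h.six
  input j := by rw [h0, h.input]
  pow y hy := by rw [h1, h.pow y hy]

theorem Env.frame {φ : CNF3} {r G D k : ℕ} {as : List ℕ} {p : Program} {s s' : State}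
    (h : Env φ r G D s) (hf : p.Frame s s') (hp : p.Within k as) (hk : k ≤ 40) (h0 : 0 ∉ as)
    (h1 : 1 ∉ as) : Env φ r G D s' :=
  h.congr (fun _ hx => hf.reg _ (hp.keepsReg (hk.trans hx))) (hf.arr _ (hp.keepsArr h0))
    (hf.arr _ (hp.keepsArr h1))

/-- Array `2` describes the set `S`. -/
def HasSet (φ : CNF3) (S : ℕ → Bool) (s : State) : Prop :=
  ∀ z < φ.numVars, s.arr 2 z = (S z).toNat

/-- Array `4` describes the binary digits of `a`. -/
def HasBits (φ : CNF3) (a : ℕ) (s : State) : Prop :=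
  ∀ z < φ.numVars, s.arr 4 z = (a.testBit z).toNat

theorem mod_two_pow_succ_eq (a k : ℕ) :
    a % 2 ^ (k + 1) = a % 2 ^ k + 2 ^ k * (a.testBit k).toNat := by
  rw [Nat.mod_pow_succ, Nat.testBit_eq_decide_div_mod_eq]
  rcases Nat.mod_two_eq_zero_or_one (a / 2 ^ k) with h | h <;> simp [h]

namespace Program

/-- Write the binary digits of the number in register `18` (scaled) to array `4`. -/
def decode : Program :=
  add 9 41 43 ;; add 10 18 43 ;;
  loop 9 (sub 9 9 40 ;; load 5 1 9 ;; sub 6 5 10 ;;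
    ite 6 (store 4 9 43) (sub 10 10 5 ;; store 4 9 40))

theorem decode_within : decode.Within 11 [4] := by simp [decode, Within]

/-- Greedy subtraction of the powers of two from the top. Numbers and powers carry the common factor
`8 * N + 8`, so no division is needed. -/
theorem decode_spec {φ : CNF3} {r G D Y a : ℕ} {s : State} (h : Env φ r G D s)
    (ha : a < 2 ^ φ.numVars) (hs : s.reg 18 = (8 * φ.numVars + 8) * a) (hY : 20 ≤ Y)
    (hN : φ.numVars ≤ Y) : Runs decode s (Y ^ 5) (HasBits φ a) := by
  refine Runs.seq_pow (by omega) (a := 1) (b := 4) (Runs.loopFree_pow trivial (by simp [cost]; omega)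
    one_pos rfl) (R := fun s' => s' = _) ?_ (by decide) (by decide)
  rintro s' rfl -
  refine Runs.seq_pow (by omega) (a := 1) (b := 3) (Runs.loopFree_pow trivial (by simp [cost]; omega)
    one_pos rfl) (R := fun s' => s' = _) ?_ (by decide) (by decide)
  rintro s' rfl -
  refine (Runs.loop_pow (Y := Y) (n := φ.numVars) (a := 1) (e := 3) (by omega) hN
    (fun k s' => s'.reg 9 = k ∧ s'.reg 10 = (8 * φ.numVars + 8) * (a % 2 ^ k) ∧
      ∀ z, k ≤ z → z < φ.numVars → s'.arr 4 z = (a.testBit z).toNat) (fun k s' h => h.1) ?_ ?_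
    (by decide)).mono le_rfl fun s' hs' z hz => hs'.2.2 z (Nat.zero_le _) hz
  · refine ⟨by simp [run, h.vars, h.zero], ?_, fun z h1 h2 => by omega⟩
    simp [run, h.zero, hs, Nat.mod_eq_of_lt ha]
  · rintro k s' hk hf ⟨h1, h2, h3⟩
    have e : Env φ r G D s' := by
      refine Env.congr (s := s) h (fun x hx => ?_) ?_ ?_
      · rw [hf.reg x (by simp [KeepsReg]; omega)]; simp [run, show x ≠ 9 by omega, show x ≠ 10 by omega]
      · rw [hf.arr 0 (by simp [KeepsArr])]; simp [run]
      · rw [hf.arr 1 (by simp [KeepsArr])]; simp [run]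
    refine Runs.loopFree_pow (by simp [LoopFree]) (by simp [cost]; omega) one_pos ?_
    have hb := mod_two_pow_succ_eq a k
    have hm := Nat.mod_lt a (Nat.two_pow_pos k)
    -- The truncated difference of power and remainder is positive exactly if the power does not
    -- fit, that is, if the digit is 0.
    have hlt : a.testBit k = false ↔ 0 < (8 * φ.numVars + 8) * 2 ^ k - (8 * φ.numVars + 8) *
        (a % 2 ^ (k + 1)) := by
      rw [hb]
      rcases a.testBit k with _ | _
      · simp only [Bool.toNat_false, mul_zero, add_zero, true_iff]
        exact Nat.sub_pos_of_lt (Nat.mul_lt_mul_of_pos_left hm (by omega))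
      · simp only [Bool.toNat_true, mul_one, reduceCtorEq, false_iff, not_lt, Nat.mul_add]
        omega
    rw [← e.pow k hk] at hlt
    have hp := e.pow k hk
    simp only [run, State.setReg_reg, State.setReg_arr, h1, h2, e.one, e.zero]
    norm_num
    split_ifs with hz
    · have hbit : a.testBit k = true := by
        by_contra hc
        have := hlt.1 (by simpa using hc); omega
      refine ⟨by simp, ?_, fun z hz1 hz2 => ?_⟩
      · simp [hb, hbit, Nat.mul_add, hp]
      · simp only [State.setArr_arr, State.setReg_arr]
        norm_num
        split_ifs with hzk
        · rw [hzk, hbit]; simp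
        · exact h3 z (by omega) hz2
    · have hbit : a.testBit k = false := hlt.2 (by omega)
      refine ⟨by simp, ?_, fun z hz1 hz2 => ?_⟩
      · simp [hb, hbit, h2]
      · simp only [State.setArr_arr, State.setReg_arr]
        norm_num
        split_ifs with hzk
        · rw [hzk, hbit]; simp
        · exact h3 z (by omega) hz2

/-- Register `12` becomes `1` if the literal at the input position in register `11` passes. -/
def testLit : Program :=
  load 5 0 11 ;; add 11 11 40 ;; load 6 0 11 ;; add 11 11 40 ;; load 13 2 5 ;;
  ite 13 (load 5 4 5 ;; sub 14 5 6 ;; sub 5 6 5 ;; add 14 14 5 ;; ite 14 skip (const 12 1))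
    (const 12 1)

/-- Equality of digit and sign is tested by adding the two truncated differences. Register 12 is
only ever raised, so running three such tests computes the disjunction. -/
theorem testLit_spec {φ : CNF3} {r G D a p : ℕ} {S : ℕ → Bool} {s : State} (h : Env φ r G D s)
    (hS : HasSet φ S s) (ha : HasBits φ a s) (l : Lit φ.numVars) (hp : s.reg 11 = p)
    (h1 : φ.encode.getD p 0 = l.1) (h2 : φ.encode.getD (p + 1) 0 = if l.2 then 1 else 0) :
    (testLit.run s).reg 12 = (if litPass S a l then 1 else s.reg 12) ∧
    (testLit.run s).reg 11 = p + 2 := by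
  obtain ⟨v, b⟩ := l
  have e1 := hS v v.2
  have e2 := ha v v.2
  simp only at h1 h2 ⊢
  simp only [testLit, skip, run, litPass]
  split_ifs <;> simp_all [-List.getD_eq_getElem?_getD, h.input, h.one, Bool.toNat_eq_zero]
  revert e2
  cases b <;> cases a.testBit v <;> simp_all

/-- Process the clause at the input position in register `11`: register `15` becomes `0` if the
clause does not pass. -/
def testClause : Program :=
  const 12 0 ;; testLit ;; testLit ;; testLit ;; ite 12 skip (const 15 0) ;; sub 9 9 40

theorem testLit_frame (s : State) : testLit.Frame s (testLit.run s) := by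
  obtain ⟨t, -, h⟩ := LoopFree.exec (p := testLit) (by simp [testLit, LoopFree, skip]) s
  exact h.frame

theorem testLit_within : testLit.Within 15 [] := by simp [testLit, Within, skip]

theorem testLit_keepsReg_nine : testLit.KeepsReg 9 := by simp [testLit, KeepsReg, skip]

theorem testLit_inv {φ : CNF3} {r G D a : ℕ} {S : ℕ → Bool} {s : State} (h : Env φ r G D s)
    (hS : HasSet φ S s) (ha : HasBits φ a s) :
    Env φ r G D (testLit.run s) ∧ HasSet φ S (testLit.run s) ∧ HasBits φ a (testLit.run s) := by
  have hf := testLit_frame s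
  refine ⟨h.frame hf testLit_within (by decide) (by simp) (by simp), fun z hz => ?_, fun z hz => ?_⟩
  · rw [hf.arr 2 (testLit_within.keepsArr (by simp))]; exact hS z hz
  · rw [hf.arr 4 (testLit_within.keepsArr (by simp))]; exact ha z hz

theorem testClause_spec {φ : CNF3} {r G D a p : ℕ} {S : ℕ → Bool} {s : State} (h : Env φ r G D s)
    (hS : HasSet φ S s) (ha : HasBits φ a s) (c : Lit φ.numVars × Lit φ.numVars × Lit φ.numVars)
    (hp : s.reg 11 = p) (hc : ∀ j, j < 6 → φ.encode.getD (p + j) 0 =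
      (encodeLit c.1 ++ encodeLit c.2.1 ++ encodeLit c.2.2).getD j 0) :
    (testClause.run s).reg 15 = (if litPass S a c.1 || litPass S a c.2.1 || litPass S a c.2.2 then
      s.reg 15 else 0) ∧ (testClause.run s).reg 11 = p + 6 ∧
    (testClause.run s).reg 9 = s.reg 9 - 1 := by
  set s0 := s.setReg 12 0 with hs0
  have i0 : Env φ r G D s0 ∧ HasSet φ S s0 ∧ HasBits φ a s0 :=
    ⟨h.congr (fun x hx => by simp [hs0]; omega) rfl rfl, hS, ha⟩
  have i1 := testLit_inv i0.1 i0.2.1 i0.2.2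
  have i2 := testLit_inv i1.1 i1.2.1 i1.2.2
  have i3 := testLit_inv i2.1 i2.2.1 i2.2.2
  have q1 := testLit_spec i0.1 i0.2.1 i0.2.2 c.1 (p := p) (by simp [hs0, hp])
    (by simpa [encodeLit] using hc 0) (by simpa [encodeLit] using hc 1)
  have q2 := testLit_spec i1.1 i1.2.1 i1.2.2 c.2.1 q1.2
    (by simpa [encodeLit] using hc 2) (by simpa [encodeLit] using hc 3)
  have q3 := testLit_spec i2.1 i2.2.1 i2.2.2 c.2.2 q2.2
    (by simpa [encodeLit] using hc 4) (by simpa [encodeLit] using hc 5)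
  have k : ∀ s x, (x = 9 ∨ 15 ≤ x) → (testLit.run s).reg x = s.reg x := by
    rintro s x (rfl | hx)
    · exact (testLit_frame s).reg _ testLit_keepsReg_nine
    · exact (testLit_frame s).reg _ (testLit_within.keepsReg hx)
  have k15 : (testLit.run (testLit.run (testLit.run s0))).reg 15 = s.reg 15 := by
    rw [k _ _ (by simp), k _ _ (by simp), k _ _ (by simp)]; simp [hs0]
  have k9 : (testLit.run (testLit.run (testLit.run s0))).reg 9 = s.reg 9 := by
    rw [k _ _ (by simp), k _ _ (by simp), k _ _ (by simp)]; simp [hs0]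
  have e : s0.reg 12 = 0 := by simp [hs0]
  have z := i3.1.one
  have hk : testClause.run s = (sub 9 9 40).run ((ite 12 skip (const 15 0)).run
      (testLit.run (testLit.run (testLit.run s0)))) := rfl
  rw [hk]
  generalize testLit.run (testLit.run (testLit.run s0)) = s3 at *
  simp only [run, skip]
  rw [q3.1, q2.1, q1.1, e]
  cases litPass S a c.1 <;> cases litPass S a c.2.1 <;> cases litPass S a c.2.2 <;>
    simp [q3.2, k15, k9, z]

/-- Register `15` becomes nonzero if all clauses pass. -/
def check : Program := const 15 1 ;; const 11 2 ;; add 9 42 43 ;; loop 9 testClause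

theorem testClause_within : testClause.Within 16 [] := by
  have := testLit_within.mono (show 15 ≤ 16 by decide) (List.Subset.refl [])
  simp [testClause, Within, skip, this]

theorem check_within : check.Within 16 [] := by simp [check, Within, testClause_within]

theorem _root_.List.getD_flatMap_const {α β : Type*} {l : List α} {f : α → List β} {n : ℕ} (d : β)
    (hf : ∀ a ∈ l, (f a).length = n) {i j : ℕ} (hi : i < l.length) (hj : j < n) :
    (l.flatMap f).getD (n * i + j) d = (f l[i]).getD j d := by
  induction l generalizing i with
  | nil => simp at hi
  | cons a l ih =>
    have ha := hf a List.mem_cons_self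
    rw [List.flatMap_cons]
    rcases i with _ | i
    · simp only [mul_zero, zero_add, List.getElem_cons_zero]
      rw [List.getD_append _ _ _ _ (by omega)]
    · rw [List.getD_append_right _ _ _ _ (by rw [ha, Nat.mul_succ]; omega), ha]
      have e : n * (i + 1) + j - n = n * i + j := by rw [Nat.mul_succ]; omega
      rw [e, ih (fun b hb => hf b (List.mem_cons_of_mem _ hb)) (by simpa using hi)]
      simp

theorem encode_getD_clause (φ : CNF3) {i j : ℕ} (hi : i < φ.clauses.length) (hj : j < 6) :
    φ.encode.getD (2 + 6 * i + j) 0 = (encodeLit φ.clauses[i].1 ++ encodeLit φ.clauses[i].2.1 ++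
      encodeLit φ.clauses[i].2.2).getD j 0 := by
  rw [← List.getD_flatMap_const (f := fun c : Lit φ.numVars × Lit φ.numVars × Lit φ.numVars =>
    encodeLit c.1 ++ encodeLit c.2.1 ++ encodeLit c.2.2) 0 (fun c _ => by simp [encodeLit]) hi hj]
  have : 2 + 6 * i + j = 6 * i + j + 1 + 1 := by omega
  rw [this, CNF3.encode, List.getD_cons_succ, List.getD_cons_succ]

theorem check_spec {φ : CNF3} {r G D Y a : ℕ} {S : ℕ → Bool} {s : State} (h : Env φ r G D s)
    (hS : HasSet φ S s) (ha : HasBits φ a s) (hY : 100 ≤ Y) (hm : φ.clauses.length ≤ Y) :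
    Runs check s (Y ^ 6) fun s' => s'.reg 15 ≠ 0 ↔ laneOK φ S a = true := by
  refine Runs.seq_pow (by omega) (a := 1) (b := 5) (Runs.loopFree_pow trivial (by simp [cost]; omega)
    one_pos rfl) (R := fun s' => s' = _) ?_ (by decide) (by decide)
  rintro s' rfl -
  refine Runs.seq_pow (by omega) (a := 1) (b := 4) (Runs.loopFree_pow trivial (by simp [cost]; omega)
    one_pos rfl) (R := fun s' => s' = _) ?_ (by decide) (by decide)
  rintro s' rfl -
  refine Runs.seq_pow (by omega) (a := 1) (b := 3) (Runs.loopFree_pow trivial (by simp [cost]; omega)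
    one_pos rfl) (R := fun s' => s' = _) ?_ (by decide) (by decide)
  rintro s' rfl -
  refine (Runs.loop_pow (Y := Y) (n := φ.clauses.length) (a := 1) (e := 3) (by omega) hm
    (fun k s' => s'.reg 9 = k ∧ s'.reg 11 = 2 + 6 * (φ.clauses.length - k) ∧
      (s'.reg 15 ≠ 0 ↔ ((φ.clauses.take (φ.clauses.length - k)).all fun c =>
        litPass S a c.1 || litPass S a c.2.1 || litPass S a c.2.2) = true)) (fun k s' h => h.1) ?_ ?_
    (by decide)).mono le_rfl fun s' hs' => ?_
  · simp [run, h.clauses, h.zero]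
  · rintro k s' hk hf ⟨h1, h2, h3⟩
    have e : Env φ r G D s' := by
      refine Env.congr (s := s) h (fun x hx => ?_) ?_ ?_
      · rw [hf.reg x (testClause_within.keepsReg (by omega))]
        simp [run, show x ≠ 9 by omega, show x ≠ 11 by omega, show x ≠ 15 by omega]
      · rw [hf.arr 0 (testClause_within.keepsArr (by simp))]; simp [run]
      · rw [hf.arr 1 (testClause_within.keepsArr (by simp))]; simp [run]
    have eS : HasSet φ S s' := by
      intro z hz; rw [hf.arr 2 (testClause_within.keepsArr (by simp))]; simpa [run] using hS z hz
    have ea : HasBits φ a s' := by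
      intro z hz; rw [hf.arr 4 (testClause_within.keepsArr (by simp))]; simpa [run] using ha z hz
    obtain ⟨i, hi⟩ : ∃ i, i = φ.clauses.length - (k + 1) := ⟨_, rfl⟩
    have hi' : i < φ.clauses.length := by omega
    obtain ⟨g1, g2, g3⟩ := testClause_spec e eS ea φ.clauses[i] h2
      (fun j hj => by rw [← hi]; exact encode_getD_clause φ hi' hj)
    have hk' : φ.clauses.length - k = i + 1 := by omega
    refine Runs.loopFree_pow (by simp [testClause, testLit, skip, LoopFree])
      (by simp [testClause, testLit, skip, cost]; omega) one_pos ⟨by rw [g3, h1]; rfl, ?_, ?_⟩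
    · rw [g2, hk', ← hi]; ring
    · rw [g1, hk', List.take_succ_eq_append_getElem hi', List.all_append, Bool.and_eq_true]
      rw [← hi] at h3
      split_ifs with hc
      · simp only [List.all_cons, List.all_nil, hc, Bool.and_true, and_true]; exact h3
      · simp only [List.all_cons, List.all_nil, Bool.and_true]; simp [hc]
  · rw [hs'.2.2]; simp [laneOK]

end Program

/-! ## The candidates of one slot -/

theorem Runs.step {p q : Program} {s : State} {Y b e : ℕ} {Q : State → Prop} (hp : p.LoopFree)
    (hc : p.cost ≤ Y) (h : Runs q (p.run s) (Y ^ b) Q) (hY : 2 ≤ Y) (hb : 0 < b) (he : b < e) :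
    Runs (p ;; q) s (Y ^ e) Q :=
  Runs.seq_pow hY (a := 1) (b := b) (R := fun s' => s' = p.run s)
    (Runs.loopFree_pow hp hc one_pos rfl) (by rintro s' rfl -; exact h) (by omega) he

/-- The position counters of a sweep over track `τ` after `n` positions. -/
structure At (φ : CNF3) (r G τ n : ℕ) (s : State) : Prop where
  slotX : s.reg 23 = n * G + (2 * (4 * φ.numVars * blockLen r) + 2)
  nearX : s.reg 24 = n * (G + 2)
  baseY : s.reg 25 = 5 * τ * G + 6 * n

/-- The tables of track `τ`: its set of variables and its (scaled) lanes. -/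
structure HasRow (φ : CNF3) (r τ : ℕ) (s : State) : Prop where
  set : HasSet φ (rowSet r (τ / 2)) s
  count : s.reg 26 = (lanes (rowSet r (τ / 2)) φ.numVars).length
  lane : ∀ j (hj : j < (lanes (rowSet r (τ / 2)) φ.numVars).length),
    s.arr 3 j = (8 * φ.numVars + 8) * (lanes (rowSet r (τ / 2)) φ.numVars)[j]

theorem At.congr {φ : CNF3} {r G τ n : ℕ} {s s' : State} (h : At φ r G τ n s)
    (h1 : s'.reg 23 = s.reg 23) (h2 : s'.reg 24 = s.reg 24) (h3 : s'.reg 25 = s.reg 25) :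
    At φ r G τ n s' :=
  ⟨h1.trans h.slotX, h2.trans h.nearX, h3.trans h.baseY⟩

theorem At.frame {φ : CNF3} {r G τ n k : ℕ} {as : List ℕ} {p : Program} {s s' : State}
    (h : At φ r G τ n s) (hf : p.Frame s s') (hp : p.Within k as) (hk : k ≤ 23) :
    At φ r G τ n s' :=
  h.congr (hf.reg _ (hp.keepsReg hk)) (hf.reg _ (hp.keepsReg (by omega)))
    (hf.reg _ (hp.keepsReg (by omega)))

theorem HasRow.congr {φ : CNF3} {r τ : ℕ} {s s' : State} (h : HasRow φ r τ s)
    (h1 : s'.reg 26 = s.reg 26) (h2 : s'.arr 2 = s.arr 2) (h3 : s'.arr 3 = s.arr 3) :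
    HasRow φ r τ s' :=
  ⟨fun z hz => by rw [h2, h.set z hz], h1.trans h.count, fun j hj => by rw [h3, h.lane j hj]⟩

theorem HasRow.frame {φ : CNF3} {r τ k : ℕ} {as : List ℕ} {p : Program} {s s' : State}
    (h : HasRow φ r τ s) (hf : p.Frame s s') (hp : p.Within k as) (hk : k ≤ 26) (h2 : 2 ∉ as)
    (h3 : 3 ∉ as) : HasRow φ r τ s' :=
  h.congr (hf.reg _ (hp.keepsReg hk)) (hf.arr _ (hp.keepsArr h2)) (hf.arr _ (hp.keepsArr h3))

/-- The number `Y` is large enough to bound all numbers of steps. -/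
structure Ample (φ : CNF3) (r Y : ℕ) : Prop where
  vars : φ.numVars ≤ Y
  clauses : φ.clauses.length ≤ Y
  lanes : ∀ ρ, (lanes (rowSet r ρ) φ.numVars).length ≤ Y
  const : 100 * blockLen r + 1000 ≤ Y
  const_sq : 100 * blockLen r ^ 2 ≤ Y

namespace Program

/-- Emit the candidate of the digit `β` with vertical offset `c`. -/
def emitCand (β : Bool) (c : ℕ) : Program :=
  add 8 19 22 ;; add 8 8 (if β then 40 else 43) ;; add 8 8 8 ;; add 8 8 23 ;; emitRow 5 c

theorem emitCand_within (β : Bool) (c : ℕ) : (emitCand β c).Within 9 [50] := by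
  have := (emitRow_within 5 c).mono (show 8 ≤ 9 by decide) (List.Subset.refl _)
  simp [emitCand, Within, this]

theorem emitCand_spec {φ : CNF3} {r G D Y c : ℕ} {β : Bool} {l : List (ℕ × ℕ)} {s : State}
    (h : Env φ r G D s) (hE : Emitted D l s) (hY : c + 30 ≤ Y) :
    Runs (emitCand β c) s (Y ^ 5) (Emitted D (l ++ [(s.reg 23 + 2 * (s.reg 19 + s.reg 22 + β.toNat),
      s.reg 25 + 5 * G + c)])) := by
  refine Runs.step trivial (show 1 ≤ Y by omega) ?_ (by omega) (b := 4) (by decide) (by decide)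
  refine Runs.step trivial (show 1 ≤ Y by omega) ?_ (by omega) (b := 3) (by decide) (by decide)
  refine Runs.step trivial (show 1 ≤ Y by omega) ?_ (by omega) (b := 2) (by decide) (by decide)
  refine Runs.step trivial (show 1 ≤ Y by omega) ?_ (by omega) (b := 1) (by decide) (by decide)
  have := emitRow_spec (Y := Y) (g := 5) (c := c) (s := (add 8 8 23).run ((add 8 8 8).run
    ((add 8 8 (if β then 40 else 43)).run ((add 8 19 22).run s))))
    (D := D) (l := l) (hE.congr (by simp [run]) (by simp [run]) (by simp [run]))
    (by simp [run, h.one]) (by simp [run, h.zero]) (by simp [run, h.den]) (by omega)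
  refine this.mono_pow (by omega) le_rfl fun s' _ h' => ?_
  convert h' using 4
  · cases β <;> simp [run, h.one, h.zero] <;> ring
  · simp [run, h.mesh]

/-- Emission under the condition that register `13` is zero or register `14` is nonzero
respectively zero. -/
def guarded (β : Bool) (p : Program) : Program :=
  .ite 13 (if β then .ite 14 p skip else .ite 14 skip p) p

theorem guarded_within {β : Bool} {p : Program} {k : ℕ} {as : List ℕ} (h : p.Within k as)
    (hk : 4 < k) : (guarded β p).Within k as := by
  cases β <;> simp [guarded, Within, skip, h, hk]

/-- The condition is the one that guards the two candidates in `laneCands`, for `β` false and `β`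
true. -/
theorem guarded_spec {D Y a : ℕ} {β S b : Bool} {p : Program} {l l' : List (ℕ × ℕ)} {s : State}
    (hS : s.reg 13 = S.toNat) (hb : s.reg 14 = b.toNat) (hE : Emitted D l s) (hY : 2 ≤ Y)
    (h : Runs p s (Y ^ a) (Emitted D (l ++ l'))) :
    Runs (guarded β p) s (Y ^ (a + 2)) (Emitted D (l ++
      if (!S || (b == β)) = true then l' else [])) := by
  have hskip : Runs skip s (Y ^ a) (Emitted D l) :=
    (Runs.loopFree (p := skip) trivial (hE.congr (by simp [skip, run]) (by simp [skip, run])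
      (by simp [skip, run]))).mono (Nat.one_le_pow _ _ (by omega)) fun _ h => h
  have hp : Runs p s (Y ^ (a + 1)) (Emitted D (l ++ l')) :=
    h.mono (Nat.pow_le_pow_right (by omega) (by omega)) fun _ h => h
  refine Runs.ite_pow hY (a := a + 1) (fun h13 => ?_) (fun h13 => ?_) (by omega)
  · have hS' : S = true := by cases S <;> simp_all
    subst hS'
    cases β
    · refine Runs.ite_pow hY (a := a) (fun h14 => ?_) (fun h14 => ?_) (by omega)
      · cases b <;> simp_all
      · cases b <;> simp_all
    · refine Runs.ite_pow hY (a := a) (fun h14 => ?_) (fun h14 => ?_) (by omega)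
      · cases b <;> simp_all
      · cases b <;> simp_all
  · have hS' : S = false := by cases S <;> simp_all
    subst hS'
    simpa using hp

end Program

/-- The vertical offset of a candidate on its level, without the contribution of the position. -/
def slotOff (τ s : ℕ) (touch : Bool) : ℕ :=
  if touch then (if (τ + s) % 2 = 0 then 4 else 0) else 2

theorem slotOff_le (τ s : ℕ) (touch : Bool) : slotOff τ s touch ≤ 4 := by
  unfold slotOff; split_ifs <;> omega

theorem slotOff_congr {τ s s' : ℕ} (h : s % 2 = s' % 2) (touch : Bool) :
    slotOff τ s touch = slotOff τ s' touch := by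
  have : (τ + s) % 2 = (τ + s') % 2 := by omega
  simp [slotOff, this]

theorem touchBit_congr {q τ s s' : ℕ} (h : s % 2 = s' % 2) : touchBit q τ s = touchBit q τ s' := by
  have : (τ + s) % 2 = (τ + s') % 2 := by omega
  simp [touchBit, this]

/-- The lattice points of the candidates of one number. -/
def lanePoints (φ : CNF3) (r G τ q i s a : ℕ) : List (ℕ × ℕ) :=
  if laneOK φ (rowSet r (τ / 2)) a = true then
    (laneCands (rowSet r (τ / 2)) φ.numVars τ q i s a).map fun c =>
      (s * G + (2 * (4 * φ.numVars * blockLen r) + 2 + 2 * c.1),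
        (5 * τ + 5) * G + (6 * s + slotOff τ s c.2)) else []

namespace Program

/-- Emit the candidates of the lane whose index is in register `17`. The parity of the position is
that of `s`. -/
def laneBody (τ q s : ℕ) : Program :=
  load 18 3 17 ;; decode ;; check ;;
  (if τ % 2 = 0 then add 19 18 43 else sub 19 48 18) ;; load 13 2 21 ;; load 14 4 21 ;;
  ite 15 (guarded false (emitCand false (slotOff τ s (!touchBit q τ s))) ;;
    guarded true (emitCand true (slotOff τ s (touchBit q τ s)))) skip ;;
  add 17 17 40 ;; sub 16 16 40

theorem laneBody_within (τ q s : ℕ) : (laneBody τ q s).Within 20 [4, 50] := by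
  refine ⟨by simp [Within], decode_within.mono (by decide) (by simp),
    check_within.mono (by decide) (by simp), by split_ifs <;> simp [Within], by simp [Within],
    by simp [Within], ⟨⟨?_, ?_⟩, by simp [skip, Within]⟩, by simp [Within], by simp [Within]⟩
  · exact (guarded_within (emitCand_within _ _) (by decide)).mono (by decide) (by simp)
  · exact (guarded_within (emitCand_within _ _) (by decide)).mono (by decide) (by simp)

/-- The program knows only the parity `p` of the position; `slotOff_congr` and `touchBit_congr` show
that nothing else about `s` matters apart from the counters. -/
theorem laneBody_spec {φ : CNF3} {r G D Y τ q i p s j : ℕ} {l : List (ℕ × ℕ)} {σ : State}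
    (hY : Ample φ r Y) (h : Env φ r G D σ) (hR : HasRow φ r τ σ) (hA : At φ r G τ s σ)
    (hp : p % 2 = s % 2) (hi : i < φ.numVars) (hx : σ.reg 21 = blockVar φ.numVars q i)
    (ho : σ.reg 22 = 2 * (4 * φ.numVars - (q * φ.numVars + i)))
    (hj : j < (lanes (rowSet r (τ / 2)) φ.numVars).length) (h17 : σ.reg 17 = j)
    (hE : Emitted D l σ) :
    Runs (laneBody τ q p) σ (Y ^ 20) fun σ' => Emitted D (l ++ lanePoints φ r G τ q i s
      (lanes (rowSet r (τ / 2)) φ.numVars)[j]) σ' ∧ σ'.reg 17 = j + 1 ∧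
      σ'.reg 16 = σ.reg 16 - 1 := by
  have hc := hY.const
  have hY2 : 2 ≤ Y := by omega
  obtain ⟨a, ha⟩ : ∃ a, a = (lanes (rowSet r (τ / 2)) φ.numVars)[j] := ⟨_, rfl⟩
  have hlt : a < 2 ^ φ.numVars := lanes_lt (by rw [ha]; exact List.getElem_mem hj)
  rw [← ha]
  have hxN : blockVar φ.numVars q i < φ.numVars := by unfold blockVar; split_ifs <;> omega
  refine Runs.step trivial (show 1 ≤ Y by omega) ?_ hY2 (b := 19) (by decide) (by decide)
  obtain ⟨s1, hs1⟩ : ∃ s1, s1 = (load 18 3 17).run σ := ⟨_, rfl⟩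
  rw [← hs1]
  have h1 : Env φ r G D s1 := h.congr (fun x hx => by simp [hs1, run]; omega) (by simp [hs1, run])
    (by simp [hs1, run])
  have a1 : s1.reg 18 = (8 * φ.numVars + 8) * a := by simp [hs1, run, h17, hR.lane j hj, ha]
  have r1 : HasRow φ r τ s1 := hR.congr (by simp [hs1, run]) (by simp [hs1, run])
    (by simp [hs1, run])
  have t1 : At φ r G τ s s1 := hA.congr (by simp [hs1, run]) (by simp [hs1, run])
    (by simp [hs1, run])
  have e1 : Emitted D l s1 := hE.congr (by simp [hs1, run]) (by simp [hs1, run])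
    (by simp [hs1, run])
  have v1 : s1.reg 16 = σ.reg 16 ∧ s1.reg 17 = j ∧ s1.reg 21 = blockVar φ.numVars q i ∧
      s1.reg 22 = 2 * (4 * φ.numVars - (q * φ.numVars + i)) := by
    simp [hs1, run, h17, hx, ho]
  refine Runs.seq_pow hY2 (decode_spec h1 hlt a1 (by omega) hY.vars) (b := 18) ?_ (by decide)
    (by decide)
  intro s2 b2 f2
  have w2 := decode_within
  have h2 := h1.frame f2 w2 (by decide) (by simp) (by simp)
  have r2 := r1.frame f2 w2 (by decide) (by simp) (by simp)
  have t2 := t1.frame f2 w2 (by decide)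
  have e2 := e1.frame f2 (by simp [decode, KeepsReg]) (by simp [decode, KeepsReg])
    (by simp [decode, KeepsArr])
  refine Runs.seq_pow hY2 (check_spec h2 r2.set b2 (by omega) hY.clauses) (b := 17) ?_ (by decide)
    (by decide)
  intro s3 o3 f3
  have w3 := check_within
  have h3 := h2.frame f3 w3 (by decide) (by simp) (by simp)
  have r3 := r2.frame f3 w3 (by decide) (by simp) (by simp)
  have t3 := t2.frame f3 w3 (by decide)
  have e3 := e2.frame f3 (by simp [check, testClause, testLit, skip, KeepsReg])
    (by simp [check, testClause, testLit, skip, KeepsReg]) (w3.keepsArr (by simp))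
  have b3 : HasBits φ a s3 := fun z hz => by
    rw [f3.arr 4 (w3.keepsArr (by simp))]; exact b2 z hz
  have v3 : ∀ x, 16 ≤ x → s3.reg x = s1.reg x := fun x hx => by
    rw [f3.reg x (w3.keepsReg hx), f2.reg x (w2.keepsReg (by omega))]
  refine Runs.step (by split_ifs <;> trivial) (by split_ifs <;> simp only [cost] <;> omega) ?_ hY2
    (b := 16) (by decide) (by decide)
  refine Runs.step trivial (show 1 ≤ Y by omega) ?_ hY2 (b := 15) (by decide) (by decide)
  refine Runs.step trivial (show 1 ≤ Y by omega) ?_ hY2 (b := 14) (by decide) (by decide)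
  -- The scaled complement on odd tracks is one subtraction from register 48, which holds the scaled
  -- value of `2 ^ N - 1`.
  obtain ⟨mv, hmv⟩ : ∃ mv, mv = (8 * φ.numVars + 8) * trackVal φ.numVars τ a := ⟨_, rfl⟩
  have hrun : (if τ % 2 = 0 then add 19 18 43 else sub 19 48 18).run s3 = s3.setReg 19 mv := by
    rw [hmv, trackVal]
    split_ifs
    · simp [run, v3, a1, h1.zero]
    · simp [run, v3, a1, h1.full, Nat.mul_sub]
  rw [hrun]
  obtain ⟨s4, hs4⟩ : ∃ s4, s4 = (load 14 4 21).run ((load 13 2 21).run (s3.setReg 19 mv)) :=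
    ⟨_, rfl⟩
  rw [← hs4]
  have k4 : ∀ x, x ≠ 13 → x ≠ 14 → x ≠ 19 → s4.reg x = s3.reg x := fun x _ _ _ => by
    simp [run, *]
  have m4 : s4.arr = s3.arr := by simp [hs4, run]
  have h4 : Env φ r G D s4 := h3.congr (fun x hx => k4 x (by omega) (by omega) (by omega))
    (by rw [m4]) (by rw [m4])
  have e4 : Emitted D l s4 := e3.congr (k4 _ (by decide) (by decide) (by decide))
    (k4 _ (by decide) (by decide) (by decide)) (by rw [m4])
  have t4 : At φ r G τ s s4 := t3.congr (k4 _ (by decide) (by decide) (by decide))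
    (k4 _ (by decide) (by decide) (by decide)) (k4 _ (by decide) (by decide) (by decide))
  have x4 : s4.reg 13 = (rowSet r (τ / 2) (blockVar φ.numVars q i)).toNat := by
    simp [hs4, run, v3, v1.2.2.1, r3.set _ hxN]
  have y4 : s4.reg 14 = (a.testBit (blockVar φ.numVars q i)).toNat := by
    simp [hs4, run, v3, v1.2.2.1, b3 _ hxN]
  have z4 : s4.reg 19 = mv ∧ s4.reg 15 = s3.reg 15 ∧ s4.reg 16 = σ.reg 16 ∧ s4.reg 17 = j ∧
      s4.reg 22 = 2 * (4 * φ.numVars - (q * φ.numVars + i)) := by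
    simp [hs4, run, v3, v1]
  refine Runs.seq_pow hY2 (a := 12) (b := 3) (R := Emitted D (l ++ lanePoints φ r G τ q i s a))
    ?_ ?_ (by decide) (by decide)
  · refine Runs.ite_pow hY2 (a := 11) (fun h15 => ?_) (fun h15 => ?_) (by decide)
    · have ok : laneOK φ (rowSet r (τ / 2)) a = true := o3.1 (by rwa [z4.2.1] at h15)
      have gw : ∀ β c, (guarded β (emitCand β c)).Within 9 [50] := fun β c =>
        guarded_within (emitCand_within _ _) (by decide)
      refine Runs.seq_pow hY2 (guarded_spec x4 y4 e4 hY2 (emitCand_spec h4 e4 ?_)) (b := 10) ?_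
        (by decide) (by decide)
      · have := slotOff_le τ p (!touchBit q τ p); omega
      · intro s5 e5 f5
        have h5 := h4.frame f5 (gw _ _) (by decide) (by simp) (by simp)
        have k5 : ∀ x, 9 ≤ x → s5.reg x = s4.reg x := fun x hx => f5.reg x ((gw _ _).keepsReg hx)
        refine (guarded_spec (a := 5) (by rw [k5 _ (by decide), x4]) (by rw [k5 _ (by decide), y4])
          e5 hY2 (emitCand_spec h5 e5 ?_)).mono_pow (by omega) (by decide) fun s6 _ e6 => ?_
        · have := slotOff_le τ p (touchBit q τ p); omega
        · convert e6 using 1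
          rw [List.append_assoc]
          congr 1
          rw [lanePoints, if_pos ok, laneCands, List.map_append]
          congr 1
          · rw [apply_ite (List.map _)]
            have : ∀ b : Bool, (b == false) = !b := by decide
            simp only [this, List.map_cons, List.map_nil, t4.slotX, t4.baseY, z4, hmv,
              slotOff_congr hp, touchBit_congr hp]
            congr 3
            · simp; ring
            · ring
          · rw [apply_ite (List.map _)]
            have : ∀ b : Bool, (b == true) = b := by decide
            simp only [this, List.map_cons, List.map_nil, k5 _ (show 9 ≤ 23 by decide),
              k5 _ (show 9 ≤ 19 by decide), k5 _ (show 9 ≤ 22 by decide),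
              k5 _ (show 9 ≤ 25 by decide), t4.slotX, t4.baseY, z4, hmv,
              slotOff_congr hp, touchBit_congr hp]
            congr 3
            · simp; ring
            · ring
    · have ok : ¬ laneOK φ (rowSet r (τ / 2)) a = true := fun hc => o3.2 hc (by rwa [← z4.2.1])
      rw [lanePoints, if_neg ok, List.append_nil]
      exact Runs.loopFree_pow trivial (show 1 ≤ Y by omega) (by decide)
        (e4.congr (by simp [skip, run]) (by simp [skip, run]) (by simp [skip, run]))
  · intro s5 e5 f5
    have gw : ∀ c c', (ite 15 (guarded false (emitCand false c) ;;
        guarded true (emitCand true c')) skip).Within 9 [50] := fun c c' =>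
      ⟨⟨guarded_within (emitCand_within _ _) (by decide),
        guarded_within (emitCand_within _ _) (by decide)⟩, by simp [skip, Within]⟩
    have k5 : ∀ x, 9 ≤ x → s5.reg x = s4.reg x := fun x hx => f5.reg x ((gw _ _).keepsReg hx)
    refine Runs.loopFree_pow (by simp [LoopFree]) (by simp [cost]; omega) (by decide) ⟨?_, ?_, ?_⟩
    · exact e5.congr (by simp [run]) (by simp [run]) (by simp [run])
    · simp [run, k5, z4, h4.one]
    · simp [run, k5, z4, h4.one]

end Program

/-! ## One slot -/

section Slots

variable {φ : CNF3} {r : ℕ} {hr : 0 < r} {G D Y τ q i o s : ℕ} {l : List (ℕ × ℕ)} {σ : State}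

/-- The lattice points of the non-terminals of one slot. -/
def pointsV (φ : CNF3) (r : ℕ) (hr : 0 < r) (G τ s : ℕ) : List (ℕ × ℕ) :=
  (((formulaTracks φ r hr).cand τ s).map (Ob.slot τ s) ++
    if (formulaTracks φ r hr).HasConn τ s then [Ob.conn τ s] else []).map
      (Ob.pos (formulaTracks φ r hr) G)

/-- The lattice points of the terminals of one slot. -/
def pointsT (φ : CNF3) (r : ℕ) (hr : 0 < r) (G τ s : ℕ) : List (ℕ × ℕ) :=
  (Ob.priv τ s :: if (formulaTracks φ r hr).Check τ s then [Ob.lower τ s, Ob.upper τ s]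
    else []).map (Ob.pos (formulaTracks φ r hr) G)

theorem lanePoints_eq (hr : 0 < r) (a : ℕ) : lanePoints φ r G τ q i s a =
    (if laneOK φ (rowSet r (τ / 2)) a = true then
      laneCands (rowSet r (τ / 2)) φ.numVars τ q i s a else []).map
        fun c => (Ob.slot τ s c).pos (formulaTracks φ r hr) G := by
  rw [lanePoints]
  split_ifs
  · rfl
  · rfl

namespace Program

/-- Emit the non-terminals of a slot in pass `q` whose position has the parity of `p`. -/
def slotV (P τ q p : ℕ) : Program :=
  add 16 26 43 ;; const 17 0 ;; loop 16 (laneBody τ q p) ;;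
  (if (τ + p) % 2 = 0 then (if τ + 1 < P then emitPoint false 6 4 else skip)
    else (if 0 < τ then emitPoint true 4 0 else skip))

theorem slotV_within (P τ q p : ℕ) : (slotV P τ q p).Within 20 [4, 50] := by
  refine ⟨by simp [Within], by simp [Within], laneBody_within _ _ _, ?_⟩
  have := fun h g c => (emitPoint_within h g c).mono (show 9 ≤ 20 by decide)
    (show [50] ⊆ [4, 50] by simp)
  split_ifs <;> simp [this, skip, Within]

theorem skip_spec {e : ℕ} (hY : 1 ≤ Y) (hE : Emitted D l σ) :
    Runs skip σ (Y ^ e) (Emitted D l) :=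
  (Runs.loopFree (p := skip) trivial (hE.congr (by simp [skip, run]) (by simp [skip, run])
    (by simp [skip, run]))).mono (Nat.one_le_pow _ _ hY) fun _ h => h

theorem emitPoint_at_spec (hY : Ample φ r Y) (h : Env φ r G D σ) (hA : At φ r G τ s σ)
    (hE : Emitted D l σ) (b : Bool) {g c : ℕ} (hg : g + c ≤ 20) :
    Runs (emitPoint b g c) σ (Y ^ 2) (Emitted D (l ++ [(s * G + (2 * s + if b then
      2 * (4 * φ.numVars * blockLen r) + 2 + 2 * ((8 * φ.numVars + 8) * 2 ^ φ.numVars) else 0),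
        (5 * τ + g) * G + (6 * s + c))])) := by
  refine (emitPoint_spec (g := g) (c := c) (h := b) hE h.one h.zero h.den
    (by have := hY.const; omega)).mono_pow (by have := hY.const; omega) le_rfl fun s' _ h' => ?_
  convert h' using 4
  · rw [hA.nearX, h.far]; ring
  · rw [hA.baseY, h.mesh]; ring

theorem slotV_spec {p : ℕ} (hY : Ample φ r Y) (h : Env φ r G D σ) (hR : HasRow φ r τ σ)
    (hA : At φ r G τ (blockPos r φ.numVars q i o) σ) (hp : p % 2 = blockPos r φ.numVars q i o % 2)
    (hi : i < φ.numVars) (ho : o < blockLen r) (hx : σ.reg 21 = blockVar φ.numVars q i)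
    (hoff : σ.reg 22 = 2 * (4 * φ.numVars - (q * φ.numVars + i))) (hE : Emitted D l σ) :
    Runs (slotV (2 * r ^ 3) τ q p) σ (Y ^ 25)
      (Emitted D (l ++ pointsV φ r hr G τ (blockPos r φ.numVars q i o))) := by
  have hc := hY.const
  have hY2 : 2 ≤ Y := by omega
  obtain ⟨s, hs⟩ : ∃ s, s = blockPos r φ.numVars q i o := ⟨_, rfl⟩
  rw [← hs] at hA hp ⊢
  set LL := lanes (rowSet r (τ / 2)) φ.numVars with hLL
  refine Runs.step trivial (show 1 ≤ Y by omega) ?_ hY2 (b := 24) (by decide) (by decide)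
  refine Runs.step trivial (show 1 ≤ Y by omega) ?_ hY2 (b := 23) (by decide) (by decide)
  obtain ⟨s1, hs1⟩ : ∃ s1, s1 = (const 17 0).run ((add 16 26 43).run σ) := ⟨_, rfl⟩
  rw [← hs1]
  have k1 : ∀ x, x ≠ 16 → x ≠ 17 → s1.reg x = σ.reg x := fun x _ _ => by simp [run, *]
  have m1 : s1.arr = σ.arr := by simp [hs1, run]
  have h1 : Env φ r G D s1 := h.congr (fun x hx => k1 x (by omega) (by omega)) (by rw [m1])
    (by rw [m1])
  have r1 : HasRow φ r τ s1 := hR.congr (k1 _ (by decide) (by decide)) (by rw [m1]) (by rw [m1])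
  have t1 : At φ r G τ s s1 := hA.congr (k1 _ (by decide) (by decide)) (k1 _ (by decide) (by decide))
    (k1 _ (by decide) (by decide))
  refine Runs.seq_pow hY2 (a := 22) (b := 5) (R := Emitted D (l ++
    ((formulaTracks φ r hr).cand τ s).map fun c => (Ob.slot τ s c).pos (formulaTracks φ r hr) G))
    ?_ ?_ (by decide) (by decide)
  · refine (Runs.loop_pow (Y := Y) (n := LL.length) (a := 20) (by omega) (hY.lanes _)
      (fun k s' => s'.reg 16 = k ∧ s'.reg 17 = LL.length - k ∧ Emitted D (l ++
        (LL.take (LL.length - k)).flatMap (lanePoints φ r G τ q i s)) s') (fun k s' h => h.1) ?_ ?_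
      (by decide)).mono le_rfl fun s' hs' => ?_
    · refine ⟨by simp [hs1, run, hR.count, h.zero, hLL], by simp [hs1, run], ?_⟩
      simpa using hE.congr (k1 2 (by decide) (by decide)) (k1 3 (by decide) (by decide))
        (by rw [m1])
    · rintro k s' hk hf ⟨g1, g2, g3⟩
      have w := laneBody_within τ q p
      have hjk : LL.length - (k + 1) < LL.length := by omega
      refine (laneBody_spec hY (h1.frame hf w (by decide) (by simp) (by simp))
        (r1.frame hf w (by decide) (by simp) (by simp)) (t1.frame hf w (by decide)) hp hi
        ((hf.reg _ (w.keepsReg (by decide))).trans ((k1 21 (by decide) (by decide)).trans hx))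
        ((hf.reg _ (w.keepsReg (by decide))).trans ((k1 22 (by decide) (by decide)).trans hoff))
        hjk g2 g3).mono le_rfl ?_
      rintro s'' ⟨e1, e2, e3⟩
      refine ⟨by rw [e3, g1]; rfl, by rw [e2]; omega, ?_⟩
      have e : LL.length - k = LL.length - (k + 1) + 1 := by omega
      rw [e, List.take_succ_eq_append_getElem hjk, List.flatMap_append, ← List.append_assoc]
      simpa using e1
    · have e := hs'.2.2
      rw [Nat.sub_zero, List.take_length] at e
      convert e using 2
      have hd := blockPos_div (r := r) (q := q) hi ho
      rw [← hs] at hd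
      simp only [formulaTracks, hd.1, hd.2, blockCands, List.map_flatMap]
      congr 1
      funext a
      exact (lanePoints_eq hr a).symm
  · intro s2 e2 f2
    have w := laneBody_within τ q p
    have h2 := h1.frame f2 w (by decide) (by simp) (by simp)
    have t2 := t1.frame f2 w (by decide)
    have key : ∀ (P : Program) (pts : List (ℕ × ℕ)), Runs P s2 (Y ^ 2) (Emitted D ((l ++
        ((formulaTracks φ r hr).cand τ s).map fun c => (Ob.slot τ s c).pos (formulaTracks φ r hr) G)
          ++ pts)) → (if (formulaTracks φ r hr).HasConn τ s then [Ob.conn τ s] else []).map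
            (Ob.pos (formulaTracks φ r hr) G) = pts →
        Runs P s2 (Y ^ 5) (Emitted D (l ++ pointsV φ r hr G τ s)) := by
      intro P pts hP he
      refine hP.mono_pow (by omega) (by decide) fun s' _ h' => ?_
      convert h' using 1
      rw [pointsV, List.map_append, he, List.append_assoc, List.map_map]; rfl
    have hup : (τ + p) % 2 = (τ + s) % 2 := by omega
    rw [hup]
    split_ifs with c1 c2 c2
    · refine key _ _ (emitPoint_at_spec hY h2 t2 e2 false (by decide)) ?_
      rw [if_pos ⟨fun _ => c2, fun c => absurd c1 c⟩]
      simp [Ob.pos, Ob.col, Ob.lev, Ob.offX, Ob.offY, c1]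
    · refine key _ [] (by simpa using skip_spec (by omega) e2) ?_
      rw [if_neg fun c => c2 (c.1 c1)]; rfl
    · refine key _ _ (emitPoint_at_spec hY h2 t2 e2 true (by decide)) ?_
      rw [if_pos ⟨fun c => absurd c c1, fun _ => c2⟩]
      simp [Ob.pos, Ob.col, Ob.lev, Ob.offX, Ob.offY, c1, formulaTracks]
    · refine key _ [] (by simpa using skip_spec (by omega) e2) ?_
      rw [if_neg fun c => c2 (c.2 c1)]; rfl

/-- Emit the terminals of a slot whose position has the parity of `p`. -/
def slotT (P τ p : ℕ) : Program :=
  if (τ + p) % 2 = 0 then emitPoint true 4 4 ;;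
    (if τ + 1 < P then emitPoint false 7 2 ;; emitPoint true 8 2 else skip)
  else emitPoint false 6 0

theorem slotT_within (P τ p : ℕ) : (slotT P τ p).Within 20 [4, 50] := by
  have := fun h g c => (emitPoint_within h g c).mono (show 9 ≤ 20 by decide)
    (show [50] ⊆ [4, 50] by simp)
  unfold slotT
  split_ifs <;> simp [this, skip, Within]

theorem slotT_spec {p : ℕ} (hY : Ample φ r Y) (h : Env φ r G D σ) (hA : At φ r G τ s σ)
    (hp : p % 2 = s % 2) (hE : Emitted D l σ) :
    Runs (slotT (2 * r ^ 3) τ p) σ (Y ^ 25) (Emitted D (l ++ pointsT φ r hr G τ s)) := by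
  have hc := hY.const
  have hY2 : 2 ≤ Y := by omega
  have hup : (τ + p) % 2 = (τ + s) % 2 := by omega
  have w := fun h g c => emitPoint_within h g c
  unfold slotT
  rw [hup]
  split_ifs with c1 c2
  · refine Runs.seq_pow hY2 (emitPoint_at_spec hY h hA hE true (by decide)) (b := 24) ?_ (by decide)
      (by decide)
    intro s1 e1 f1
    have h1 := h.frame f1 (w _ _ _) (by decide) (by simp) (by simp)
    have t1 := hA.frame f1 (w _ _ _) (by decide)
    refine Runs.seq_pow hY2 (emitPoint_at_spec hY h1 t1 e1 false (by decide)) (b := 3) ?_ (by decide)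
      (by decide)
    intro s2 e2 f2
    have h2 := h1.frame f2 (w _ _ _) (by decide) (by simp) (by simp)
    have t2 := t1.frame f2 (w _ _ _) (by decide)
    refine (emitPoint_at_spec hY h2 t2 e2 true (by decide)).mono_pow (by omega) (by decide)
      fun s3 _ e3 => ?_
    convert e3 using 1
    rw [pointsT, if_pos ⟨c2, c1⟩]
    simp [Ob.pos, Ob.col, Ob.lev, Ob.offX, Ob.offY, c1, formulaTracks]
  · refine Runs.seq_pow hY2 (emitPoint_at_spec hY h hA hE true (by decide)) (b := 24) ?_ (by decide)
      (by decide)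
    intro s1 e1 f1
    refine (skip_spec (e := 24) (by omega) e1).mono_pow (by omega) le_rfl fun s' _ h' => ?_
    convert h' using 2
    rw [pointsT, if_neg fun c => c2 c.1]
    simp [Ob.pos, Ob.col, Ob.lev, Ob.offX, Ob.offY, c1, formulaTracks]
  · refine (emitPoint_at_spec hY h hA hE false (by decide)).mono_pow (by omega) (by decide)
      fun s' _ h' => ?_
    convert h' using 2
    rw [pointsT, if_neg fun c => c1 c.2]
    simp [Ob.pos, Ob.col, Ob.lev, Ob.offX, Ob.offY, c1]

end Program

end Slots

/-! ## Sweeping over all slots -/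

section Sweep

variable {φ : CNF3} {r : ℕ} {G D Y τ : ℕ} {l : List (ℕ × ℕ)} {f : ℕ → ℕ → List (ℕ × ℕ)}
  {body : ℕ → ℕ → Program}

/-- The program `body q o` treats the slot with offset `o` of a block of pass `q` on track `τ`: it
emits the points that `f` assigns to it. -/
structure TreatsSlots (φ : CNF3) (r G D Y τ : ℕ) (f : ℕ → List (ℕ × ℕ)) (body : ℕ → ℕ → Program) :
    Prop where
  within : ∀ q o, (body q o).Within 20 [4, 50]
  spec : ∀ q i o l σ, q < 4 → i < φ.numVars → o < blockLen r → Env φ r G D σ → HasRow φ r τ σ →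
    At φ r G τ (blockPos r φ.numVars q i o) σ → σ.reg 21 = blockVar φ.numVars q i →
    σ.reg 22 = 2 * (4 * φ.numVars - (q * φ.numVars + i)) → Emitted D l σ →
    Runs (body q o) σ (Y ^ 25) (Emitted D (l ++ f (blockPos r φ.numVars q i o)))

/-- The situation after `n` slots of track `τ`. -/
structure Swept (φ : CNF3) (r G D τ : ℕ) (f : ℕ → List (ℕ × ℕ)) (l : List (ℕ × ℕ)) (n : ℕ)
    (σ : State) : Prop where
  env : Env φ r G D σ
  row : HasRow φ r τ σ
  pos : At φ r G τ n σ
  out : Emitted D (l ++ (List.range n).flatMap fun i => f (i + 1)) σ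

theorem Swept.congr {f : ℕ → List (ℕ × ℕ)} {n : ℕ} {σ σ' : State} (h : Swept φ r G D τ f l n σ)
    (hr : ∀ x, (x = 2 ∨ x = 3 ∨ 23 ≤ x) → σ'.reg x = σ.reg x) (ha : σ'.arr = σ.arr) :
    Swept φ r G D τ f l n σ' where
  env := h.env.congr (fun x hx => hr x (by omega)) (by rw [ha]) (by rw [ha])
  row := h.row.congr (hr _ (by decide)) (by rw [ha]) (by rw [ha])
  pos := h.pos.congr (hr _ (by decide)) (hr _ (by decide)) (hr _ (by decide))
  out := h.out.congr (hr _ (by decide)) (hr _ (by decide)) (by rw [ha])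

namespace Program

/-- Advance the position counters by one slot. -/
def advance : Program := add 23 23 44 ;; add 24 24 49 ;; add 25 25 50

theorem advance_run {n : ℕ} {σ : State} (h : Env φ r G D σ) (hA : At φ r G τ n σ) :
    At φ r G τ (n + 1) (advance.run σ) := by
  refine ⟨?_, ?_, ?_⟩
  · simp [advance, run, h.mesh, hA.slotX]; ring
  · simp [advance, run, h.mesh_two, hA.nearX]; ring
  · simp [advance, run, h.six, hA.baseY]; ring

/-- Treat one block of pass `q`; register `20` holds the number of blocks that remain. -/
def block (r q : ℕ) (body : ℕ → Program) : Program :=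
  (if q < 2 then sub 21 20 40 else sub 21 41 20) ;; add 22 20 20 ;; addN 22 41 (2 * (3 - q)) ;;
  all ((List.range (blockLen r)).map fun o => advance ;; body o) ;; sub 20 20 40

theorem block_within (r q : ℕ) {body : ℕ → Program} (h : ∀ o, (body o).Within 20 [4, 50]) :
    (block r q body).Within 26 [4, 50] := by
  refine ⟨by split_ifs <;> simp [Within], by simp [Within], addN_within (by decide) (by decide),
    all_within (by decide) ?_, by simp [Within]⟩
  intro p hp
  obtain ⟨o, -, rfl⟩ := List.mem_map.1 hp
  exact ⟨by simp [advance, Within], (h o).mono (by decide) (List.Subset.refl _)⟩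

/-- A block is unrolled, since its length depends only on `r`, while the blocks of a pass form a
genuine loop over the variables. -/
theorem block_spec {f : ℕ → List (ℕ × ℕ)} (hY : Ample φ r Y) (hb : TreatsSlots φ r G D Y τ f body)
    {q i : ℕ} (hq : q < 4) (hi : i < φ.numVars) {σ : State}
    (h : Swept φ r G D τ f l ((q * φ.numVars + i) * blockLen r) σ)
    (h20 : σ.reg 20 = φ.numVars - i) :
    Runs (block r q (body q)) σ (Y ^ 40) fun σ' =>
      Swept φ r G D τ f l ((q * φ.numVars + i + 1) * blockLen r) σ' ∧
        σ'.reg 20 = φ.numVars - (i + 1) := by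
  have hc := hY.const
  have hY2 : 2 ≤ Y := by omega
  refine Runs.step (by split_ifs <;> trivial) (by split_ifs <;> simp only [cost] <;> omega) ?_ hY2
    (b := 39) (by decide) (by decide)
  refine Runs.step trivial (show 1 ≤ Y by omega) ?_ hY2 (b := 38) (by decide) (by decide)
  refine Runs.step (addN_loopFree _ _ _) (by rw [addN_cost]; omega) ?_ hY2 (b := 37) (by decide)
    (by decide)
  have hrun : (if q < 2 then sub 21 20 40 else sub 21 41 20).run σ =
      σ.setReg 21 (blockVar φ.numVars q i) := by
    unfold blockVar
    split_ifs
    · simp only [run, h20, h.env.one]; congr 1; omega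
    · simp only [run, h20, h.env.vars]; congr 1; omega
  rw [hrun, addN_run _ (by decide) (by decide) (by decide)]
  generalize hs1 : State.setReg _ _ _ = s1
  have e21 : s1.reg 21 = blockVar φ.numVars q i := by simp [← hs1, run]
  -- The block part of the label is assembled as `2 * (N - i)` from the loop counter plus `2 * (3 -
  -- q) * N` by repeated addition.
  have e22 : s1.reg 22 = 2 * (4 * φ.numVars - (q * φ.numVars + i)) := by
    simp only [← hs1, run, State.setReg_reg, h20, h.env.vars]
    norm_num [h20, h.env.vars]
    have : q * φ.numVars + (3 - q) * φ.numVars = 3 * φ.numVars := by rw [← Nat.add_mul]; congr 1; omega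
    rw [mul_assoc]
    omega
  have e20 : s1.reg 20 = φ.numVars - i := by simp [← hs1, run, h20]
  have w1 : Swept φ r G D τ f l ((q * φ.numVars + i) * blockLen r) s1 := by
    refine h.congr (fun x hx => ?_) (by simp [← hs1, run])
    have a4 : x ≠ 4 := by omega
    have a21 : x ≠ 21 := by omega
    have a22 : x ≠ 22 := by omega
    simp [← hs1, run, a4, a21, a22]
  refine Runs.seq_pow hY2 (a := 30) (b := 1) (R := fun s' => Swept φ r G D τ f l
    ((q * φ.numVars + i) * blockLen r + blockLen r) s' ∧ s'.reg 20 = φ.numVars - i) ?_ ?_ (by decide)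
    (by decide)
  · refine (Runs.all_range_pow (Y := Y) (by omega) (a := 27) (e := 30) (by omega)
      (fun o s' => Swept φ r G D τ f l ((q * φ.numVars + i) * blockLen r + o) s' ∧
        s'.reg 20 = φ.numVars - i ∧ s'.reg 21 = blockVar φ.numVars q i ∧
        s'.reg 22 = 2 * (4 * φ.numVars - (q * φ.numVars + i))) ⟨w1, e20, e21, e22⟩ ?_ ?_
      (by decide)).mono le_rfl fun s' hs' => ⟨hs'.1, hs'.2.1⟩
    · rintro o s' ⟨g1, g2, g3, g4⟩
      refine ⟨g1.congr (fun x hx => ?_) rfl, by simp [g2], by simp [g3], by simp [g4]⟩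
      have a4 : x ≠ 4 := by omega
      simp [a4]
    · rintro o s' ho ⟨g1, g2, g3, g4⟩
      refine Runs.step (by simp [advance, LoopFree]) (by simp [advance, cost]; omega) ?_ hY2
        (b := 26) (by decide) (by decide)
      have t := advance_run g1.env g1.pos
      have hk : ∀ x, x ≠ 23 → x ≠ 24 → x ≠ 25 → (advance.run s').reg x = s'.reg x :=
        fun x _ _ _ => by simp [advance, run, *]
      have hm : (advance.run s').arr = s'.arr := rfl
      generalize advance.run s' = s2 at *
      have v2 : Env φ r G D s2 := g1.env.congr (fun x hx => hk x (by omega) (by omega) (by omega))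
        (by rw [hm]) (by rw [hm])
      have r2 : HasRow φ r τ s2 := g1.row.congr (hk _ (by decide) (by decide) (by decide))
        (by rw [hm]) (by rw [hm])
      have o2 := g1.out.congr (hk 2 (by decide) (by decide) (by decide))
        (hk 3 (by decide) (by decide) (by decide)) (by rw [hm])
      have w := hb.within q o
      refine (hb.spec q i o _ s2 hq hi ho v2 r2 t
        (by rw [hk _ (by decide) (by decide) (by decide), g3])
        (by rw [hk _ (by decide) (by decide) (by decide), g4]) o2).mono_pow (by omega) (by decide)
        fun s3 f3 e3 => ⟨⟨v2.frame f3 w (by decide) (by simp) (by simp),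
          r2.frame f3 w (by decide) (by simp) (by simp),
          t.congr (f3.reg _ (w.keepsReg (by decide))) (f3.reg _ (w.keepsReg (by decide)))
            (f3.reg _ (w.keepsReg (by decide))), ?_⟩, ?_, ?_, ?_⟩
      · convert e3 using 1
        rw [← add_assoc, List.range_succ, List.flatMap_append, List.append_assoc]
        simp [blockPos]
      · rw [f3.reg _ (w.keepsReg (by decide)), hk _ (by decide) (by decide) (by decide), g2]
      · rw [f3.reg _ (w.keepsReg (by decide)), hk _ (by decide) (by decide) (by decide), g3]
      · rw [f3.reg _ (w.keepsReg (by decide)), hk _ (by decide) (by decide) (by decide), g4]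
  · rintro s' ⟨g1, g2⟩ -
    refine Runs.loopFree_pow trivial (show 1 ≤ Y by omega) (by decide) ⟨?_, ?_⟩
    · rw [Nat.add_mul _ 1, one_mul]
      refine g1.congr (fun x hx => ?_) rfl
      have : x ≠ 20 := by omega
      simp [run, this]
    · simp [run, g2, g1.env.one]; omega

/-- Treat all slots of a track. -/
def sweep (r : ℕ) (body : ℕ → ℕ → Program) : Program :=
  all ((List.range 4).map fun q => add 20 41 43 ;; loop 20 (block r q (body q)))

theorem sweep_within (r : ℕ) {body : ℕ → ℕ → Program} (h : ∀ q o, (body q o).Within 20 [4, 50]) :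
    (sweep r body).Within 26 [4, 50] := by
  refine all_within (by decide) ?_
  intro p hp
  obtain ⟨q, -, rfl⟩ := List.mem_map.1 hp
  exact ⟨by simp [Within], block_within r q (h q)⟩

theorem sweep_spec {f : ℕ → List (ℕ × ℕ)} (hY : Ample φ r Y) (hb : TreatsSlots φ r G D Y τ f body)
    {σ : State} (h : Swept φ r G D τ f l 0 σ) :
    Runs (sweep r body) σ (Y ^ 50) (Swept φ r G D τ f l (4 * φ.numVars * blockLen r)) := by
  have hc := hY.const
  have hY2 : 2 ≤ Y := by omega
  refine Runs.all_range_pow (Y := Y) (by omega) (a := 45) (e := 50) (by omega)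
    (fun q s' => Swept φ r G D τ f l (q * φ.numVars * blockLen r) s') (by simpa using h) ?_ ?_
    (by decide)
  · intro o s' g1
    refine g1.congr (fun x hx => ?_) rfl
    have a4 : x ≠ 4 := by omega
    simp [a4]
  · intro q s' hq g
    refine Runs.step trivial (show 1 ≤ Y by omega) ?_ hY2 (b := 44) (by decide) (by decide)
    refine (Runs.loop_pow (Y := Y) (n := φ.numVars) (a := 40) (by omega) hY.vars
      (fun k s' => s'.reg 20 = k ∧ k ≤ φ.numVars ∧
        Swept φ r G D τ f l ((q * φ.numVars + (φ.numVars - k)) * blockLen r) s')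
      (fun k s' h => h.1) ?_ ?_ (by decide)).mono le_rfl fun s' hs' => ?_
    · refine ⟨by simp [run, g.env.vars, g.env.zero], le_rfl, ?_⟩
      rw [Nat.sub_self, add_zero]
      refine g.congr (fun x hx => ?_) rfl
      have a4 : x ≠ 20 := by omega
      simp [run, a4]
    · rintro k s' hk - ⟨g1, -, g2⟩
      refine (block_spec hY hb hq (show φ.numVars - (k + 1) < φ.numVars by omega) g2
        (by omega)).mono le_rfl ?_
      rintro s'' ⟨e1, e2⟩
      refine ⟨by omega, by omega, ?_⟩
      rw [show φ.numVars - k = φ.numVars - (k + 1) + 1 by omega, ← add_assoc]; exact e1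
    · have := hs'.2.2
      rw [Nat.sub_zero] at this
      rw [Nat.add_mul q 1, one_mul]; exact this

end Program

end Sweep

/-! ## The tables of one track -/

section Tables

variable {φ : CNF3} {r : ℕ} {G D Y τ : ℕ} {l : List (ℕ × ℕ)} {σ : State}

theorem rowSet_add (r ρ x : ℕ) : rowSet r ρ (r + x) = rowSet r ρ x := by
  simp [rowSet, Nat.add_mod_left]

theorem lanes_length_mono (S : ℕ → Bool) {m n : ℕ} (h : m ≤ n) :
    (lanes S m).length ≤ (lanes S n).length := by
  induction n, h using Nat.le_induction with
  | base => exact le_rfl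
  | succ n _ ih =>
    refine ih.trans ?_
    rw [lanes]; split_ifs
    · simp
    · exact le_rfl

namespace Program

/-- Write the set of variables of row `ρ` to array `2`. -/
def tabulateSet (r ρ : ℕ) : Program :=
  all ((List.range r).map fun k => const 27 k ;; const 28 (rowSet r ρ k).toNat ;; store 2 27 28) ;;
  add 20 41 43 ;; const 27 0 ;; const 28 r ;;
  loop 20 (load 29 2 27 ;; store 2 28 29 ;; add 27 27 40 ;; add 28 28 40 ;; sub 20 20 40)

theorem tabulateSet_within (r ρ : ℕ) : (tabulateSet r ρ).Within 30 [2, 3] := by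
  refine ⟨all_within (by decide) ?_, by simp [Within]⟩
  intro p hp
  obtain ⟨q, -, rfl⟩ := List.mem_map.1 hp
  simp [Within]

theorem tabulateSet_keeps (r ρ : ℕ) {x : ℕ} (hx : x < 4) : (tabulateSet r ρ).KeepsReg x := by
  refine ⟨all_keepsReg ?_ (by omega), by simp [KeepsReg]; omega⟩
  intro p hp
  obtain ⟨q, -, rfl⟩ := List.mem_map.1 hp
  simp [KeepsReg]; omega

/-- One period of the row set is hard-coded, and the loop extends it with period `r`, by
`rowSet_add`. No residue is ever computed. -/
theorem tabulateSet_spec {ρ : ℕ} (hY : Ample φ r Y) (hr : 0 < r) (h : Env φ r G D σ) :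
    Runs (tabulateSet r ρ) σ (Y ^ 10) (HasSet φ (rowSet r ρ)) := by
  have hc := hY.const
  have hrB : r ≤ blockLen r := by
    have := Nat.le_self_pow (show 3 ≠ 0 by decide) r
    unfold blockLen; omega
  have hY2 : 2 ≤ Y := by omega
  have hfirst : Runs (all ((List.range r).map fun k => const 27 k ;;
      const 28 (rowSet r ρ k).toNat ;; store 2 27 28)) σ (Y ^ 3)
      (fun s' => ∀ z < r, s'.arr 2 z = (rowSet r ρ z).toNat) := by
    refine Runs.all_range_pow (by omega) (a := 1) (by omega)
      (fun k s' => ∀ z < k, s'.arr 2 z = (rowSet r ρ z).toNat) (fun z hz => by omega)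
      (fun k s' h => h) (fun k s' hk g => ?_) (by decide)
    refine Runs.loopFree_pow (by simp [LoopFree]) (by simp [cost]; omega) (by decide) fun z hz => ?_
    simp only [run, State.setArr_arr, State.setReg_arr, State.setReg_reg]
    norm_num
    split_ifs with hzk
    · rw [hzk]
    · exact g z (by omega)
  refine Runs.seq_pow hY2 hfirst (b := 9) ?_ (by decide) (by decide)
  intro s1 g1 f1
  have w1 : (all ((List.range r).map fun k => const 27 k ;;
      const 28 (rowSet r ρ k).toNat ;; store 2 27 28)).Within 30 [2, 3] :=
    (tabulateSet_within r ρ).1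
  have h1 := h.frame f1 w1 (by decide) (by simp) (by simp)
  refine Runs.step trivial (show 1 ≤ Y by omega) ?_ hY2 (b := 8) (by decide) (by decide)
  refine Runs.step trivial (show 1 ≤ Y by omega) ?_ hY2 (b := 7) (by decide) (by decide)
  refine Runs.step trivial (show 1 ≤ Y by omega) ?_ hY2 (b := 6) (by decide) (by decide)
  refine (Runs.loop_pow (Y := Y) (n := φ.numVars) (a := 1) (by omega) hY.vars
    (fun k s' => s'.reg 20 = k ∧ s'.reg 27 = φ.numVars - k ∧ s'.reg 28 = r + (φ.numVars - k) ∧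
      ∀ z < r + (φ.numVars - k), s'.arr 2 z = (rowSet r ρ z).toNat)
    (fun k s' h => h.1) ?_ ?_ (by decide)).mono le_rfl fun s' hs' z hz => hs'.2.2.2 z (by omega)
  · refine ⟨by simp [run, h1.vars, h1.zero], by simp [run], by simp [run], ?_⟩
    rw [Nat.sub_self, add_zero]; exact g1
  · rintro k s' hk hf ⟨a1, a2, a3, a4⟩
    have one : s'.reg 40 = 1 := by
      rw [hf.reg 40 (by simp [KeepsReg])]; simp [run, h1.one]
    refine Runs.loopFree_pow (by simp [LoopFree]) (by simp [cost]; omega) (by decide)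
      ⟨by simp [run, a1, one], by simp [run, a2, one]; omega, by simp [run, a3, one]; omega, ?_⟩
    intro z hz
    simp only [run, State.setArr_arr, State.setReg_arr, State.setReg_reg, State.setArr_reg]
    norm_num [a2, a3]
    split_ifs with hzk
    · rw [a4 _ (by omega), show z = r + (φ.numVars - (k + 1)) by omega, rowSet_add]
    · exact a4 z (by omega)

/-- Write the (scaled) lanes of the set in array `2` to array `3`. -/
def tabulateLanes : Program :=
  const 27 0 ;; store 3 27 43 ;; const 26 1 ;; const 21 0 ;; add 20 41 43 ;;
  loop 20 (load 28 2 21 ;;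
    ite 28 (load 29 1 21 ;; add 22 26 43 ;; const 27 0 ;;
      loop 22 (load 5 3 27 ;; add 5 5 29 ;; store 3 26 5 ;; add 26 26 40 ;; add 27 27 40 ;;
        sub 22 22 40)) skip ;;
    add 21 21 40 ;; sub 20 20 40)

theorem tabulateLanes_within : tabulateLanes.Within 30 [2, 3] := by
  simp [tabulateLanes, Within, skip]

/-- The loop follows the recursion of `lanes`: for each variable of the set the list is doubled by
appending a copy increased by the scaled power of two. The order matters, as it fixes the order of
the output. -/
theorem tabulateLanes_spec {S : ℕ → Bool} (hY : Ample φ r Y) (h : Env φ r G D σ)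
    (hS : HasSet φ S σ) (hK : (lanes S φ.numVars).length ≤ Y) :
    Runs tabulateLanes σ (Y ^ 20) fun s' => s'.reg 26 = (lanes S φ.numVars).length ∧
      ∀ j < (lanes S φ.numVars).length,
        s'.arr 3 j = (8 * φ.numVars + 8) * (lanes S φ.numVars).getD j 0 := by
  have hc := hY.const
  have hY2 : 2 ≤ Y := by omega
  refine Runs.step trivial (show 1 ≤ Y by omega) ?_ hY2 (b := 19) (by decide) (by decide)
  refine Runs.step trivial (show 1 ≤ Y by omega) ?_ hY2 (b := 18) (by decide) (by decide)
  refine Runs.step trivial (show 1 ≤ Y by omega) ?_ hY2 (b := 17) (by decide) (by decide)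
  refine Runs.step trivial (show 1 ≤ Y by omega) ?_ hY2 (b := 16) (by decide) (by decide)
  refine Runs.step trivial (show 1 ≤ Y by omega) ?_ hY2 (b := 15) (by decide) (by decide)
  generalize hs1 : (add 20 41 43).run _ = s1
  have h1 : Env φ r G D s1 := by
    refine h.congr (fun x hx => ?_) (by rw [← hs1]; funext j; simp [run])
      (by rw [← hs1]; funext j; simp [run])
    rw [← hs1]; simp [run, show x ≠ 20 by omega, show x ≠ 21 by omega, show x ≠ 26 by omega,
      show x ≠ 27 by omega]
  have hS1 : HasSet φ S s1 := fun z hz => by rw [← hs1]; simpa [run] using hS z hz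
  refine (Runs.loop_pow (Y := Y) (n := φ.numVars) (a := 12) (by omega) hY.vars
    (fun k s' => s'.reg 20 = k ∧ k ≤ φ.numVars ∧ s'.reg 21 = φ.numVars - k ∧ HasSet φ S s' ∧
      s'.reg 26 = (lanes S (φ.numVars - k)).length ∧ ∀ j < (lanes S (φ.numVars - k)).length,
        s'.arr 3 j = (8 * φ.numVars + 8) * (lanes S (φ.numVars - k)).getD j 0)
    (fun k s' h => h.1) ?_ ?_ (by decide)).mono le_rfl fun s' hs' => ?_
  · refine ⟨?_, le_rfl, ?_, hS1, ?_, ?_⟩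
    · rw [← hs1]; simp [run, h.vars, h.zero]
    · rw [← hs1]; simp [run]
    · rw [← hs1]; simp [run, lanes]
    · rw [← hs1]; simp [run, lanes, h.zero]
  · rintro k s' hk hf ⟨a1, -, a2, aS, a3, a4⟩
    obtain ⟨y, hy⟩ : ∃ y, y = φ.numVars - (k + 1) := ⟨_, rfl⟩
    have hyN : y < φ.numVars := by omega
    rw [← hy] at a2 a3 a4
    rw [show φ.numVars - k = y + 1 by omega]
    have e1 : Env φ r G D s' := by
      refine h1.congr (fun x hx => hf.reg x ?_) (hf.arr _ ?_) (hf.arr _ ?_)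
      · refine Within.keepsReg (k := 30) (as := [2, 3]) ?_ (by omega); simp [Within, skip]
      · simp [KeepsArr, skip]
      · simp [KeepsArr, skip]
    have hlen := lanes_length_mono S hyN.le
    refine Runs.step trivial (show 1 ≤ Y by omega) ?_ hY2 (b := 11) (by decide) (by decide)
    generalize hs2 : (load 28 2 21).run s' = s2
    have e2 : Env φ r G D s2 := e1.congr (fun x hx => by
      rw [← hs2]; simp [run, show x ≠ 28 by omega]) (by rw [← hs2]; rfl) (by rw [← hs2]; rfl)
    have b28 : s2.reg 28 = (S y).toNat := by rw [← hs2]; simp [run, a2, aS y hyN]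
    have bk : ∀ x, x ≠ 28 → s2.reg x = s'.reg x := fun x hx => by rw [← hs2]; simp [run, hx]
    have bm : s2.arr = s'.arr := by rw [← hs2]; rfl
    refine Runs.seq_pow hY2 (a := 10) (b := 1) (R := fun s3 => s3.reg 20 = k + 1 ∧
      s3.reg 21 = y ∧ HasSet φ S s3 ∧ s3.reg 40 = 1 ∧ s3.reg 26 = (lanes S (y + 1)).length ∧
        ∀ j < (lanes S (y + 1)).length,
        s3.arr 3 j = (8 * φ.numVars + 8) * (lanes S (y + 1)).getD j 0) ?_ ?_ (by decide) (by decide)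
    · refine Runs.ite_pow hY2 (a := 9) (fun hx => ?_) (fun hx => ?_) (by decide)
      · have hSy : S y = true := by
          rw [b28] at hx; cases hc : S y <;> simp_all
        have hl : lanes S (y + 1) = lanes S y ++ (lanes S y).map (· + 2 ^ y) := by
          rw [lanes, if_pos hSy]
        rw [hl]
        refine Runs.step trivial (show 1 ≤ Y by omega) ?_ hY2 (b := 8) (by decide) (by decide)
        refine Runs.step trivial (show 1 ≤ Y by omega) ?_ hY2 (b := 7) (by decide) (by decide)
        refine Runs.step trivial (show 1 ≤ Y by omega) ?_ hY2 (b := 6) (by decide) (by decide)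
        generalize hs3 : (const 27 0).run _ = s3
        have c29 : s3.reg 29 = (8 * φ.numVars + 8) * 2 ^ y := by
          rw [← hs3]; simp [run, bk, a2, e2.pow y hyN]
        have ck : ∀ x, x ≠ 22 → x ≠ 27 → x ≠ 28 → x ≠ 29 → s3.reg x = s'.reg x :=
          fun x _ _ _ _ => by rw [← hs3]; simp [run, *]
        have cm : s3.arr = s'.arr := by rw [← hs3, ← bm]; rfl
        set n := (lanes S y).length with hn
        refine (Runs.loop_pow (Y := Y) (n := n) (a := 1) (by omega) (by omega)
          (fun k s' => s'.reg 22 = k ∧ s'.reg 27 = n - k ∧ s'.reg 26 = n + (n - k) ∧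
            ∀ j < n + (n - k), s'.arr 3 j = (8 * φ.numVars + 8) *
              (lanes S y ++ (lanes S y).map (· + 2 ^ y)).getD j 0)
          (fun k s' h => h.1) ?_ ?_ (by decide)).frame.mono le_rfl fun s4 hs4 => ?_
        · refine ⟨?_, ?_, ?_, fun j hj => ?_⟩
          · rw [← hs3]; simp [run, bk, a3, e1.zero]
          · rw [← hs3]; simp [run]
          · rw [ck _ (by decide) (by decide) (by decide) (by decide), a3]; simp
          · have hj' : j < n := by omega
            rw [cm, a4 j hj', List.getD_append _ _ _ _ hj']
        · rintro k s4 hk4 hf4 ⟨d1, d2, d3, d4⟩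
          have one : s4.reg 40 = 1 := by
            rw [hf4.reg 40 (by simp [KeepsReg]), ck _ (by decide) (by decide) (by decide)
              (by decide), e1.one]
          have r29 : s4.reg 29 = (8 * φ.numVars + 8) * 2 ^ y := by
            rw [hf4.reg 29 (by simp [KeepsReg]), c29]
          refine Runs.loopFree_pow (by simp [LoopFree]) (by simp [cost]; omega) (by decide)
            ⟨by simp [run, d1, one], by simp [run, d2, one]; omega,
              by simp [run, d3, one]; omega, fun j hj => ?_⟩
          have g1 : (n - (k + 1)) < (lanes S y).length := by omega
          have hval := d4 (n - (k + 1)) (by omega)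
          rw [List.getD_append _ _ _ _ g1] at hval
          simp only [run, State.setArr_arr, State.setReg_arr, State.setReg_reg, State.setArr_reg]
          simp [d2, d3, hval, r29, -List.getD_eq_getElem?_getD]
          split_ifs with hzk
          · rw [hzk, List.getD_append_right _ _ _ _ (by omega), ← hn, Nat.add_sub_cancel_left,
              List.getD_eq_getElem _ _ g1, List.getD_eq_getElem _ _ (by simpa using g1),
              List.getElem_map, Nat.mul_add]
          · exact d4 j (by omega)
        · obtain ⟨⟨d1, d2, d3, d4⟩, hf4⟩ := hs4
          have kk : ∀ x, x ≠ 5 → x ≠ 22 → x ≠ 26 → x ≠ 27 → x ≠ 28 → x ≠ 29 →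
              s4.reg x = s'.reg x := fun x _ _ _ _ _ _ => by
            rw [hf4.reg x (by simp [KeepsReg, *]), ck x (by assumption) (by assumption)
              (by assumption) (by assumption)]
          refine ⟨?_, ?_, fun z hz => ?_, ?_, ?_, ?_⟩
          · rw [kk _ (by decide) (by decide) (by decide) (by decide) (by decide) (by decide), a1]
          · rw [kk _ (by decide) (by decide) (by decide) (by decide) (by decide) (by decide), a2]
          · rw [hf4.arr 2 (by simp [KeepsArr]), cm, aS z hz]
          · rw [kk _ (by decide) (by decide) (by decide) (by decide) (by decide) (by decide),
              e1.one]
          · rw [d3]; simp [hn]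
          · intro j hj; exact d4 j (by simpa [hn] using hj)
      · have hSy : S y = false := by
          rw [b28] at hx; cases hc : S y <;> simp_all
        have hl : lanes S (y + 1) = lanes S y := by rw [lanes]; simp [hSy]
        rw [hl]
        refine Runs.loopFree_pow trivial (show 1 ≤ Y by omega) (by decide) ?_
        refine ⟨by simp [skip, run, bk, a1], by simp [skip, run, bk, a2], fun z hz => ?_,
          by simp [skip, run, e2.one], by simp [skip, run, bk, a3], fun j hj => ?_⟩
        · simp [skip, run, bm, aS z hz]
        · simp [skip, run, bm, a4 j hj]
    · rintro s3 ⟨d1, d2, dS, d0, d3, d4⟩ -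
      refine Runs.loopFree_pow (by simp [LoopFree]) (by simp [cost]; omega) (by decide)
        ⟨by simp [run, d1, d0], by omega, by simp [run, d2, d0], dS, by simp [run, d3], d4⟩
  · have := hs'.2.2.2.2
    rwa [Nat.sub_zero] at this

end Program

end Tables

/-! ## All tracks, and the trunk -/

section Phases

variable {φ : CNF3} {r : ℕ} {G D Y : ℕ} {l : List (ℕ × ℕ)} {σ : State}

theorem two_mul_cube_le_blockLen (r : ℕ) : 2 * r ^ 3 + 2 ≤ blockLen r := le_rfl

namespace Program

/-- Tabulate the data of track `τ` and treat all its slots. -/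
def track (r τ : ℕ) (body : ℕ → ℕ → Program) : Program :=
  tabulateSet r (τ / 2) ;; tabulateLanes ;; add 23 46 43 ;; const 24 0 ;; const 25 0 ;;
  addN 25 44 (5 * τ) ;; sweep r body

theorem track_within (r τ : ℕ) {body : ℕ → ℕ → Program}
    (h : ∀ q o, (body q o).Within 20 [4, 50]) : (track r τ body).Within 30 [2, 3, 4, 50] :=
  ⟨(tabulateSet_within _ _).mono (by decide) (by simp),
    tabulateLanes_within.mono (by decide) (by simp), by simp [Within], by simp [Within],
    by simp [Within], addN_within (by decide) (by decide),
    (sweep_within r h).mono (by decide) (by simp)⟩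

theorem track_spec {τ : ℕ} {f : ℕ → List (ℕ × ℕ)} {body : ℕ → ℕ → Program} (hr : 0 < r)
    (hτ : τ < 2 * r ^ 3) (hY : Ample φ r Y) (hb : TreatsSlots φ r G D Y τ f body)
    (h : Env φ r G D σ) (hE : Emitted D l σ) :
    Runs (track r τ body) σ (Y ^ 60) (Emitted D (l ++
      (List.range (4 * φ.numVars * blockLen r)).flatMap fun i => f (i + 1))) := by
  have hc := hY.const
  have hP := two_mul_cube_le_blockLen r
  have hY2 : 2 ≤ Y := by omega
  refine Runs.seq_pow hY2 (tabulateSet_spec hY hr h) (b := 59) ?_ (by decide) (by decide)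
  intro s1 g1 f1
  have w1 := tabulateSet_within r (τ / 2)
  have h1 := h.frame f1 w1 (by decide) (by simp) (by simp)
  have e1 := hE.frame f1 (tabulateSet_keeps _ _ (by decide)) (tabulateSet_keeps _ _ (by decide))
    (w1.keepsArr (by simp))
  refine Runs.seq_pow hY2 (tabulateLanes_spec hY h1 g1 (hY.lanes _)) (b := 58) ?_ (by decide)
    (by decide)
  rintro s2 ⟨g2, g3⟩ f2
  have w2 := tabulateLanes_within
  have h2 := h1.frame f2 w2 (by decide) (by simp) (by simp)
  have e2 := e1.frame f2 (by simp [tabulateLanes, KeepsReg, skip])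
    (by simp [tabulateLanes, KeepsReg, skip]) (w2.keepsArr (by simp))
  have r2 : HasRow φ r τ s2 := by
    refine ⟨fun z hz => ?_, g2, fun j hj => ?_⟩
    · rw [f2.arr 2 (by simp [tabulateLanes, KeepsArr, skip]), g1 z hz]
    · rw [g3 j hj, List.getD_eq_getElem _ _ hj]
  refine Runs.step trivial (show 1 ≤ Y by omega) ?_ hY2 (b := 57) (by decide) (by decide)
  refine Runs.step trivial (show 1 ≤ Y by omega) ?_ hY2 (b := 56) (by decide) (by decide)
  refine Runs.step trivial (show 1 ≤ Y by omega) ?_ hY2 (b := 55) (by decide) (by decide)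
  refine Runs.step (addN_loopFree _ _ _) (by rw [addN_cost]; omega) ?_ hY2 (b := 54) (by decide)
    (by decide)
  rw [addN_run _ (by decide) (by decide) (by decide)]
  generalize hs3 : State.setReg _ _ _ = s3
  have k3 : ∀ x, x ≠ 4 → x ≠ 23 → x ≠ 24 → x ≠ 25 → s3.reg x = s2.reg x := fun x _ _ _ _ => by
    rw [← hs3]; simp [run, *]
  have m3 : s3.arr = s2.arr := by rw [← hs3]; simp [run]
  have h3 : Env φ r G D s3 := h2.congr
    (fun x hx => k3 x (by omega) (by omega) (by omega) (by omega)) (by rw [m3]) (by rw [m3])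
  have key : Swept φ r G D τ f l 0 s3 := by
    refine ⟨h3, r2.congr (k3 _ (by decide) (by decide) (by decide) (by decide)) (by rw [m3])
      (by rw [m3]), ⟨?_, ?_, ?_⟩, ?_⟩
    · rw [← hs3]; simp [run, h2.base, h2.zero]
    · rw [← hs3]; simp [run]
    · rw [← hs3]; simp [run, h2.mesh]
    · simpa using e2.congr (k3 2 (by decide) (by decide) (by decide) (by decide))
        (k3 3 (by decide) (by decide) (by decide) (by decide)) (by rw [m3])
  exact (sweep_spec hY hb key).mono_pow (by omega) (by decide) fun s' _ h' => h'.out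

/-- Treat all slots of all tracks. -/
def phase (r : ℕ) (body : ℕ → ℕ → ℕ → Program) : Program :=
  all ((List.range (2 * r ^ 3)).map fun τ => track r τ (body τ))

theorem phase_within (r : ℕ) {body : ℕ → ℕ → ℕ → Program}
    (h : ∀ τ q o, (body τ q o).Within 20 [4, 50]) : (phase r body).Within 30 [2, 3, 4, 50] := by
  refine all_within (by decide) ?_
  intro p hp
  obtain ⟨τ, -, rfl⟩ := List.mem_map.1 hp
  exact track_within r τ (h τ)

theorem phase_spec {f : ℕ → ℕ → List (ℕ × ℕ)} {body : ℕ → ℕ → ℕ → Program} (hr : 0 < r)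
    (hY : Ample φ r Y) (hb : ∀ τ, TreatsSlots φ r G D Y τ (f τ) (body τ)) (h : Env φ r G D σ)
    (hE : Emitted D l σ) :
    Runs (phase r body) σ (Y ^ 65) (Emitted D (l ++ (List.range (2 * r ^ 3)).flatMap fun τ =>
      (List.range (4 * φ.numVars * blockLen r)).flatMap fun i => f τ (i + 1))) := by
  have hc := hY.const
  have hP := two_mul_cube_le_blockLen r
  refine (Runs.all_range_pow (Y := Y) (by omega) (a := 60) (e := 65) (by omega)
    (fun n s' => Env φ r G D s' ∧ Emitted D (l ++ (List.range n).flatMap fun τ =>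
      (List.range (4 * φ.numVars * blockLen r)).flatMap fun i => f τ (i + 1)) s')
    ⟨h, by simpa using hE⟩ ?_ ?_ (by decide)).mono le_rfl fun s' hs' => hs'.2
  · rintro n s' ⟨g1, g2⟩
    refine ⟨g1.congr (fun x hx => ?_) rfl rfl, g2.congr (by simp) (by simp) rfl⟩
    have : x ≠ 4 := by omega
    simp [this]
  · rintro τ s' hτ ⟨g1, g2⟩
    refine (track_spec hr hτ hY (hb τ) g1 g2).mono_pow (by omega) le_rfl fun s'' f' e => ⟨?_, ?_⟩
    · exact g1.frame f' (track_within r τ (hb τ).within) (by decide) (by simp) (by simp)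
    · rwa [List.range_succ, List.flatMap_append, ← List.append_assoc, List.flatMap_cons,
        List.flatMap_nil, List.append_nil]

/-- Emit the trunk. -/
def trunk (P : ℕ) : Program :=
  all ((List.range (5 * P)).map fun j =>
    (if (j + 5) % 5 = 0 then sub 24 47 40 ;; sub 24 24 40 else const 24 0) ;;
    const 25 0 ;; emitPoint false (j + 5) 2)

theorem trunk_within (P : ℕ) : (trunk P).Within 30 [50] := by
  refine all_within (by decide) ?_
  intro p hp
  obtain ⟨j, -, rfl⟩ := List.mem_map.1 hp
  exact ⟨by split_ifs <;> simp [Within], by simp [Within],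
    (emitPoint_within _ _ _).mono (by decide) (by simp)⟩

/-- Register 47 holds `2 * L + 2 + 2 * A`; subtracting 1 twice gives the trunk offset on the levels
of tracks. -/
theorem trunk_spec (hr : 0 < r) (hY : Ample φ r Y) (h : Env φ r G D σ) (hE : Emitted D l σ) :
    Runs (trunk (2 * r ^ 3)) σ (Y ^ 10) (Emitted D (l ++ (List.range (5 * (2 * r ^ 3))).map fun j =>
      (Ob.trunk (j + 5)).pos (formulaTracks φ r hr) G)) := by
  have hc := hY.const
  have hP := two_mul_cube_le_blockLen r
  have hY2 : 2 ≤ Y := by omega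
  refine (Runs.all_range_pow (Y := Y) (by omega) (a := 8) (e := 10) (by omega)
    (fun n s' => Env φ r G D s' ∧ Emitted D (l ++ (List.range n).map fun j =>
      (Ob.trunk (j + 5)).pos (formulaTracks φ r hr) G) s')
    ⟨h, by simpa using hE⟩ ?_ ?_ (by decide)).mono le_rfl fun s' hs' => hs'.2
  · rintro n s' ⟨g1, g2⟩
    refine ⟨g1.congr (fun x hx => ?_) rfl rfl, g2.congr (by simp) (by simp) rfl⟩
    have : x ≠ 4 := by omega
    simp [this]
  · rintro j s' hj ⟨g1, g2⟩
    refine Runs.step (by split_ifs <;> simp [LoopFree]) (by split_ifs <;> simp only [cost] <;> omega)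
      ?_ hY2 (b := 7) (by decide) (by decide)
    refine Runs.step trivial (show 1 ≤ Y by omega) ?_ hY2 (b := 6) (by decide) (by decide)
    generalize hs1 : (const 25 0).run _ = s1
    have k1 : ∀ x, x ≠ 24 → x ≠ 25 → s1.reg x = s'.reg x := fun x _ _ => by
      rw [← hs1]; split_ifs <;> simp [run, *]
    have m1 : s1.arr = s'.arr := by rw [← hs1]; split_ifs <;> simp [run]
    have h1 : Env φ r G D s1 := g1.congr (fun x hx => k1 x (by omega) (by omega)) (by rw [m1])
      (by rw [m1])
    have e1 := g2.congr (k1 2 (by decide) (by decide)) (k1 3 (by decide) (by decide)) (by rw [m1])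
    refine (emitPoint_spec (Y := Y) (h := false) (g := j + 5) (c := 2) e1 h1.one h1.zero h1.den
      (by omega)).mono_pow (by omega) (by decide) fun s2 f2 e2 => ⟨?_, ?_⟩
    · exact h1.frame f2 (emitPoint_within _ _ _) (by decide) (by simp) (by simp)
    · convert e2 using 1
      rw [List.range_succ, List.map_append, List.append_assoc]
      congr 2
      simp only [List.map_cons, List.map_nil]
      congr 1
      simp only [Ob.pos, Ob.col, Ob.offX, Ob.lev, Ob.offY, h1.mesh]
      rw [← hs1]
      by_cases c : j % 5 = 0
      · simp [run, c, g1.far, g1.one, formulaTracks]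
      · simp [run, c]

end Program

end Phases

/-! ## The reduction -/

/-- The side of the mesh, plus one. -/
def meshSize (r N : ℕ) : ℕ := 2 ^ (2 * blockLen r + 14) * 16 ^ N

/-- The denominator of the coordinates, for squares or for disks. -/
def denominator (sq : Bool) (r N : ℕ) : ℕ := if sq then 2 * meshSize r N else meshSize r N

theorem meshSize_pos (r N : ℕ) : 0 < meshSize r N := by unfold meshSize; positivity

theorem denominator_pos (sq : Bool) (r N : ℕ) : 0 < denominator sq r N := by
  have := meshSize_pos r N
  unfold denominator; split_ifs <;> omega

theorem meshSize_eq (r N : ℕ) : meshSize r N = (2 ^ (blockLen r + 7) * 4 ^ N) ^ 2 := by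
  unfold meshSize
  rw [mul_pow, ← pow_mul, ← pow_mul, mul_comm N 2, pow_mul 4 2 N]
  congr 2; ring

/-- The mesh size is the square of `2 ^ (B + 7) * 4 ^ N`, with `B` the block length. This root
strictly exceeds all offsets, because labels stay below `(8 * N + 8) * 2 ^ N`; strictness pays for
the mesh being one less than the square. -/
theorem largeMesh (φ : CNF3) (r : ℕ) (hr : 0 < r) :
    LargeMesh (formulaTracks φ r hr) (meshSize r φ.numVars - 1) := by
  unfold LargeMesh
  rw [meshSize_eq]
  generalize hN : φ.numVars = N
  have h1 : 2 * (4 * N * blockLen r) + 2 + 2 * ((8 * N + 8) * 2 ^ N) + 100 <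
      2 ^ (blockLen r + 7) * 4 ^ N := by
    have e1 : N + 1 ≤ 2 ^ N := Nat.lt_two_pow_self
    have e2 : blockLen r + 1 ≤ 2 ^ blockLen r := Nat.lt_two_pow_self
    have e3 : (4 : ℕ) ^ N = 2 ^ N * 2 ^ N := by rw [← mul_pow]; norm_num
    have e4 : N + 1 ≤ 4 ^ N := by rw [e3]; nlinarith
    have e5 : (N + 1) * 2 ^ N ≤ 4 ^ N := by rw [e3]; gcongr
    have e6 : N * blockLen r ≤ 4 ^ N * blockLen r := by gcongr; omega
    have e7 : (128 * (blockLen r + 1)) * 4 ^ N ≤ 2 ^ (blockLen r + 7) * 4 ^ N := by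
      gcongr; rw [pow_add]; omega
    have e8 : 1 ≤ 4 ^ N := by omega
    have e9 : blockLen r * 1 ≤ blockLen r * 4 ^ N := by gcongr
    have e10 : 2 ≤ blockLen r := by unfold blockLen; omega
    nlinarith
  have h2 := Nat.pow_lt_pow_left h1 (show 2 ≠ 0 by decide)
  have h3 : (formulaTracks φ r hr).L = 4 * N * blockLen r := by rw [← hN]; rfl
  have h4 : (formulaTracks φ r hr).A = (8 * N + 8) * 2 ^ N := by rw [← hN]; rfl
  rw [h3, h4]
  omega

/-- The Steiner Tree instance of a formula. -/
def instanceOf (sq : Bool) (φ : CNF3) (r : ℕ) (hr : 0 < r) : SteinerInstance :=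
  (formulaTracks φ r hr).toSteiner (meshSize r φ.numVars - 1) (denominator sq r φ.numVars)
    (largeMesh φ r hr) (denominator_pos sq r φ.numVars)

/-- Odd numerators over powers of two are already in lowest terms, so the reduction can write
coordinates without computing a gcd. -/
theorem encodeRat_odd_div (X e : ℕ) :
    encodeRat (((2 * X + 1 : ℕ) : ℚ) / ((2 ^ e : ℕ) : ℚ)) = [0, 2 * X + 1, 2 ^ e] := by
  have hc : Nat.Coprime (2 * X + 1) (2 ^ e) := by
    refine Nat.Coprime.pow_right _ ?_
    rw [Nat.coprime_comm, Nat.coprime_two_left]; exact ⟨X, rfl⟩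
  have hn := Rat.num_div_eq_of_coprime (a := (2 * X + 1 : ℕ)) (b := (2 ^ e : ℕ))
    (by positivity) hc
  have hd := Rat.den_div_eq_of_coprime (a := (2 * X + 1 : ℕ)) (b := (2 ^ e : ℕ))
    (by positivity) hc
  have hq : ¬ (((2 * X + 1 : ℕ) : ℚ) / ((2 ^ e : ℕ) : ℚ) < 0) := not_lt.2 (by positivity)
  rw [Int.cast_natCast, Int.cast_natCast] at hn hd
  rw [encodeRat, if_neg hq, hn]
  congr 3
  exact_mod_cast hd

theorem denominator_eq (sq : Bool) (r N : ℕ) : ∃ e, denominator sq r N = 2 ^ e := by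
  have h : meshSize r N = 2 ^ (2 * blockLen r + 14 + 4 * N) := by
    rw [meshSize, pow_add _ (2 * blockLen r + 14), pow_mul 2 4 N]; norm_num
  unfold denominator
  split_ifs
  · exact ⟨2 * blockLen r + 14 + 4 * N + 1, by rw [h, pow_succ]; ring⟩
  · exact ⟨_, h⟩

theorem encode_instanceOf (sq : Bool) (φ : CNF3) (r : ℕ) (hr : 0 < r) :
    (instanceOf sq φ r hr).encode =
      (formulaTracks φ r hr).budget :: (formulaTracks φ r hr).objV.length ::
      (formulaTracks φ r hr).objT.length ::
      (((formulaTracks φ r hr).objV ++ (formulaTracks φ r hr).objT).map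
        (Ob.pos (formulaTracks φ r hr) (meshSize r φ.numVars - 1))).flatMap
          (record (denominator sq r φ.numVars)) := by
  simp only [SteinerInstance.encode, instanceOf, TrackSystem.toSteiner, List.length_map,
    ← List.map_append, List.flatMap_map]
  congr 4
  funext o
  obtain ⟨e, he⟩ := denominator_eq sq r φ.numVars
  rw [he]
  simp only [ratPoint, encodeRat_odd_div, record]
  rfl

/-! ### The budget -/

theorem countP_parity (τ h : ℕ) :
    ((List.range (2 * h)).filter fun i => decide ((τ + (i + 1)) % 2 = 0)).length = h := by
  induction h with
  | zero => rfl
  | succ h ih =>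
    rw [show 2 * (h + 1) = 2 * h + 1 + 1 by ring, List.range_succ, List.range_succ,
      List.filter_append, List.filter_append, List.length_append, List.length_append, ih]
    rcases Nat.mod_two_eq_zero_or_one τ with ht | ht
    · have h1 : (τ + (2 * h + 1)) % 2 ≠ 0 := by omega
      have h2 : (τ + (2 * h + 1 + 1)) % 2 = 0 := by omega
      simp [h1, h2]
    · have h1 : (τ + (2 * h + 1)) % 2 = 0 := by omega
      have h2 : (τ + (2 * h + 1 + 1)) % 2 ≠ 0 := by omega
      simp [h1, h2]

theorem length_pairs (Θ : TrackSystem) : Θ.pairs.length = Θ.P * Θ.L := by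
  simp [TrackSystem.pairs, List.length_flatMap]

theorem length_filter_check (Θ : TrackSystem) (h : ℕ) (hL : Θ.L = 2 * h) :
    (Θ.pairs.filter fun p => Θ.Check p.1 p.2).length = (Θ.P - 1) * h := by
  have key : ∀ n ≤ Θ.P, (((List.range n).flatMap fun τ => (List.range Θ.L).map fun i =>
      (τ, i + 1)).filter fun p => decide (Θ.Check p.1 p.2)).length = min n (Θ.P - 1) * h := by
    intro n
    induction n with
    | zero => simp
    | succ n ih =>
      intro hn
      rw [List.range_succ, List.flatMap_append, List.filter_append, List.length_append,
        ih (by omega), List.flatMap_cons, List.flatMap_nil, List.append_nil, List.filter_map,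
        List.length_map]
      by_cases hn' : n + 1 < Θ.P
      · have : ((fun p : ℕ × ℕ => decide (Θ.Check p.1 p.2)) ∘ fun i => (n, i + 1)) =
            fun i => decide ((n + (i + 1)) % 2 = 0) := by
          funext i; simp [TrackSystem.Check, hn']
        rw [this, hL, countP_parity, min_eq_left (by omega), min_eq_left (by omega), Nat.add_mul,
          one_mul]
      · have : ((fun p : ℕ × ℕ => decide (Θ.Check p.1 p.2)) ∘ fun i => (n, i + 1)) =
            fun i => false := by
          funext i; simp [TrackSystem.Check, hn']
        rw [this, min_eq_right (by omega), min_eq_right (by omega)]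
        simp
  have := key Θ.P le_rfl
  rw [min_eq_right (by omega)] at this
  exact this

/-- The budget per variable. -/
def unitBudget (r : ℕ) : ℕ := 2 * r ^ 3 * (4 * blockLen r) + (2 * r ^ 3 - 1) * (4 * (r ^ 3 + 1))

/-- Each track has an even number of positions, half of which carry checkpoints. The budget is thus
`N` times a constant of `r`, which a machine without multiplication computes by repeated addition.
-/
theorem budget_eq (φ : CNF3) (r : ℕ) (hr : 0 < r) :
    (formulaTracks φ r hr).budget = φ.numVars * unitBudget r := by
  have hL : (formulaTracks φ r hr).L = 2 * (φ.numVars * (4 * (r ^ 3 + 1))) := by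
    simp only [formulaTracks, blockLen]; ring
  rw [TrackSystem.budget, length_pairs, length_filter_check _ _ hL]
  simp only [formulaTracks, unitBudget]
  ring

theorem unitBudget_le (r : ℕ) : unitBudget r ≤ 8 * blockLen r ^ 2 := by
  have h1 : 2 * r ^ 3 ≤ blockLen r := by unfold blockLen; omega
  have h2 : 2 * (r ^ 3 + 1) = blockLen r := by unfold blockLen; ring
  unfold unitBudget
  calc 2 * r ^ 3 * (4 * blockLen r) + (2 * r ^ 3 - 1) * (4 * (r ^ 3 + 1))
      ≤ blockLen r * (4 * blockLen r) + blockLen r * (4 * blockLen r) := by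
        gcongr <;> omega
    _ = _ := by ring

/-! ### The complete reduction as a program -/

section Setup

variable {φ : CNF3} {r Y : ℕ} {σ : State}

/-- The input has been inspected, and nothing has been emitted yet. -/
structure Started (φ : CNF3) (σ : State) : Prop where
  one : σ.reg 40 = 1
  vars : σ.reg 41 = φ.numVars
  clauses : σ.reg 42 = φ.clauses.length
  zero : σ.reg 43 = 0
  cnt : σ.reg 3 = 0
  input : ∀ j, σ.arr 0 j = φ.encode.getD j 0
  out : ∀ j, σ.arr 50 j = 0

theorem Started.congr {σ' : State} (h : Started φ σ)
    (hr : ∀ x, x = 3 ∨ x = 40 ∨ x = 41 ∨ x = 42 ∨ x = 43 → σ'.reg x = σ.reg x)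
    (h0 : σ'.arr 0 = σ.arr 0) (h50 : σ'.arr 50 = σ.arr 50) : Started φ σ' where
  one := (hr _ (by decide)).trans h.one
  vars := (hr _ (by decide)).trans h.vars
  clauses := (hr _ (by decide)).trans h.clauses
  zero := (hr _ (by decide)).trans h.zero
  cnt := (hr _ (by decide)).trans h.cnt
  input j := by rw [h0, h.input]
  out j := by rw [h50, h.out]

namespace Program

/-- Compute the mesh size in register `44`. -/
def computeMesh (r : ℕ) : Program :=
  const 44 (2 ^ (2 * blockLen r + 14)) ;; add 20 41 43 ;;
  loop 20 (add 44 44 44 ;; add 44 44 44 ;; add 44 44 44 ;; add 44 44 44 ;; sub 20 20 40)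

theorem computeMesh_spec (hY : Ample φ r Y) (h : Started φ σ) :
    Runs (computeMesh r) σ (Y ^ 5) fun σ' => σ'.reg 44 = meshSize r φ.numVars := by
  have hc := hY.const
  have hY2 : 2 ≤ Y := by omega
  refine Runs.step trivial (show 1 ≤ Y by omega) ?_ hY2 (b := 4) (by decide) (by decide)
  refine Runs.step trivial (show 1 ≤ Y by omega) ?_ hY2 (b := 3) (by decide) (by decide)
  refine (Runs.loop_pow (Y := Y) (n := φ.numVars) (a := 1) (by omega) hY.vars
    (fun k s' => s'.reg 20 = k ∧ s'.reg 40 = 1 ∧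
      s'.reg 44 = 2 ^ (2 * blockLen r + 14) * 16 ^ (φ.numVars - k))
    (fun k s' h => h.1) ?_ ?_ (by decide)).mono le_rfl fun s' hs' => hs'.2.2
  · simp [run, h.vars, h.zero, h.one]
  · rintro k s' hk - ⟨a1, a2, a3⟩
    refine Runs.loopFree_pow (by simp [LoopFree]) (by simp [cost]; omega) (by decide)
      ⟨by simp [run, a1, a2], by simp [run, a2], ?_⟩
    rw [show φ.numVars - k = φ.numVars - (k + 1) + 1 by omega, pow_succ]
    simp [run, a3]; ring

/-- Compute the table of the (scaled) powers of two in array `1`, the next one in register `27`, and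
the scale in register `29`. -/
def computePowers : Program :=
  const 27 8 ;; addN 27 41 8 ;; add 29 27 43 ;; const 28 0 ;; add 20 41 43 ;;
  loop 20 (store 1 28 27 ;; add 27 27 27 ;; add 28 28 40 ;; sub 20 20 40)

theorem computePowers_within : computePowers.Within 30 [1] :=
  ⟨by simp [Within], addN_within (by decide) (by decide), by simp [Within]⟩

theorem computePowers_spec (hY : Ample φ r Y) (h : Started φ σ) :
    Runs computePowers σ (Y ^ 10) fun σ' => σ'.reg 29 = 8 * φ.numVars + 8 ∧
      σ'.reg 27 = (8 * φ.numVars + 8) * 2 ^ φ.numVars ∧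
      ∀ y < φ.numVars, σ'.arr 1 y = (8 * φ.numVars + 8) * 2 ^ y := by
  have hc := hY.const
  have hY2 : 2 ≤ Y := by omega
  refine Runs.step trivial (show 1 ≤ Y by omega) ?_ hY2 (b := 9) (by decide) (by decide)
  refine Runs.step (addN_loopFree _ _ _) (by rw [addN_cost]; omega) ?_ hY2 (b := 8) (by decide)
    (by decide)
  rw [addN_run _ (by decide) (by decide) (by decide)]
  refine Runs.step trivial (show 1 ≤ Y by omega) ?_ hY2 (b := 7) (by decide) (by decide)
  refine Runs.step trivial (show 1 ≤ Y by omega) ?_ hY2 (b := 6) (by decide) (by decide)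
  refine Runs.step trivial (show 1 ≤ Y by omega) ?_ hY2 (b := 5) (by decide) (by decide)
  refine (Runs.loop_pow (Y := Y) (n := φ.numVars) (a := 1) (by omega) hY.vars
    (fun k s' => s'.reg 20 = k ∧ s'.reg 40 = 1 ∧ s'.reg 29 = 8 * φ.numVars + 8 ∧
      s'.reg 28 = φ.numVars - k ∧ s'.reg 27 = (8 * φ.numVars + 8) * 2 ^ (φ.numVars - k) ∧
      ∀ y < φ.numVars - k, s'.arr 1 y = (8 * φ.numVars + 8) * 2 ^ y)
    (fun k s' h => h.1) ?_ ?_ (by decide)).mono le_rfl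
      fun s' hs' => ⟨hs'.2.2.1, hs'.2.2.2.2.1, hs'.2.2.2.2.2⟩
  · simp [run, h.vars, h.zero, h.one, add_comm]
  · rintro k s' hk - ⟨a1, a2, a3, a4, a5, a6⟩
    refine Runs.loopFree_pow (by simp [LoopFree]) (by simp [cost]; omega) (by decide)
      ⟨by simp [run, a1, a2], by simp [run, a2], by simp [run, a3], by simp [run, a4, a2]; omega,
        ?_, fun y hy => ?_⟩
    · rw [show φ.numVars - k = φ.numVars - (k + 1) + 1 by omega, pow_succ]
      simp [run, a5]; ring
    · simp only [run, State.setArr_arr, State.setReg_arr]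
      simp [a4, a5]
      split_ifs with hy'
      · rw [hy']
      · exact a6 y (by omega)

/-- Prepare the constants of the reduction. -/
def setup (sq : Bool) (r : ℕ) : Program :=
  const 40 1 ;; load 41 0 43 ;; load 42 0 40 ;; computeMesh r ;;
  add 45 44 (if sq then 44 else 43) ;; sub 44 44 40 ;; add 49 44 40 ;; add 49 49 40 ;; const 50 6 ;;
  const 46 2 ;; addN 46 41 (8 * blockLen r) ;; computePowers ;; sub 48 27 29 ;; add 47 46 27 ;;
  add 47 47 27 ;; const 2 2

theorem setup_within (sq : Bool) (r : ℕ) : (setup sq r).Within 51 [1] := by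
  refine ⟨by simp [Within], by simp [Within], by simp [Within], by simp [computeMesh, Within],
    by simp [Within], by simp [Within], by simp [Within], by simp [Within], by simp [Within],
    by simp [Within], addN_within (by decide) (by decide),
    computePowers_within.mono (by decide) (List.Subset.refl _), by simp [Within]⟩

/-- Register 43 is never written and serves as the constant 0. Multiplication by 16 in the mesh is
four doublings per variable. -/
theorem setup_spec (sq : Bool) (hY : Ample φ r Y) :
    Runs (setup sq r) (initState φ.encode) (Y ^ 40) fun σ =>
      Env φ r (meshSize r φ.numVars - 1) (denominator sq r φ.numVars) σ ∧
        Emitted (denominator sq r φ.numVars) [] σ := by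
  have hc := hY.const
  have hY2 : 2 ≤ Y := by omega
  refine Runs.step trivial (show 1 ≤ Y by omega) ?_ hY2 (b := 39) (by decide) (by decide)
  refine Runs.step trivial (show 1 ≤ Y by omega) ?_ hY2 (b := 38) (by decide) (by decide)
  refine Runs.step trivial (show 1 ≤ Y by omega) ?_ hY2 (b := 37) (by decide) (by decide)
  generalize hs1 : (load 42 0 40).run _ = s1
  have b1 : Started φ s1 := by
    rw [← hs1]
    refine ⟨?_, ?_, ?_, ?_, ?_, ?_, ?_⟩ <;> simp [run, initState, CNF3.encode]
  refine Runs.seq_pow hY2 (computeMesh_spec hY b1) (b := 36) ?_ (by decide) (by decide)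
  intro s2 g2 f2
  have b2 : Started φ s2 := b1.congr (fun x hx => f2.reg x (by
    rcases hx with rfl | rfl | rfl | rfl | rfl <;> simp [computeMesh, KeepsReg]))
    (f2.arr _ (by simp [computeMesh, KeepsArr])) (f2.arr _ (by simp [computeMesh, KeepsArr]))
  refine Runs.step trivial (show 1 ≤ Y by omega) ?_ hY2 (b := 35) (by decide) (by decide)
  refine Runs.step trivial (show 1 ≤ Y by omega) ?_ hY2 (b := 34) (by decide) (by decide)
  refine Runs.step trivial (show 1 ≤ Y by omega) ?_ hY2 (b := 33) (by decide) (by decide)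
  refine Runs.step trivial (show 1 ≤ Y by omega) ?_ hY2 (b := 32) (by decide) (by decide)
  refine Runs.step trivial (show 1 ≤ Y by omega) ?_ hY2 (b := 31) (by decide) (by decide)
  refine Runs.step trivial (show 1 ≤ Y by omega) ?_ hY2 (b := 30) (by decide) (by decide)
  refine Runs.step (addN_loopFree _ _ _) (by rw [addN_cost]; omega) ?_ hY2 (b := 29) (by decide)
    (by decide)
  rw [addN_run _ (by decide) (by decide) (by decide)]
  generalize hs3 : State.setReg _ _ _ = s3
  have hW := meshSize_pos r φ.numVars
  have b3 : Started φ s3 := b2.congr (fun x hx => by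
    rw [← hs3]; rcases hx with rfl | rfl | rfl | rfl | rfl <;> simp [run])
    (by rw [← hs3]; simp [run]) (by rw [← hs3]; simp [run])
  have c44 : s3.reg 44 = meshSize r φ.numVars - 1 := by rw [← hs3]; simp [run, g2, b2.one]
  have c45 : s3.reg 45 = denominator sq r φ.numVars := by
    rw [← hs3, denominator]; cases sq <;> simp [run, g2, b2.zero]; omega
  have c49 : s3.reg 49 = meshSize r φ.numVars - 1 + 2 := by rw [← hs3]; simp [run, g2, b2.one]
  have c50 : s3.reg 50 = 6 := by rw [← hs3]; simp [run]
  have c46 : s3.reg 46 = 2 * (4 * φ.numVars * blockLen r) + 2 := by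
    rw [← hs3]; simp [run, b2.vars]; ring
  refine Runs.seq_pow hY2 (computePowers_spec hY b3) (b := 28) ?_ (by decide) (by decide)
  rintro s4 ⟨g1, g2, g3⟩ f4
  have w4 := computePowers_within
  have k4 : ∀ x, 30 ≤ x → s4.reg x = s3.reg x := fun x hx => f4.reg x (w4.keepsReg hx)
  have z4 : s4.reg 3 = 0 := by
    rw [f4.reg 3 ⟨by simp [KeepsReg], addN_keepsReg (by decide) (by decide), by simp [KeepsReg]⟩,
      b3.cnt]
  refine Runs.loopFree_pow (by simp [LoopFree]) (by simp [cost]; omega) (by decide)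
    ⟨⟨?_, ?_, ?_, ?_, ?_, ?_, ?_, ?_, ?_, ?_, ?_, ?_, ?_⟩, ⟨?_, ?_, ?_⟩⟩
  · simp [run, k4, b3.one]
  · simp [run, k4, b3.vars]
  · simp [run, k4, b3.clauses]
  · simp [run, k4, b3.zero]
  · simp [run, k4, c44]
  · simp [run, k4, c45]
  · simp [run, k4, c46]
  · simp [run, k4, c46, g2]; ring
  · simp [run, g1, g2, Nat.mul_sub]
  · simp [run, k4, c49]
  · simp [run, k4, c50]
  · intro j
    rw [← b3.input j, ← f4.arr 0 (w4.keepsArr (by simp))]; rfl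
  · intro y hy; rw [← g3 y hy]; rfl
  · simp [run]
  · simp [run, z4]
  · intro j
    have e := b3.out j
    rw [← f4.arr 50 (w4.keepsArr (by simp))] at e
    refine e.trans ?_
    rcases j with _ | _ | _ | j <;> simp

/-- The reduction from 3-SAT to Steiner Tree. The output is in array `50`, its length in register
`100`. -/
def reduction (sq : Bool) (r : ℕ) : Program :=
  setup sq r ;; phase r (fun τ q o => slotV (2 * r ^ 3) τ q (o + 1)) ;; add 53 3 43 ;;
  phase r (fun τ _ o => slotT (2 * r ^ 3) τ (o + 1)) ;; trunk (2 * r ^ 3) ;; sub 54 3 53 ;;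
  const 52 0 ;; addN 52 41 (unitBudget r) ;; store 50 43 52 ;; store 50 40 53 ;; add 55 40 40 ;;
  store 50 55 54 ;; add 100 2 40

theorem reduction_within (sq : Bool) (r : ℕ) : (reduction sq r).Within 101 [1, 2, 3, 4, 50] :=
  ⟨(setup_within sq r).mono (by decide) (by simp),
    (phase_within r fun _ _ _ => slotV_within _ _ _ _).mono (by decide) (by simp), by simp [Within],
    (phase_within r fun _ _ _ => slotT_within _ _ _).mono (by decide) (by simp),
    (trunk_within _).mono (by decide) (by simp), by simp [Within], by simp [Within],
    addN_within (by decide) (by decide), by simp [Within]⟩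

/-- The three header cells are filled in last, when the numbers of emitted points are known.
Non-terminals are emitted before terminals, so the count in between separates the two. -/
theorem reduction_spec (sq : Bool) (hr : 0 < r) (hY : Ample φ r Y) :
    Runs (reduction sq r) (initState φ.encode) (Y ^ 100) fun σ =>
      σ.reg 100 = (instanceOf sq φ r hr).encode.length ∧
      ∀ j, σ.arr 50 j = (instanceOf sq φ r hr).encode.getD j 0 := by
  have hc := hY.const
  have hY2 : 2 ≤ Y := by omega
  set G := meshSize r φ.numVars - 1 with hG
  set D := denominator sq r φ.numVars with hD
  set Θ := formulaTracks φ r hr with hΘ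
  refine Runs.seq_pow hY2 (setup_spec sq hY) (b := 99) ?_ (by decide) (by decide)
  rintro s1 ⟨h1, e1⟩ -
  have hbV : ∀ τ, TreatsSlots φ r G D Y τ (pointsV φ r hr G τ)
      (fun q o => slotV (2 * r ^ 3) τ q (o + 1)) := fun τ =>
    ⟨fun q o => slotV_within _ _ _ _, fun q i o l σ hq hi ho h hR hA hx hoff hE =>
      slotV_spec hY h hR hA blockPos_mod_two.symm hi ho hx hoff hE⟩
  have hbT : ∀ τ, TreatsSlots φ r G D Y τ (pointsT φ r hr G τ)
      (fun _ o => slotT (2 * r ^ 3) τ (o + 1)) := fun τ =>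
    ⟨fun q o => slotT_within _ _ _, fun q i o l σ hq hi ho h hR hA hx hoff hE =>
      slotT_spec hY h hA blockPos_mod_two.symm hE⟩
  have hpairs : ∀ f : ℕ → ℕ → List Ob, ((Θ.pairs.flatMap fun p => f p.1 p.2).map (Ob.pos Θ G)) =
      (List.range (2 * r ^ 3)).flatMap fun τ => (List.range (4 * φ.numVars * blockLen r)).flatMap
        fun i => (f τ (i + 1)).map (Ob.pos Θ G) := by
    intro f
    simp only [TrackSystem.pairs, List.flatMap_assoc, List.map_flatMap, List.flatMap_map]
    rfl
  refine Runs.seq_pow hY2 (phase_spec hr hY hbV h1 e1) (b := 98) ?_ (by decide) (by decide)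
  intro s2 e2 f2
  have w2 := phase_within r (body := fun τ q o => slotV (2 * r ^ 3) τ q (o + 1))
    fun _ _ _ => slotV_within _ _ _ _
  have h2 := h1.frame f2 w2 (by decide) (by simp) (by simp)
  have eV : (List.range (2 * r ^ 3)).flatMap (fun τ =>
      (List.range (4 * φ.numVars * blockLen r)).flatMap fun i => pointsV φ r hr G τ (i + 1)) =
        Θ.objV.map (Ob.pos Θ G) := (hpairs fun τ s => (Θ.cand τ s).map (Ob.slot τ s) ++
          if Θ.HasConn τ s then [Ob.conn τ s] else []).symm
  rw [List.nil_append, eV] at e2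
  refine Runs.step trivial (show 1 ≤ Y by omega) ?_ hY2 (b := 97) (by decide) (by decide)
  generalize hs3 : (add 53 3 43).run s2 = s3
  have k3 : ∀ x, x ≠ 53 → s3.reg x = s2.reg x := fun x hx => by rw [← hs3]; simp [run, hx]
  -- Register 53 lies in the range that `Env.congr` wants unchanged, so the fields are transferred
  -- one by one.
  have h3 : Env φ r G D s3 := by
    refine ⟨?_, ?_, ?_, ?_, ?_, ?_, ?_, ?_, ?_, ?_, ?_, ?_, ?_⟩
    · exact (k3 _ (by decide)).trans h2.one
    · exact (k3 _ (by decide)).trans h2.vars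
    · exact (k3 _ (by decide)).trans h2.clauses
    · exact (k3 _ (by decide)).trans h2.zero
    · exact (k3 _ (by decide)).trans h2.mesh
    · exact (k3 _ (by decide)).trans h2.den
    · exact (k3 _ (by decide)).trans h2.base
    · exact (k3 _ (by decide)).trans h2.far
    · exact (k3 _ (by decide)).trans h2.full
    · exact (k3 _ (by decide)).trans h2.mesh_two
    · exact (k3 _ (by decide)).trans h2.six
    · rw [← hs3]; exact h2.input
    · rw [← hs3]; exact h2.pow
  have e3 : Emitted D (Θ.objV.map (Ob.pos Θ G)) s3 :=
    e2.congr (k3 _ (by decide)) (k3 _ (by decide)) (by rw [← hs3]; rfl)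
  have n3 : s3.reg 53 = Θ.objV.length := by
    rw [← hs3]; simp [run, e2.cnt, h2.zero]
  refine Runs.seq_pow hY2 (phase_spec hr hY hbT h3 e3) (b := 96) ?_ (by decide) (by decide)
  intro s4 e4 f4
  have w4 := phase_within r (body := fun τ _ o => slotT (2 * r ^ 3) τ (o + 1))
    fun _ _ _ => slotT_within _ _ _
  have h4 := h3.frame f4 w4 (by decide) (by simp) (by simp)
  refine Runs.seq_pow hY2 (trunk_spec hr hY h4 e4) (b := 95) ?_ (by decide) (by decide)
  intro s5 e5 f5
  have w5 := trunk_within (2 * r ^ 3)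
  have h5 := h4.frame f5 w5 (by decide) (by simp) (by simp)
  have n5 : s5.reg 53 = Θ.objV.length := by
    rw [f5.reg _ (w5.keepsReg (by decide)), f4.reg _ (w4.keepsReg (by decide)), n3]
  have eT : (List.range (2 * r ^ 3)).flatMap (fun τ =>
      (List.range (4 * φ.numVars * blockLen r)).flatMap fun i => pointsT φ r hr G τ (i + 1)) ++
        ((List.range (5 * (2 * r ^ 3))).map fun j => (Ob.trunk (j + 5)).pos Θ G) =
          Θ.objT.map (Ob.pos Θ G) := by
    rw [TrackSystem.objT, List.map_append, hpairs fun τ s => Ob.priv τ s :: if Θ.Check τ s then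
      [Ob.lower τ s, Ob.upper τ s] else [], List.map_map]
    rfl
  rw [List.append_assoc, eT, ← List.map_append] at e5
  have hk := unitBudget_le r
  have hk' := hY.const_sq
  refine Runs.step trivial (show 1 ≤ Y by omega) ?_ hY2 (b := 94) (by decide) (by decide)
  refine Runs.step trivial (show 1 ≤ Y by omega) ?_ hY2 (b := 93) (by decide) (by decide)
  refine Runs.step (addN_loopFree _ _ _) (by rw [addN_cost]; omega) ?_ hY2 (b := 92) (by decide)
    (by decide)
  rw [addN_run _ (by decide) (by decide) (by decide)]
  have hcnt := e5.cnt
  have hptr := e5.ptr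
  rw [List.length_map, List.length_append] at hcnt hptr
  have henc := encode_instanceOf sq φ r hr
  rw [← hG, ← hD, ← hΘ] at henc
  refine Runs.loopFree_pow (by simp [LoopFree]) (by simp [cost]; omega) (by decide) ⟨?_, fun j => ?_⟩
  · rw [henc]
    rw [List.length_cons, List.length_cons, List.length_cons, length_flatMap_record,
      List.length_map, List.length_append]
    simp [run, hptr, h5.one]; ring
  · rw [henc]
    have ho := e5.out j
    rcases j with _ | _ | _ | j
    · simp [run, h5.zero, h5.one, h5.vars, budget_eq, hΘ, mul_comm]
    · simp [run, h5.zero, h5.one, n5]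
    · simp [run, h5.zero, h5.one, n5, hcnt]
    · simp only [List.getD_cons_succ] at ho ⊢
      rw [← ho]
      simp [run, h5.zero, h5.one]

end Program

end Setup

/-! ## Sizes -/

section Sizes

variable {φ : CNF3} {r Y : ℕ} {hr : 0 < r}

theorem lanes_length (S : ℕ → Bool) (n : ℕ) :
    (lanes S n).length = 2 ^ ((Finset.range n).filter fun x => S x = true).card := by
  induction n with
  | zero => rfl
  | succ n ih =>
    rw [lanes, Finset.range_add_one, Finset.filter_insert]
    split_ifs
    · rw [List.length_append, List.length_map, ih, Finset.card_insert_of_notMem (by simp), pow_succ]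
      ring
    · exact ih

theorem card_filter_mod_le (hr : 0 < r) (N c : ℕ) :
    ((Finset.range N).filter fun x => x % r = c % r).card ≤ N / r + 1 := by
  have h := Nat.count_modEq_card N hr c
  rw [Nat.count_eq_card_filter_range] at h
  have h' : ((Finset.range N).filter fun x => x % r = c % r).card =
      N / r + if c % r < N % r then 1 else 0 := h
  rw [h']; split_ifs <;> omega

/-- A row contains at most three residue classes of at most `N / r + 1` variables each. This is the
only exponential quantity in the number of objects, and its rate tends to 0 as `r` grows. -/
theorem lanes_rowSet_length_le (hr : 0 < r) (ρ N : ℕ) :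
    (lanes (rowSet r ρ) N).length ≤ 2 ^ (3 * (N / r + 1)) := by
  rw [lanes_length]
  refine Nat.pow_le_pow_right (by decide) ?_
  have h : ((Finset.range N).filter fun x => rowSet r ρ x = true) ⊆
      ((Finset.range N).filter fun x => x % r = ρ % r) ∪
      (((Finset.range N).filter fun x => x % r = ρ / r % r) ∪
        ((Finset.range N).filter fun x => x % r = ρ / r / r % r)) := by
    intro x
    simp only [Finset.mem_filter, Finset.mem_union, rowSet, Bool.or_eq_true, decide_eq_true_eq]
    tauto
  refine (Finset.card_le_card h).trans ((Finset.card_union_le _ _).trans ?_)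
  have h1 := Finset.card_union_le ((Finset.range N).filter fun x => x % r = ρ / r % r)
    ((Finset.range N).filter fun x => x % r = ρ / r / r % r)
  have a1 := card_filter_mod_le hr N ρ
  have a2 := card_filter_mod_le hr N (ρ / r)
  have a3 := card_filter_mod_le hr N (ρ / r / r)
  omega

/-- There are `2 * N` literals, and distinctness of the clauses is part of an instance. -/
theorem clauses_length_le (φ : CNF3) : φ.clauses.length ≤ 8 * φ.numVars ^ 3 := by
  refine φ.nodup.length_le_card.trans (le_of_eq ?_)
  simp [Fintype.card_prod, Fintype.card_fin]; ring

/-- A bound for the quantities that govern the running time of the reduction. -/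
def workBound (r N : ℕ) : ℕ :=
  9 * N ^ 3 + 2 ^ (3 * (N / r + 1)) + (100 * blockLen r ^ 2 + 100 * blockLen r + 1000)

theorem ample_workBound (φ : CNF3) (hr : 0 < r) : Ample φ r (workBound r φ.numVars) := by
  have h1 : φ.numVars ≤ φ.numVars ^ 3 := Nat.le_self_pow (by decide) _
  have h2 := clauses_length_le φ
  refine ⟨?_, ?_, fun ρ => (lanes_rowSet_length_le hr ρ _).trans ?_, ?_, ?_⟩ <;>
    unfold workBound <;> generalize 2 ^ (3 * (φ.numVars / r + 1)) = e <;> omega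

theorem length_blockCands_le (hY : Ample φ r Y) (τ q i s : ℕ) :
    (blockCands φ r τ q i s).length ≤ 2 * Y := by
  have key : ∀ l : List ℕ, (l.flatMap fun a => if laneOK φ (rowSet r (τ / 2)) a = true then
      laneCands (rowSet r (τ / 2)) φ.numVars τ q i s a else []).length ≤ 2 * l.length := by
    intro l
    induction l with
    | nil => simp
    | cons a l ih =>
      rw [List.flatMap_cons, List.length_append, List.length_cons]
      have : (if laneOK φ (rowSet r (τ / 2)) a = true then
          laneCands (rowSet r (τ / 2)) φ.numVars τ q i s a else []).length ≤ 2 := by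
        unfold laneCands
        split_ifs <;> simp
      omega
  exact (key _).trans (Nat.mul_le_mul_left 2 (hY.lanes _))

theorem length_flatMap_le {α β : Type*} {l : List α} {f : α → List β} {c : ℕ}
    (h : ∀ a ∈ l, (f a).length ≤ c) : (l.flatMap f).length ≤ l.length * c := by
  induction l with
  | nil => simp
  | cons a l ih =>
    rw [List.flatMap_cons, List.length_append, List.length_cons, Nat.add_mul, one_mul]
    have h1 := h a List.mem_cons_self
    have h2 := ih fun b hb => h b (List.mem_cons_of_mem _ hb)
    omega

theorem length_pairs_formulaTracks (φ : CNF3) (r : ℕ) (hr : 0 < r) :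
    (formulaTracks φ r hr).pairs.length = 2 * r ^ 3 * (4 * φ.numVars * blockLen r) :=
  length_pairs _

theorem length_objV_le (hY : Ample φ r Y) : (formulaTracks φ r hr).objV.length ≤
    2 * r ^ 3 * (4 * φ.numVars * blockLen r) * (2 * Y + 1) := by
  rw [← length_pairs_formulaTracks φ r hr]
  refine length_flatMap_le fun p _ => ?_
  rw [List.length_append, List.length_map]
  refine Nat.add_le_add (length_blockCands_le hY _ _ _ _) ?_
  split_ifs <;> simp

theorem length_objT_le : (formulaTracks φ r hr).objT.length ≤
    2 * r ^ 3 * (4 * φ.numVars * blockLen r) * 3 + 5 * (2 * r ^ 3) := by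
  rw [← length_pairs_formulaTracks φ r hr, TrackSystem.objT, List.length_append, List.length_map,
    List.length_range]
  refine Nat.add_le_add (length_flatMap_le fun p _ => ?_) le_rfl
  rw [List.length_cons]
  split_ifs <;> simp

/-- The parameter of the instance, per variable. -/
def parameterBound (r : ℕ) : ℕ := unitBudget r + 2 * r ^ 3 * (4 * blockLen r) * 3 + 5 * (2 * r ^ 3)

/-- Budget and terminals count slots, checkpoints and trunk levels, but not candidates; hence they
are linear in `N` for fixed `r`. The summand 1 covers the trunk, which is present even without
variables. -/
theorem parameter_le (sq : Bool) (φ : CNF3) (hr : 0 < r) :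
    (instanceOf sq φ r hr).k + (instanceOf sq φ r hr).t ≤ parameterBound r * (φ.numVars + 1) := by
  have h1 : (instanceOf sq φ r hr).k = φ.numVars * unitBudget r := budget_eq φ r hr
  have h2 : (instanceOf sq φ r hr).t = (formulaTracks φ r hr).objT.length := by
    simp [SteinerInstance.t, instanceOf, TrackSystem.toSteiner]
  rw [h1, h2]
  have h3 := length_objT_le (φ := φ) (r := r) (hr := hr)
  unfold parameterBound
  nlinarith [Nat.zero_le (unitBudget r), Nat.zero_le (r ^ 3 * blockLen r),
    Nat.zero_le (r ^ 3 * φ.numVars)]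

/-! ### The number of bits -/

theorem bitSize_le {w : List ℕ} {c : ℕ} (h : ∀ a ∈ w, a < 2 ^ c) :
    bitSize w ≤ w.length * (c + 1) := by
  have := List.sum_le_card_nsmul (w.map fun a => a.size + 1) (c + 1) (by
    intro x hx
    obtain ⟨a, ha, rfl⟩ := List.mem_map.1 hx
    exact Nat.succ_le_succ (Nat.size_le.2 (h a ha)))
  simpa [bitSize] using this

/-- There are at most `Y ^ 7` cells, each with at most `Y ^ 5` bits. Coordinates are exponential in
`N`, but their bit length is linear in `N` for fixed `r`; the exponents are generous, as only their
independence of `r` matters. -/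
theorem size_instanceOf_le (sq : Bool) (hY : Ample φ r Y) :
    (instanceOf sq φ r hr).size ≤ Y ^ 16 := by
  have hc := hY.const
  have hP := two_mul_cube_le_blockLen r
  have hN := hY.vars
  set L := 4 * φ.numVars * blockLen r with hL
  have hLY : L ≤ Y ^ 2 := by
    rw [hL, pow_two]
    calc 4 * φ.numVars * blockLen r = φ.numVars * (4 * blockLen r) := by ring
      _ ≤ Y * Y := by gcongr; omega
  have hY1 : 1000 ≤ Y := by omega
  have hPL : 2 * r ^ 3 * L ≤ Y ^ 3 := by
    calc 2 * r ^ 3 * L ≤ Y * Y ^ 2 := by gcongr; omega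
      _ = Y ^ 3 := by ring
  have hV : (formulaTracks φ r hr).objV.length ≤ Y ^ 5 := by
    refine (length_objV_le hY).trans ?_
    calc 2 * r ^ 3 * L * (2 * Y + 1) ≤ Y ^ 3 * (Y * Y) := by gcongr; nlinarith
      _ = Y ^ 5 := by ring
  have hT : (formulaTracks φ r hr).objT.length ≤ Y ^ 5 := by
    refine length_objT_le.trans ?_
    have e1 : 5 * (2 * r ^ 3) ≤ Y := by omega
    have e2 : Y ≤ Y ^ 3 := Nat.le_self_pow (by decide) _
    calc 2 * r ^ 3 * L * 3 + 5 * (2 * r ^ 3) ≤ Y ^ 3 * 3 + Y ^ 3 := by gcongr; omega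
      _ = Y ^ 3 * 4 := by ring
      _ ≤ Y ^ 3 * Y ^ 2 := by gcongr; nlinarith
      _ = Y ^ 5 := by ring
  have hK : (formulaTracks φ r hr).budget ≤ Y ^ 5 := by
    rw [budget_eq]
    have := unitBudget_le r
    have := hY.const_sq
    calc φ.numVars * unitBudget r ≤ Y * Y := by gcongr; omega
      _ = Y ^ 2 := by ring
      _ ≤ Y ^ 5 := Nat.pow_le_pow_right (by omega) (by decide)
  have hlt : ∀ a ≤ Y ^ 5, a < 2 ^ Y ^ 5 := fun a ha => lt_of_le_of_lt ha Nat.lt_two_pow_self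
  have hmesh : meshSize r φ.numVars = 2 ^ (2 * blockLen r + 14 + 4 * φ.numVars) := by
    rw [meshSize, pow_add _ (2 * blockLen r + 14), pow_mul 2 4]; norm_num
  have hbig : ∀ z a : ℕ, z ≤ Y ^ 3 → a ≤ 2 * (z * meshSize r φ.numVars) → a < 2 ^ Y ^ 5 := by
    intro z a hz ha
    have e : 2 * (z * meshSize r φ.numVars) < 2 ^ (1 + z + (2 * blockLen r + 14 + 4 * φ.numVars)) := by
      rw [pow_add, pow_add, hmesh, pow_one, mul_assoc]
      have := Nat.lt_two_pow_self (n := z)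
      gcongr
    refine (lt_of_le_of_lt ha e).trans_le (Nat.pow_le_pow_right (by decide) ?_)
    have e2 : Y ≤ Y ^ 3 := Nat.le_self_pow (by decide) _
    have e3 : 8 * Y ^ 3 ≤ Y ^ 5 := by
      calc 8 * Y ^ 3 ≤ Y ^ 2 * Y ^ 3 := by gcongr; nlinarith
        _ = Y ^ 5 := by ring
    omega
  have hpos := meshSize_pos r φ.numVars
  have hcell : ∀ a ∈ (instanceOf sq φ r hr).encode, a < 2 ^ Y ^ 5 := by
    rw [encode_instanceOf]
    intro a ha
    rw [List.mem_cons, List.mem_cons, List.mem_cons, List.mem_flatMap] at ha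
    rcases ha with rfl | rfl | rfl | ⟨p, hp, ha⟩
    · exact hlt _ hK
    · exact hlt _ hV
    · exact hlt _ hT
    · obtain ⟨o, ho, rfl⟩ := List.mem_map.1 hp
      have hobj : o.IsObj (formulaTracks φ r hr) := by
        rcases List.mem_append.1 ho with h | h
        · exact Or.inl (TrackSystem.mem_objV.1 h)
        · exact Or.inr (TrackSystem.mem_objT.1 h)
      have hx := Ob.offX_lt (largeMesh φ r hr) hobj
      have hy := Ob.offY_lt (largeMesh φ r hr) hobj
      have hcol : o.col ≤ L := by
        have hPL' : (formulaTracks φ r hr).L = L := rfl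
        rcases hobj with h | h <;> cases o <;> simp [Ob.IsV, Ob.IsT, Ob.col] at h ⊢ <;> omega
      have hlev : o.lev ≤ 5 * (2 * r ^ 3) + 5 := by
        have hPP : (formulaTracks φ r hr).P = 2 * r ^ 3 := rfl
        rcases hobj with h | h <;> cases o <;>
          simp [Ob.IsV, Ob.IsT, Ob.lev, TrackSystem.Check, hPP] at h ⊢ <;>
          (try split_ifs) <;> omega
      have e2 : Y ≤ Y ^ 3 := Nat.le_self_pow (by decide) _
      have e3 : Y ^ 2 + 2 ≤ Y ^ 3 := by
        calc Y ^ 2 + 2 ≤ Y ^ 2 * 2 := by nlinarith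
          _ ≤ Y ^ 2 * Y := by gcongr; omega
          _ = Y ^ 3 := by ring
      have hX : 2 * (Ob.pos (formulaTracks φ r hr) (meshSize r φ.numVars - 1) o).1 + 1 ≤
          2 * ((L + 1) * meshSize r φ.numVars) := by
        have : o.col * (meshSize r φ.numVars - 1) ≤ L * meshSize r φ.numVars := by gcongr; omega
        simp only [Ob.pos]; rw [Nat.add_mul L]; omega
      have hYc : 2 * (Ob.pos (formulaTracks φ r hr) (meshSize r φ.numVars - 1) o).2 + 1 ≤
          2 * ((5 * (2 * r ^ 3) + 5 + 1) * meshSize r φ.numVars) := by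
        have : o.lev * (meshSize r φ.numVars - 1) ≤ (5 * (2 * r ^ 3) + 5) * meshSize r φ.numVars := by
          gcongr; omega
        simp only [Ob.pos]; rw [Nat.add_mul (5 * (2 * r ^ 3) + 5)]; omega
      have hD : denominator sq r φ.numVars ≤ 2 * (1 * meshSize r φ.numVars) := by
        unfold denominator; split_ifs <;> omega
      simp only [record, List.mem_cons, List.not_mem_nil, or_false] at ha
      rcases ha with rfl | rfl | rfl | rfl | rfl | rfl
      · positivity
      · exact hbig _ _ (by omega) hX
      · exact hbig _ _ (by omega) hD
      · positivity
      · exact hbig _ _ (by omega) hYc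
      · exact hbig _ _ (by omega) hD
  refine (bitSize_le hcell).trans ?_
  have hlen : (instanceOf sq φ r hr).encode.length ≤ Y ^ 7 := by
    rw [encode_instanceOf, List.length_cons, List.length_cons, List.length_cons,
      length_flatMap_record, List.length_map, List.length_append]
    have : 1 ≤ Y ^ 5 := Nat.one_le_pow _ _ (by omega)
    calc _ ≤ Y ^ 5 * 15 := by omega
      _ ≤ Y ^ 5 * Y ^ 2 := by gcongr; nlinarith
      _ = Y ^ 7 := by ring
  have : 1 ≤ Y ^ 5 := Nat.one_le_pow _ _ (by omega)
  calc _ ≤ Y ^ 7 * (Y ^ 5 * 2) := by gcongr; omega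
    _ ≤ Y ^ 7 * (Y ^ 5 * Y ^ 4) := by gcongr; exact le_trans (by omega) (Nat.le_self_pow (by decide) Y)
    _ = Y ^ 16 := by ring

end Sizes

open Filter

/-! ## From an algorithm for Steiner Tree to one for 3-SAT -/

theorem hasSolution_instanceOf {obj : ℚ × ℚ → Set Plane} {sq : Bool}
    (hS : ∀ r N, ShapeGrid obj (meshSize r N) (denominator sq r N)) (φ : CNF3) {r : ℕ}
    (hr : 0 < r) : (instanceOf sq φ r hr).HasSolution obj ↔ φ.Satisfiable := by
  have h := hS r φ.numVars
  rw [← Nat.sub_add_cancel (meshSize_pos r φ.numVars)] at h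
  exact (TrackSystem.hasSolution_iff_feasible (largeMesh φ r hr) _ h).trans
    feasible_iff_satisfiable

/-- The algorithm for 3-SAT that runs the algorithm `p` for Steiner Tree on the instance of the
formula. -/
def Program.satSolver (sq : Bool) (r : ℕ) (p : Program) : Program :=
  reduction sq r ;; p.shift ;; const 1 0 ;; add 0 100 1

/-- Array 50 and register 100 are the shifted input array and input length. Beyond them the
reduction writes nothing to the shifted region, which is therefore still 0. -/
theorem shifted_initState {w : List ℕ} {u : List ℕ} {sq : Bool} {r : ℕ} {σ : State}
    (hf : (Program.reduction sq r).Frame (initState w) σ) (hlen : σ.reg 100 = u.length)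
    (hout : ∀ j, σ.arr 50 j = u.getD j 0) : (initState u).Shifted σ := by
  have hw := Program.reduction_within sq r
  refine ⟨fun x => ?_, fun a => ?_⟩
  · by_cases hx : x = 0
    · subst hx; simpa [initState] using hlen
    · rw [hf.reg _ (hw.keepsReg (by omega))]; simp [initState, hx]
  · by_cases ha : a = 0
    · subst ha; funext j; simpa [initState] using hout j
    · rw [hf.arr _ (hw.keepsArr (by simp; omega))]; funext j; simp [initState, ha]

theorem exec_satSolver {φ : CNF3} {r Y t : ℕ} {sq : Bool} {hr : 0 < r} {p : Program} {s : State}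
    (hY : Ample φ r Y) (h : Exec p (initState (instanceOf sq φ r hr).encode) t s) :
    ∃ t' s', Exec (p.satSolver sq r) (initState φ.encode) t' s' ∧ t' ≤ Y ^ 100 + t + 2 ∧
      s'.reg 0 = s.reg 0 := by
  obtain ⟨t1, s1, h1, h2, ⟨h3, h4⟩, h5⟩ := (Program.reduction_spec sq hr hY).frame
  obtain ⟨s2, h6, h7⟩ := h.shift s1 (shifted_initState h5 h3 h4)
  refine ⟨_, _, .seq h1 (.seq h6 (.seq (.const _ _ _) (.add _ _ _ _))), by omega, ?_⟩
  have := h7.1 0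
  simpa using this

/-! ## Asymptotics -/

theorem pow_le_const_mul_rpow (k : ℕ) {η : ℝ} (hη : 0 < η) :
    ∃ κ : ℝ, 0 < κ ∧ ∀ N : ℕ, (N : ℝ) ^ k ≤ κ * (2 : ℝ) ^ (η * N) := by
  have h1 : 1 < (2 : ℝ) ^ η := Real.one_lt_rpow (by norm_num) hη
  have h2 := (isLittleO_pow_const_const_pow_of_one_lt (R := ℝ) k h1).isBigO
  rw [Asymptotics.isBigO_nat_atTop_iff fun n hn => by
    have : 0 < ((2 : ℝ) ^ η) ^ n := by positivity
    exact absurd hn this.ne'] at h2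
  obtain ⟨C, hC⟩ := h2
  refine ⟨max C 1, by positivity, fun N => ?_⟩
  have h3 := hC N
  rw [Real.norm_of_nonneg (by positivity), Real.norm_of_nonneg (by positivity)] at h3
  rw [Real.rpow_mul (by norm_num), Real.rpow_natCast]
  exact h3.trans (by gcongr; exact le_max_left _ _)

/-- For fixed `r` the polynomial and constant terms are absorbed into `κ`, and what remains is the
rate `3 / r` of the partial assignments of a row. -/
theorem workBound_le {r : ℕ} (hr : 0 < r) :
    ∃ κ : ℝ, 0 < κ ∧ ∀ N : ℕ, (workBound r N : ℝ) ≤ κ * (2 : ℝ) ^ (3 / (r : ℝ) * N) := by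
  have hr' : (0 : ℝ) < r := by exact_mod_cast hr
  obtain ⟨κ, hκ, h⟩ := pow_le_const_mul_rpow 3 (η := 3 / r) (by positivity)
  refine ⟨9 * κ + 8 + (100 * blockLen r ^ 2 + 100 * blockLen r + 1000), by positivity, fun N => ?_⟩
  have h1 : (1 : ℝ) ≤ (2 : ℝ) ^ (3 / (r : ℝ) * N) :=
    Real.one_le_rpow (by norm_num) (by positivity)
  have h2 : (2 : ℝ) ^ (3 * (N / r + 1)) ≤ 8 * (2 : ℝ) ^ (3 / (r : ℝ) * N) := by
    rw [Nat.mul_add, pow_add, mul_comm]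
    have : (2 : ℝ) ^ (3 * (N / r)) ≤ (2 : ℝ) ^ (3 / (r : ℝ) * N) := by
      rw [← Real.rpow_natCast]
      refine Real.rpow_le_rpow_of_exponent_le (by norm_num) ?_
      push_cast
      have := Nat.cast_div_le (α := ℝ) (m := N) (n := r)
      calc 3 * ((N / r : ℕ) : ℝ) ≤ 3 * ((N : ℝ) / r) := by gcongr
        _ = 3 / (r : ℝ) * N := by ring
    norm_num; linarith
  have h3 : (100 * blockLen r ^ 2 + 100 * blockLen r + 1000 : ℝ) ≤
      (100 * blockLen r ^ 2 + 100 * blockLen r + 1000) * (2 : ℝ) ^ (3 / (r : ℝ) * N) :=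
    le_mul_of_one_le_right (by positivity) h1
  have h4 := h N
  unfold workBound
  push_cast
  nlinarith

theorem rpow_le_const_mul_rpow {Y κ η N δ a : ℝ} (hY : 0 ≤ Y) (hκ : 0 < κ) (hN : 0 ≤ N)
    (ha : 0 ≤ a) (h : Y ≤ κ * (2 : ℝ) ^ (η * N)) (hδ : η * a ≤ δ) :
    Y ^ a ≤ κ ^ a * (2 : ℝ) ^ (δ * N) :=
  calc Y ^ a ≤ (κ * (2 : ℝ) ^ (η * N)) ^ a := by gcongr
    _ = κ ^ a * (2 : ℝ) ^ (η * a * N) := by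
      rw [Real.mul_rpow hκ.le (by positivity), ← Real.rpow_mul (by norm_num)]; ring_nf
    _ ≤ κ ^ a * (2 : ℝ) ^ (δ * N) := by gcongr; norm_num

/-- A solver for Steiner Tree composed with the reduction would decide 3-SAT in time `O(2 ^ (δ N))`.
The exponent is split evenly between the parameter and the factor `n ^ b`. -/
theorem uniformExponentialLowerBound (hETH : ETH) {obj : ℚ × ℚ → Set Plane} (sq : Bool)
    (hS : ∀ r N, ShapeGrid obj (meshSize r N) (denominator sq r N)) :
    UniformExponentialLowerBound obj := by
  obtain ⟨δ, hδ, hno⟩ := hETH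
  intro b hb
  -- With `Y` of rate `3 / r`, the reduction takes time `Y ^ 100` of rate `300 / r ≤ δ`, and `n ^ b
  -- ≤ Y ^ (16 b)` has rate `48 b / r ≤ δ / 2`.
  obtain ⟨r, hr⟩ := exists_nat_gt ((300 + 96 * b) / δ)
  have hr0 : 0 < r := by
    have : (0 : ℝ) < r := lt_trans (by positivity) hr
    exact_mod_cast this
  have hr0' : (0 : ℝ) < r := by exact_mod_cast hr0
  have hδr : 300 + 96 * b < δ * r := by
    rw [div_lt_iff₀ hδ] at hr; linarith
  have e1 : 3 / (r : ℝ) * 100 ≤ δ := by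
    rw [div_mul_eq_mul_div, div_le_iff₀ hr0']; nlinarith
  have e2 : 3 / (r : ℝ) * (16 * b) ≤ δ / 2 := by
    rw [div_mul_eq_mul_div, div_le_iff₀ hr0']; nlinarith
  set c : ℝ := parameterBound r + 1 with hc
  have hc0 : 0 < c := by positivity
  -- As `k + t ≤ c (N + 1)`, this `ε` gives the parameter part the rate `δ / 2`. It depends on `b`
  -- through `r`, but not on `C`.
  refine ⟨δ / (2 * c), by positivity, fun C hC => ?_⟩
  rintro ⟨p, hp⟩
  refine hno ?_
  obtain ⟨κ, hκ, hwork⟩ := workBound_le hr0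
  refine ⟨κ ^ (100 : ℝ) + C * (2 : ℝ) ^ (δ / 2) * κ ^ (16 * b) + 2, by positivity, p.satSolver sq r,
    fun φ => ?_⟩
  obtain ⟨t, s, h1, h2, h3⟩ := hp (instanceOf sq φ r hr0)
  have hA := ample_workBound φ hr0
  obtain ⟨t', s', h4, h5, h6⟩ := exec_satSolver hA h1
  refine ⟨t', s', h4, ?_, by rw [h6, h3, hasSolution_instanceOf hS]⟩
  obtain ⟨N, hN⟩ : ∃ N : ℝ, N = (φ.numVars : ℝ) := ⟨_, rfl⟩
  have hN0 : 0 ≤ N := by rw [hN]; exact Nat.cast_nonneg _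
  have hsize := size_instanceOf_le (r := r) (hr := hr0) sq hA
  have hpar := parameter_le sq φ hr0
  have hY := hwork φ.numVars
  beta_reduce at h2 ⊢
  rw [← hN] at hY ⊢
  generalize workBound r φ.numVars = y at *
  generalize instanceOf sq φ r hr0 = I at *
  have hY0 : (0 : ℝ) ≤ y := Nat.cast_nonneg _
  have b1 := rpow_le_const_mul_rpow hY0 hκ hN0 (by norm_num) hY e1
  have b2 : (2 : ℝ) ^ (δ / (2 * c) * ((I.k + I.t : ℕ) : ℝ)) ≤
      (2 : ℝ) ^ (δ / 2) * (2 : ℝ) ^ (δ / 2 * N) := by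
    rw [← Real.rpow_add (by norm_num)]
    refine Real.rpow_le_rpow_of_exponent_le (by norm_num) ?_
    have hpar' : ((I.k + I.t : ℕ) : ℝ) ≤ c * (N + 1) := by
      calc _ ≤ ((parameterBound r * (φ.numVars + 1) : ℕ) : ℝ) := by exact_mod_cast hpar
        _ = (parameterBound r : ℝ) * (N + 1) := by rw [hN]; push_cast; rfl
        _ ≤ c * (N + 1) := by gcongr; linarith
    calc _ ≤ δ / (2 * c) * (c * (N + 1)) := by gcongr
      _ = δ / 2 + δ / 2 * N := by field_simp; ring
  have b3 : (I.size : ℝ) ^ b ≤ κ ^ (16 * b) * (2 : ℝ) ^ (δ / 2 * N) := by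
    have hsize' : (I.size : ℝ) ≤ (y : ℝ) ^ (16 : ℝ) := by
      rw [show (16 : ℝ) = ((16 : ℕ) : ℝ) by norm_num, Real.rpow_natCast]
      exact_mod_cast hsize
    calc (I.size : ℝ) ^ b ≤ ((y : ℝ) ^ (16 : ℝ)) ^ b := by gcongr
      _ = (y : ℝ) ^ (16 * b) := by rw [← Real.rpow_mul hY0]
      _ ≤ _ := rpow_le_const_mul_rpow hY0 hκ hN0 (by positivity) hY e2
  have b4 : (t : ℝ) ≤ C * (2 : ℝ) ^ (δ / 2) * κ ^ (16 * b) * (2 : ℝ) ^ (δ * N) := by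
    refine h2.trans ?_
    calc _ ≤ C * ((2 : ℝ) ^ (δ / 2) * (2 : ℝ) ^ (δ / 2 * N)) *
          (κ ^ (16 * b) * (2 : ℝ) ^ (δ / 2 * N)) := by gcongr
      _ = C * (2 : ℝ) ^ (δ / 2) * κ ^ (16 * b) *
          ((2 : ℝ) ^ (δ / 2 * N) * (2 : ℝ) ^ (δ / 2 * N)) := by ring
      _ = _ := by rw [← Real.rpow_add (by norm_num)]; ring_nf
  have b5 : (1 : ℝ) ≤ (2 : ℝ) ^ (δ * N) := Real.one_le_rpow (by norm_num) (by positivity)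
  have b6 : (t' : ℝ) ≤ (y : ℝ) ^ (100 : ℝ) + t + 2 := by
    rw [show (100 : ℝ) = ((100 : ℕ) : ℝ) by norm_num, Real.rpow_natCast]
    exact_mod_cast h5
  calc (t' : ℝ) ≤ κ ^ (100 : ℝ) * (2 : ℝ) ^ (δ * N) +
        C * (2 : ℝ) ^ (δ / 2) * κ ^ (16 * b) * (2 : ℝ) ^ (δ * N) + 2 * (2 : ℝ) ^ (δ * N) := by
        linarith
    _ = _ := by ring

theorem SteinerInstance.one_le_size (I : SteinerInstance) : 1 ≤ I.size := by
  simp only [SteinerInstance.size, SteinerInstance.encode, bitSize, List.map_cons, List.sum_cons]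
  omega

theorem SolvableInTime.mono {Inst : Type} {enc : Inst → List ℕ} {yes : Inst → Prop}
    {f g : Inst → ℝ} (h : SolvableInTime enc yes f) (hfg : ∀ I, f I ≤ g I) :
    SolvableInTime enc yes g := by
  obtain ⟨p, hp⟩ := h
  refine ⟨p, fun I => ?_⟩
  obtain ⟨t, s, h1, h2, h3⟩ := hp I
  exact ⟨t, s, h1, h2.trans (hfg I), h3⟩

/-- A function in `o(m)` is at most `ε m + c`: eventually by definition, and the finitely many
exceptions go into `c`, which only changes the constant factor. -/
theorem UniformExponentialLowerBound.noSubexponentialAlgorithm {obj : ℚ × ℚ → Set Plane}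
    (h : UniformExponentialLowerBound obj) : NoSubexponentialAlgorithm obj := by
  rintro ⟨f, C, b, hf, hsolve⟩
  -- The given `b` and `C` need not be positive; as the size is at least 1, both may be raised to at
  -- least 1.
  obtain ⟨ε, hε, hno⟩ := h (max b 1) (by positivity)
  obtain ⟨m₀, hm₀⟩ := eventually_atTop.1 (hf.bound hε)
  obtain ⟨c, hc0, hc⟩ : ∃ c : ℝ, 0 ≤ c ∧ ∀ m, f m ≤ ε * m + c := by
    refine ⟨∑ i ∈ Finset.range m₀, |f i|, Finset.sum_nonneg fun _ _ => abs_nonneg _, fun m => ?_⟩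
    have h0 : 0 ≤ ∑ i ∈ Finset.range m₀, |f i| := Finset.sum_nonneg fun _ _ => abs_nonneg _
    rcases lt_or_ge m m₀ with hm | hm
    · have h1 := Finset.single_le_sum (f := fun i => |f i|) (fun i _ => abs_nonneg _)
        (Finset.mem_range.2 hm)
      have h2 := le_abs_self (f m)
      have h3 : 0 ≤ ε * m := by positivity
      linarith
    · have h1 := hm₀ m hm
      rw [Real.norm_eq_abs, Real.norm_of_nonneg (by positivity)] at h1
      have h2 := le_abs_self (f m)
      linarith
  refine hno (max C 1 * (2 : ℝ) ^ c) (by positivity) (hsolve.mono fun I => ?_)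
  have hn : (1 : ℝ) ≤ I.size := by exact_mod_cast I.one_le_size
  calc C * (2 : ℝ) ^ f (I.k + I.t) * (I.size : ℝ) ^ b
      ≤ max C 1 * (2 : ℝ) ^ (ε * ((I.k + I.t : ℕ) : ℝ) + c) * (I.size : ℝ) ^ (max b 1) := by
        gcongr
        · exact le_max_left _ _
        · norm_num
        · exact hc _
        · exact le_max_left _ _
    _ = _ := by rw [Real.rpow_add (by norm_num)]; ring

end GeomSteiner

theorem mainTheorem5 (hETH : GeomSteiner.ETH) :
    (GeomSteiner.NoSubexponentialAlgorithm GeomSteiner.unitSquare ∧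
      GeomSteiner.NoSubexponentialAlgorithm GeomSteiner.unitDisk) ∧
    (GeomSteiner.UniformExponentialLowerBound GeomSteiner.unitSquare ∧
      GeomSteiner.UniformExponentialLowerBound GeomSteiner.unitDisk) := by
  have h1 := GeomSteiner.uniformExponentialLowerBound hETH true fun r N =>
    GeomSteiner.shapeGrid_unitSquare (GeomSteiner.meshSize_pos r N)
  have h2 := GeomSteiner.uniformExponentialLowerBound hETH false fun r N =>
    GeomSteiner.shapeGrid_unitDisk (GeomSteiner.meshSize_pos r N)
  exact ⟨⟨h1.noSubexponentialAlgorithm, h2.noSubexponentialAlgorithm⟩, h1, h2⟩
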